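/- **Groupoids of families.** For a groupoid $A$ let $\mathsf S A$ be the free symmetric monoidal groupoid on $A$: its objects are the finite sequences $(a_1,\dots,a_n)$, $n\ge 0$, of objects of $A$, and a morphism $(a_1,\dots,a_n)\to(b_1,\dots,b_n)$ is a permutation $\sigma\in\mathfrak S_n$ together with morphisms $a_i\to b_{\sigma(i)}$ of $A$ (there are no morphisms between sequences of different lengths). Let $\mathsf S^{\mathrm r}A\subseteq\mathsf S A$ be the full subgroupoid of the nonempty sequences. Both are strong monads on the category of (small) groupoids: the unit is $a\mapsto (a)$, the multiplication is concatenation in lexicographic order, and the strength is $(a,(b_i)_i)\mapsto((a,b_i))_i$. The inclusion $\mathsf S^{\mathrm r}\to\mathsf S$ is a map of monads. Fibre products of groupoids are strict fibre products. **Operads.** Let $P$ be a monad on groupoids. A (one-coloured) $P$-operad is a groupoid $Q$ with a map $s\colon Q\to P1$, a unit $1\to Q$ over the unit $1\to P1$ of $P$, and a composition $PQ\times_{P1}Q\to Q$, $((x_i)_i,y)\mapsto y\circ(x_i)_i$, over $P1$, subject to associativity and unit laws. It defines a monad $\mathsf Q$, $\mathsf QX=PX\times_{P1}Q$, with a map of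 monads $\mathsf Q\to P$ (the projection). $\mathsf{Sym}$ is the terminal $\mathsf S^{\mathrm r}$-operad, $Q=\mathsf S^{\mathrm r}1$ with $s$ the identity. **The $\mathcal T$-construction.** Let $P=\mathsf S^{\mathrm r}$. For a one-coloured $P$-operad $Q$, the groupoid $Q$ is a strict monoid under $x\cdot y=y\circ(x,\dots,x)$, where the strength is used to place $x$ at every input of $y$. For a strict monoid $Y$ in groupoids, there is a one-coloured $P$-operad with groupoid of operations $PY$, with $s=P(Y\to 1)$, with unit the one-member family of the unit of $Y$, and with composition sending families of families $(\zeta_i)_i$, $\zeta_i\in PY$, and a family $(f_i)_i\in PY$ with the same indexing to the concatenation of the families $\zeta_i\cdot f_i$, where $\zeta\cdot f$ is obtained from $\zeta$ by multiplying every member on the right by $f$. Let $\mathcal T^{\mathsf S^{\mathrm r}}(\mathsf{Sym})$ be the operad so obtained from the monoid of operations of $\mathsf{Sym}$. **Bar construction.** Let $Q$ be a one-coloured $P$-operad with monad $\mathsf Q$, and let $P\to R$ be a map of monads. The two-sided bar construction $\mathcal B^{R}Q$ is the simplicial groupoid with $n$-simplices $R\mathsf Q^n1$. Its bottom face maps are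 induced by the map $\mathsf Q1\to1$ on the innermost copy of $\mathsf Q$, its inner face maps by the multiplication $\mathsf Q\mathsf Q\to\mathsf Q$, its top face maps by the action $R\mathsf Q\to RR\to R$, and its degeneracies by the unit of $\mathsf Q$. Write $\mathcal B Q=\mathcal B^{P}Q$. **The simplicial groupoid $T\mathbf S$.** An object of $T_n\mathbf S$ is a commutative diagram of finite sets $t_{ij}$ ($0\le i\le j\le n$) and surjections $$t_{ij}\to t_{i,j-1}\ (i<j),\qquad t_{ij}\to t_{i+1,j}\ (i<j),\qquad t_{ii}\to t_{i+1,i+1}\ (i<n)$$ (a pyramid with peak $t_{0n}$, in which in particular $t_{i,i+1}\to t_{ii}\to t_{i+1,i+1}$ equals $t_{i,i+1}\to t_{i+1,i+1}$), all of whose squares, formed by $t_{ij}$, $t_{i,j-1}$, $t_{i+1,j}$, $t_{i+1,j-1}$ for $i+1\le j-1$, are pullbacks of sets. Morphisms are levelwise bijections compatible with the diagram. The face map $d_i$ removes all the sets with an index equal to $i$, and the degeneracy map $s_i$ repeats the sets with index $i$. Let $T\mathbf S_{>0}\subseteq T\mathbf S$ be the full simplicial subgroupoid of the pyramids of nonempty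 sets. Two simplicial groupoids are called equivalent if there is a simplicial map from the first to the second which is an equivalence of groupoids in every simplicial degree. **Proposition.** There are equivalences of simplicial groupoids $$\mathcal B^{\mathsf S}\,\mathcal T^{\mathsf S^{\mathrm r}}(\mathsf{Sym})\ \simeq\ T\mathbf S \qquad\text{and}\qquad \mathcal B\,\mathcal T^{\mathsf S^{\mathrm r}}(\mathsf{Sym})\ \simeq\ T\mathbf S_{>0}.$$ -/

import Mathlib

open CategoryTheory Limits MonoidalCategory CartesianMonoidalCategory

namespace Plethysm

universe v u

set_option linter.unusedSectionVars false
set_option linter.unusedSimpArgs false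
set_option linter.unusedVariables false

/-- A pullback square with a specified apex and specified projections. -/
structure Pb {E : Type u} [Category.{v} E] {X Y Z : E} (f : X ⟶ Z) (g : Y ⟶ Z) where
  obj : E
  fst : obj ⟶ X
  snd : obj ⟶ Y
  isPullback : IsPullback fst snd f g

/-- A choice of pullbacks in a category. -/
class ChosenPullbacks (E : Type u) [Category.{v} E] where
  choose : ∀ {X Y Z : E} (f : X ⟶ Z) (g : Y ⟶ Z), Pb f g

section Pullbacks

variable {E : Type u} [Category.{v} E] [ChosenPullbacks E] {W V X Y Z : E}

/-- The chosen fibre product `X ×_Z Y`. -/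
def pb (f : X ⟶ Z) (g : Y ⟶ Z) : E := (ChosenPullbacks.choose f g).obj

variable (f : X ⟶ Z) (g : Y ⟶ Z)

def pb₁ : pb f g ⟶ X := (ChosenPullbacks.choose f g).fst

def pb₂ : pb f g ⟶ Y := (ChosenPullbacks.choose f g).snd

theorem pb_isPullback : IsPullback (pb₁ f g) (pb₂ f g) f g :=
  (ChosenPullbacks.choose f g).isPullback

theorem pb_condition : pb₁ f g ≫ f = pb₂ f g ≫ g := (pb_isPullback f g).w

variable {f g}

noncomputable def pbLift (a : W ⟶ X) (b : W ⟶ Y) (h : a ≫ f = b ≫ g) : W ⟶ pb f g :=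
  (pb_isPullback f g).lift a b h

theorem pbLift_fst (a : W ⟶ X) (b : W ⟶ Y) (h : a ≫ f = b ≫ g) :
    pbLift a b h ≫ pb₁ f g = a := (pb_isPullback f g).lift_fst a b h

theorem pbLift_fst_assoc (a : W ⟶ X) (b : W ⟶ Y) (h : a ≫ f = b ≫ g) {V' : E} (v : _ ⟶ V') :
    pbLift a b h ≫ pb₁ f g ≫ v = a ≫ v := by
  simpa only [Category.assoc] using congrArg (fun z => z ≫ v) (pbLift_fst a b h)

theorem pbLift_snd (a : W ⟶ X) (b : W ⟶ Y) (h : a ≫ f = b ≫ g) :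
    pbLift a b h ≫ pb₂ f g = b := (pb_isPullback f g).lift_snd a b h

theorem pbLift_snd_assoc (a : W ⟶ X) (b : W ⟶ Y) (h : a ≫ f = b ≫ g) {V' : E} (v : _ ⟶ V') :
    pbLift a b h ≫ pb₂ f g ≫ v = b ≫ v := by
  simpa only [Category.assoc] using congrArg (fun z => z ≫ v) (pbLift_snd a b h)

attribute [simp] pbLift_fst pbLift_fst_assoc pbLift_snd pbLift_snd_assoc

theorem pb_ext {a b : W ⟶ pb f g} (h₁ : a ≫ pb₁ f g = b ≫ pb₁ f g)
    (h₂ : a ≫ pb₂ f g = b ≫ pb₂ f g) : a = b :=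
  (pb_isPullback f g).hom_ext h₁ h₂

end Pullbacks

/-- A strong monad: a monad `P` on a category with finite products together with a strength
`A ⊗ P B ⟶ P (A ⊗ B)`. -/
structure StrongMonad (E : Type u) [Category.{v} E] [CartesianMonoidalCategory E]
    extends Monad E where
  str : ∀ A B : E, A ⊗ toMonad.obj B ⟶ toMonad.obj (A ⊗ B)
  str_natural : ∀ {A A' B B' : E} (f : A ⟶ A') (g : B ⟶ B'),
    (f ⊗ₘ toMonad.map g) ≫ str A' B' = str A B ≫ toMonad.map (f ⊗ₘ g)
  str_unit : ∀ A : E, str (𝟙_ E) A ≫ toMonad.map (λ_ A).hom = (λ_ (toMonad.obj A)).hom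
  str_assoc : ∀ A B C : E, str (A ⊗ B) C ≫ toMonad.map (α_ A B C).hom =
    (α_ A B (toMonad.obj C)).hom ≫ A ◁ str B C ≫ str A (B ⊗ C)
  str_η : ∀ A B : E, A ◁ toMonad.η.app B ≫ str A B = toMonad.η.app (A ⊗ B)
  str_μ : ∀ A B : E, A ◁ toMonad.μ.app B ≫ str A B =
    str A (toMonad.obj B) ≫ toMonad.map (str A B) ≫ toMonad.μ.app (A ⊗ B)

/-- The functor underlying `P` preserves the pullback squares
`A ⊗ B = A ×_𝟙 B` over the terminal object. -/
class PreservesProductSquares {E : Type u} [Category.{v} E] [CartesianMonoidalCategory E]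
    (P : Monad E) : Prop where
  isPullback : ∀ A B : E, IsPullback (P.map (fst A B)) (P.map (snd A B))
    (P.map (toUnit A)) (P.map (toUnit B))

section Operads

variable {E : Type u} [Category.{v} E] [CartesianMonoidalCategory E] [ChosenPullbacks E]

/-- An object of operations `Q`, each with a source in `P 𝟙`. -/
structure Collection (P : Monad E) where
  Q : E
  s : Q ⟶ P.obj (𝟙_ E)

namespace Collection

variable {P : Monad E} (C : Collection P)

/-- `C.ext X = P X ×_{P 𝟙} Q`: operations whose inputs are labelled by `X`. -/
def ext (X : E) : E := pb (P.map (toUnit X)) C.s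

def labels (X : E) : C.ext X ⟶ P.obj X := pb₁ _ _

def op (X : E) : C.ext X ⟶ C.Q := pb₂ _ _

theorem ext_condition (X : E) : C.labels X ≫ P.map (toUnit X) = C.op X ≫ C.s :=
  pb_condition _ _

theorem ext_condition_assoc (X : E) {V' : E} (v : _ ⟶ V') :
    C.labels X ≫ P.map (toUnit X) ≫ v = C.op X ≫ C.s ≫ v := by
  simpa only [Category.assoc] using congrArg (fun z => z ≫ v) (ext_condition C X)

noncomputable def extLift {W X : E} (a : W ⟶ P.obj X) (b : W ⟶ C.Q)
    (h : a ≫ P.map (toUnit X) = b ≫ C.s) : W ⟶ C.ext X := pbLift a b h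

theorem extLift_labels {W X : E} (a : W ⟶ P.obj X) (b : W ⟶ C.Q)
    (h : a ≫ P.map (toUnit X) = b ≫ C.s) : C.extLift a b h ≫ C.labels X = a :=
  pbLift_fst _ _ _

theorem extLift_labels_assoc {W X : E} (a : W ⟶ P.obj X) (b : W ⟶ C.Q)
    (h : a ≫ P.map (toUnit X) = b ≫ C.s) {V' : E} (v : _ ⟶ V') :
    C.extLift a b h ≫ C.labels X ≫ v = a ≫ v := by
  simpa only [Category.assoc] using congrArg (fun z => z ≫ v) (extLift_labels C a b h)

theorem extLift_op {W X : E} (a : W ⟶ P.obj X) (b : W ⟶ C.Q)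
    (h : a ≫ P.map (toUnit X) = b ≫ C.s) : C.extLift a b h ≫ C.op X = b :=
  pbLift_snd _ _ _

theorem extLift_op_assoc {W X : E} (a : W ⟶ P.obj X) (b : W ⟶ C.Q)
    (h : a ≫ P.map (toUnit X) = b ≫ C.s) {V' : E} (v : _ ⟶ V') :
    C.extLift a b h ≫ C.op X ≫ v = b ≫ v := by
  simpa only [Category.assoc] using congrArg (fun z => z ≫ v) (extLift_op C a b h)

attribute [simp] extLift_labels extLift_labels_assoc extLift_op extLift_op_assoc

theorem ext_hom {W X : E} {a b : W ⟶ C.ext X} (h₁ : a ≫ C.labels X = b ≫ C.labels X)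
    (h₂ : a ≫ C.op X = b ≫ C.op X) : a = b := pb_ext h₁ h₂

theorem map_toUnit {X Y : E} (f : X ⟶ Y) : P.map f ≫ P.map (toUnit Y) = P.map (toUnit X) := by
  rw [← P.map_comp, comp_toUnit]

noncomputable def extMap {X Y : E} (f : X ⟶ Y) : C.ext X ⟶ C.ext Y :=
  C.extLift (C.labels X ≫ P.map f) (C.op X) (by
    rw [Category.assoc, map_toUnit, ext_condition])

theorem extMap_labels {X Y : E} (f : X ⟶ Y) :
    C.extMap f ≫ C.labels Y = C.labels X ≫ P.map f := extLift_labels _ _ _ _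

theorem extMap_labels_assoc {X Y : E} (f : X ⟶ Y) {V' : E} (v : _ ⟶ V') :
    C.extMap f ≫ C.labels Y ≫ v = C.labels X ≫ P.map f ≫ v := by
  simpa only [Category.assoc] using congrArg (fun z => z ≫ v) (extMap_labels C f)

theorem extMap_op {X Y : E} (f : X ⟶ Y) : C.extMap f ≫ C.op Y = C.op X := extLift_op _ _ _ _

theorem extMap_op_assoc {X Y : E} (f : X ⟶ Y) {V' : E} (v : _ ⟶ V') :
    C.extMap f ≫ C.op Y ≫ v = C.op X ≫ v := by
  simpa only [Category.assoc] using congrArg (fun z => z ≫ v) (extMap_op C f)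

attribute [simp] extMap_labels extMap_labels_assoc extMap_op extMap_op_assoc

theorem extMap_id (X : E) : C.extMap (𝟙 X) = 𝟙 _ := by
  apply C.ext_hom <;> simp

theorem extMap_comp {X Y Z : E} (f : X ⟶ Y) (g : Y ⟶ Z) :
    C.extMap (f ≫ g) = C.extMap f ≫ C.extMap g := by
  apply C.ext_hom <;> simp

theorem extMap_comp_assoc {X Y Z : E} (f : X ⟶ Y) (g : Y ⟶ Z) {V' : E} (v : _ ⟶ V') :
    C.extMap (f ≫ g) ≫ v = C.extMap f ≫ C.extMap g ≫ v := by
  simpa only [Category.assoc] using congrArg (fun z => z ≫ v) (extMap_comp C f g)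

end Collection

/-- A collection with a multiplication `P Q ×_{P 𝟙} Q ⟶ Q` and a unit, compatible with sources. -/
structure PreOperad (P : Monad E) extends Collection P where
  e : 𝟙_ E ⟶ Q
  m : toCollection.ext Q ⟶ Q
  e_s : e ≫ s = P.η.app (𝟙_ E)
  m_s : m ≫ s = toCollection.labels Q ≫ P.map s ≫ P.μ.app (𝟙_ E)

namespace PreOperad

variable {P : Monad E} (O : PreOperad P)

noncomputable def extη (X : E) : X ⟶ O.ext X :=
  O.extLift (P.η.app X) (toUnit X ≫ O.e) (by
    rw [Category.assoc, e_s, ← P.unit_naturality])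

theorem extη_labels (X : E) : O.extη X ≫ O.labels X = P.η.app X := O.extLift_labels _ _ _

theorem extη_labels_assoc (X : E) {V' : E} (v : _ ⟶ V') :
    O.extη X ≫ O.labels X ≫ v = P.η.app X ≫ v := by
  simpa only [Category.assoc] using congrArg (fun z => z ≫ v) (extη_labels O X)

theorem extη_op (X : E) : O.extη X ≫ O.op X = toUnit X ≫ O.e := O.extLift_op _ _ _

theorem extη_op_assoc (X : E) {V' : E} (v : _ ⟶ V') :
    O.extη X ≫ O.op X ≫ v = toUnit X ≫ O.e ≫ v := by
  simpa only [Category.assoc] using congrArg (fun z => z ≫ v) (extη_op O X)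

attribute [simp] extη_labels extη_labels_assoc extη_op extη_op_assoc

noncomputable def extμ (X : E) : O.ext (O.ext X) ⟶ O.ext X :=
  O.extLift (O.labels (O.ext X) ≫ P.map (O.labels X) ≫ P.μ.app X)
    (O.extMap (O.op X) ≫ O.m) (by
      simp only [Category.assoc, m_s, Collection.extMap_labels_assoc]
      rw [← P.mu_naturality]
      simp only [← P.map_comp_assoc, O.ext_condition])

theorem extμ_labels (X : E) : O.extμ X ≫ O.labels X =
    O.labels (O.ext X) ≫ P.map (O.labels X) ≫ P.μ.app X := O.extLift_labels _ _ _

theorem extμ_labels_assoc (X : E) {V' : E} (v : _ ⟶ V') :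
    O.extμ X ≫ O.labels X ≫ v = O.labels (O.ext X) ≫ P.map (O.labels X) ≫ P.μ.app X ≫ v := by
  simpa only [Category.assoc] using congrArg (fun z => z ≫ v) (extμ_labels O X)

theorem extμ_op (X : E) : O.extμ X ≫ O.op X = O.extMap (O.op X) ≫ O.m := O.extLift_op _ _ _

theorem extμ_op_assoc (X : E) {V' : E} (v : _ ⟶ V') :
    O.extμ X ≫ O.op X ≫ v = O.extMap (O.op X) ≫ O.m ≫ v := by
  simpa only [Category.assoc] using congrArg (fun z => z ≫ v) (extμ_op O X)

attribute [simp] extμ_labels extμ_labels_assoc extμ_op extμ_op_assoc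

theorem extη_natural {X Y : E} (f : X ⟶ Y) : f ≫ O.extη Y = O.extη X ≫ O.extMap f := by
  apply O.ext_hom
  · simp [P.unit_naturality]
  · simp

theorem extη_natural_assoc {X Y : E} (f : X ⟶ Y) {V' : E} (v : _ ⟶ V') :
    f ≫ O.extη Y ≫ v = O.extη X ≫ O.extMap f ≫ v := by
  simpa only [Category.assoc] using congrArg (fun z => z ≫ v) (extη_natural O f)

theorem extμ_natural {X Y : E} (f : X ⟶ Y) :
    O.extMap (O.extMap f) ≫ O.extμ Y = O.extμ X ≫ O.extMap f := by
  apply O.ext_hom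
  · simp only [Category.assoc, extμ_labels, O.extMap_labels, O.extMap_labels_assoc,
      extμ_labels_assoc, ← P.mu_naturality]
    simp only [← P.map_comp_assoc, O.extMap_labels]
  · simp [← O.extMap_comp_assoc]

theorem extμ_natural_assoc {X Y : E} (f : X ⟶ Y) {V' : E} (v : _ ⟶ V') :
    O.extMap (O.extMap f) ≫ O.extμ Y ≫ v = O.extμ X ≫ O.extMap f ≫ v := by
  simpa only [Category.assoc] using congrArg (fun z => z ≫ v) (extμ_natural O f)

/-- The tuple consisting of an operation `h` and the unit operation at each of its inputs. -/
noncomputable def unitsBelow : O.Q ⟶ O.ext O.Q :=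
  O.extLift (O.s ≫ P.map O.e) (𝟙 _) (by
    rw [Category.assoc, Collection.map_toUnit]; simp)

end PreOperad

/-- A (one-coloured) `P`-operad: a monoid in the monoidal category of `P`-spans `P 𝟙 ⟵ Q ⟶ 𝟙`,
where the composite of `Q` with itself is `P Q ×_{P 𝟙} Q`. -/
structure Operad (P : Monad E) extends PreOperad P where
  unit_below : toPreOperad.unitsBelow ≫ m = 𝟙 Q
  unit_above : toPreOperad.extη Q ≫ m = 𝟙 Q
  assoc : toPreOperad.extMap m ≫ m = toPreOperad.extμ Q ≫ m

namespace Operad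

variable {P : Monad E} (O : Operad P)

/-- The monad of a `P`-operad `Q`, with functor `X ↦ P X ×_{P 𝟙} Q`. -/
noncomputable def monad : Monad E where
  obj := O.ext
  map := O.extMap
  map_id := O.extMap_id
  map_comp := O.extMap_comp
  η := { app := O.extη, naturality := fun _ _ f => O.extη_natural f }
  μ := { app := O.extμ, naturality := fun _ _ f => O.extμ_natural f }
  assoc X := by
    apply O.ext_hom
    · simp only [Category.assoc, O.extμ_labels, O.extMap_labels_assoc, O.extμ_labels_assoc]
      rw [← P.map_comp_assoc, O.extμ_labels]
      simp only [P.map_comp, Category.assoc, P.assoc, ← P.mu_naturality_assoc]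
      rfl
    · simp only [Category.assoc, O.extμ_op, O.extMap_op, O.extμ_op_assoc]
      rw [← O.extMap_comp_assoc, O.extμ_op, O.extMap_comp, Category.assoc, O.assoc,
        O.extμ_natural_assoc]
  left_unit X := by
    apply O.ext_hom
    · simp [← P.unit_naturality_assoc, P.left_unit]
    · simp [← O.extη_natural_assoc, O.unit_above]
  right_unit X := by
    apply O.ext_hom
    · simp [← P.map_comp_assoc, P.right_unit]
    · have : O.extMap (O.extη X) ≫ O.extMap (O.op X) = O.op X ≫ O.unitsBelow := by
        apply O.ext_hom
        · simp only [PreOperad.unitsBelow, Category.assoc, O.extMap_labels, O.extMap_labels_assoc,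
            O.extLift_labels, ← O.ext_condition_assoc, ← P.map_comp, O.extη_op]
        · simp [PreOperad.unitsBelow]
      simp [reassoc_of% this, O.unit_below]

/-- The monad map from the monad of a `P`-operad to `P` which forgets the operation. -/
def toP : MonadHom O.monad P where
  app := O.labels
  naturality _ _ f := O.extMap_labels f
  app_η X := O.extη_labels X
  app_μ X := by simp [monad]

end Operad

/-- The terminal `P`-operad `P 𝟙 = P 𝟙 ⟶ 𝟙`. -/
noncomputable def terminalOperad (P : Monad E) : Operad P where
  Q := P.obj (𝟙_ E)
  s := 𝟙 _
  e := P.η.app _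
  m := Collection.labels ⟨P.obj (𝟙_ E), 𝟙 _⟩ _ ≫ P.μ.app (𝟙_ E)
  e_s := Category.comp_id _
  m_s := by simp
  unit_below := by simp [PreOperad.unitsBelow, P.right_unit]
  unit_above := by
    rw [PreOperad.extη_labels_assoc]
    exact P.left_unit _
  assoc := by
    rw [PreOperad.extμ_labels_assoc, Collection.extMap_labels_assoc, P.map_comp, Category.assoc,
      P.assoc]

namespace StrongMonad

variable (P : StrongMonad E)

/-- `x : A` is placed at every input of an operation of `P 𝟙`. -/
noncomputable def const (A : E) : A ⊗ P.obj (𝟙_ E) ⟶ P.obj A := P.str A (𝟙_ E) ≫ P.map (fst _ _)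

theorem str_snd (A B : E) : P.str A B ≫ P.map (snd A B) = snd _ _ := by
  have h := P.str_natural (toUnit A) (𝟙 B)
  have h' := P.str_unit B
  rw [leftUnitor_hom, leftUnitor_hom] at h'
  have : snd A B = (toUnit A ⊗ₘ 𝟙 B) ≫ snd _ _ := by simp
  rw [this, P.map_comp, ← reassoc_of% h, h']
  simp

theorem str_map {Z A A' B B' : E} (a : Z ⟶ A) (b : Z ⟶ P.obj B) (f : A ⟶ A') (g : B ⟶ B') :
    lift (a ≫ f) (b ≫ P.map g) ≫ P.str A' B' = lift a b ≫ P.str A B ≫ P.map (f ⊗ₘ g) := by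
  rw [← P.str_natural, lift_map_assoc]

theorem str_map_assoc {Z A A' B B' : E} (a : Z ⟶ A) (b : Z ⟶ P.obj B) (f : A ⟶ A') (g : B ⟶ B') {V' : E} (v : _ ⟶ V') :
    lift (a ≫ f) (b ≫ P.map g) ≫ P.str A' B' ≫ v = lift a b ≫ P.str A B ≫ P.map (f ⊗ₘ g) ≫ v := by
  simpa only [Category.assoc] using congrArg (fun z => z ≫ v) (str_map P a b f g)

theorem str_map_left {Z A A' B : E} (a : Z ⟶ A) (b : Z ⟶ P.obj B) (f : A ⟶ A') :
    lift (a ≫ f) b ≫ P.str A' B = lift a b ≫ P.str A B ≫ P.map (f ▷ B) := by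
  have h := P.str_map a b f (𝟙 B)
  rwa [P.map_id, Category.comp_id, tensorHom_id] at h

theorem str_map_left_assoc {Z A A' B : E} (a : Z ⟶ A) (b : Z ⟶ P.obj B) (f : A ⟶ A') {V' : E} (v : _ ⟶ V') :
    lift (a ≫ f) b ≫ P.str A' B ≫ v = lift a b ≫ P.str A B ≫ P.map (f ▷ B) ≫ v := by
  simpa only [Category.assoc] using congrArg (fun z => z ≫ v) (str_map_left P a b f)

theorem str_map_right {Z A B B' : E} (a : Z ⟶ A) (b : Z ⟶ P.obj B) (g : B ⟶ B') :
    lift a (b ≫ P.map g) ≫ P.str A B' = lift a b ≫ P.str A B ≫ P.map (A ◁ g) := by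
  have h := P.str_map a b (𝟙 A) g
  rwa [Category.comp_id, id_tensorHom] at h

theorem str_eta {Z A B : E} (a : Z ⟶ A) (b : Z ⟶ B) :
    lift a (b ≫ P.η.app B) ≫ P.str A B = lift a b ≫ P.η.app (A ⊗ B) := by
  rw [← P.str_η, lift_whiskerLeft_assoc]

theorem str_eta_assoc {Z A B : E} (a : Z ⟶ A) (b : Z ⟶ B) {V' : E} (v : _ ⟶ V') :
    lift a (b ≫ P.η.app B) ≫ P.str A B ≫ v = lift a b ≫ P.η.app (A ⊗ B) ≫ v := by
  simpa only [Category.assoc] using congrArg (fun z => z ≫ v) (str_eta P a b)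

theorem str_mu {Z A B : E} (a : Z ⟶ A) (b : Z ⟶ P.obj (P.obj B)) :
    lift a (b ≫ P.μ.app B) ≫ P.str A B =
      lift a b ≫ P.str A (P.obj B) ≫ P.map (P.str A B) ≫ P.μ.app (A ⊗ B) := by
  rw [← P.str_μ, lift_whiskerLeft_assoc]

theorem str_mu_assoc {Z A B : E} (a : Z ⟶ A) (b : Z ⟶ P.obj (P.obj B)) {V' : E} (v : _ ⟶ V') :
    lift a (b ≫ P.μ.app B) ≫ P.str A B ≫ v = lift a b ≫ P.str A (P.obj B) ≫ P.map (P.str A B) ≫ P.μ.app (A ⊗ B) ≫ v := by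
  simpa only [Category.assoc] using congrArg (fun z => z ≫ v) (str_mu P a b)

theorem str_lift_lift {Z A B C : E} (a : Z ⟶ A) (b : Z ⟶ B) (c : Z ⟶ P.obj C) :
    lift (lift a b) c ≫ P.str (A ⊗ B) C ≫ P.map (α_ A B C).hom =
      lift a (lift b c ≫ P.str B C) ≫ P.str A (B ⊗ C) := by
  rw [P.str_assoc, lift_lift_associator_hom_assoc, lift_whiskerLeft_assoc]

theorem const_map {Z A A' : E} (x : Z ⟶ A) (a : Z ⟶ P.obj (𝟙_ E)) (f : A ⟶ A') :
    lift (x ≫ f) a ≫ P.const A' = lift x a ≫ P.const A ≫ P.map f := by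
  simp only [const, P.str_map_left_assoc, Category.assoc, ← P.map_comp, whiskerRight_fst]

theorem const_map_assoc {Z A A' : E} (x : Z ⟶ A) (a : Z ⟶ P.obj (𝟙_ E)) (f : A ⟶ A') {V' : E} (v : _ ⟶ V') :
    lift (x ≫ f) a ≫ P.const A' ≫ v = lift x a ≫ P.const A ≫ P.map f ≫ v := by
  simpa only [Category.assoc] using congrArg (fun z => z ≫ v) (const_map P x a f)

theorem const_toUnit (A : E) : P.const A ≫ P.map (toUnit A) = snd _ _ := by
  rw [const, Category.assoc, ← P.map_comp, toUnit_unique (fst A (𝟙_ E) ≫ toUnit A) (snd _ _),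
    str_snd]

theorem const_eta {Z A : E} (x : Z ⟶ A) (a : Z ⟶ 𝟙_ E) :
    lift x (a ≫ P.η.app _) ≫ P.const A = x ≫ P.η.app A := by
  rw [const, str_eta_assoc, ← P.unit_naturality, lift_fst_assoc]

theorem const_point {Z A : E} (e : 𝟙_ E ⟶ A) (a : Z ⟶ P.obj (𝟙_ E)) :
    lift (toUnit Z ≫ e) a ≫ P.const A = a ≫ P.map e := by
  have h := P.const_toUnit (𝟙_ E)
  rw [toUnit_unit, P.map_id, Category.comp_id] at h
  rw [const_map, h, lift_snd_assoc]

theorem const_const {Z A : E} (x : Z ⟶ A) (a b : Z ⟶ P.obj (𝟙_ E)) :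
    lift (lift x a ≫ P.const A) b ≫ P.const (P.obj A) ≫ P.μ.app A =
      lift x (lift a b ≫ P.const (P.obj (𝟙_ E)) ≫ P.μ.app (𝟙_ E)) ≫ P.const A := by
  have h : lift x (lift a b ≫ P.const (P.obj (𝟙_ E))) ≫ P.str A (P.obj (𝟙_ E)) =
      lift (lift x a) b ≫ P.const (A ⊗ P.obj (𝟙_ E)) := by
    have := congrArg (· ≫ P.map (A ◁ fst (P.obj (𝟙_ E)) (𝟙_ E))) (P.str_lift_lift x a b)
    simp only [Category.assoc, ← P.map_comp] at this
    rw [← P.str_map_right, Category.assoc] at this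
    have hf : (α_ A (P.obj (𝟙_ E)) (𝟙_ E)).hom ≫ A ◁ fst (P.obj (𝟙_ E)) (𝟙_ E) = fst _ _ := by
      ext <;> simp
    rw [hf] at this
    exact this.symm
  have h' : lift x ((lift a b ≫ P.const (P.obj (𝟙_ E))) ≫ P.μ.app (𝟙_ E)) ≫ P.const A =
      lift (lift x a) b ≫ P.const (A ⊗ P.obj (𝟙_ E)) ≫ P.map (P.str A (𝟙_ E)) ≫
        P.μ.app _ ≫ P.map (fst A (𝟙_ E)) := by
    have h₀ : P.const A = P.str A (𝟙_ E) ≫ P.map (fst _ _) := rfl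
    rw [h₀, str_mu_assoc, reassoc_of% h]
  have h'' : P.map (P.const A) = P.map (P.str A (𝟙_ E)) ≫ P.map (P.map (fst A (𝟙_ E))) := by
    rw [const, P.map_comp]
  rw [const_map_assoc, ← Category.assoc (lift a b), h', h'', Category.assoc, P.mu_naturality]

end StrongMonad

namespace PreOperad

variable {P : StrongMonad E} (O : PreOperad P.toMonad)

/-- The composition pairing `(x, y)` to `y ∘ (x, …, x)`, first `x` and then `y`. -/
noncomputable def diag : O.Q ⊗ O.Q ⟶ O.ext O.Q :=
  O.extLift (O.Q ◁ O.s ≫ P.const O.Q) (snd _ _) (by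
    rw [Category.assoc, P.const_toUnit, whiskerLeft_snd])

theorem lift_diag_labels {Z : E} (x y : Z ⟶ O.Q) : lift x y ≫ O.diag ≫ O.labels O.Q =
    lift x (y ≫ O.s) ≫ P.const O.Q := by
  rw [diag, O.extLift_labels, lift_whiskerLeft_assoc]

theorem lift_diag_op {Z : E} (x y : Z ⟶ O.Q) : lift x y ≫ O.diag ≫ O.op O.Q = y := by
  rw [diag, O.extLift_op, lift_snd]

end PreOperad

namespace Operad

variable {P : StrongMonad E} (O : Operad P.toMonad)

theorem diag_assoc {Z : E} (x y z : Z ⟶ O.Q) :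
    lift (lift x y ≫ O.diag ≫ O.m) z ≫ O.diag ≫ O.m =
      lift x (lift y z ≫ O.diag ≫ O.m) ≫ O.diag ≫ O.m := by
  let w : Z ⟶ O.ext (O.ext O.Q) :=
    O.extLift (lift (lift x y ≫ O.diag) (z ≫ O.s) ≫ P.const _) z (by
      rw [Category.assoc, P.const_toUnit, lift_snd])
  have h₁ : lift (lift x y ≫ O.diag ≫ O.m) z ≫ O.diag = w ≫ O.extMap O.m := by
    apply O.ext_hom
    · simp only [w, Category.assoc, O.lift_diag_labels, O.extMap_labels, O.extLift_labels_assoc,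
        ← P.const_map]
    · simp only [w, Category.assoc, O.lift_diag_op, O.extMap_op, O.extLift_op]
  have h₃ : w ≫ O.extMap (O.op O.Q) = lift y z ≫ O.diag := by
    apply O.ext_hom
    · simp only [w, Category.assoc, O.lift_diag_labels, O.extMap_labels, O.extLift_labels_assoc,
        ← P.const_map, O.lift_diag_op]
    · simp only [w, Category.assoc, O.lift_diag_op, O.extMap_op, O.extLift_op]
  have h₂ : lift x (lift y z ≫ O.diag ≫ O.m) ≫ O.diag = w ≫ O.extμ O.Q := by
    apply O.ext_hom
    · simp only [w, Category.assoc, O.lift_diag_labels, O.extμ_labels, O.extLift_labels_assoc,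
        ← P.const_map_assoc, O.m_s, P.const_const, O.lift_diag_op]
      have := O.lift_diag_labels y z
      rw [reassoc_of% this, ← P.const_map_assoc]
    · simp only [w, Category.assoc, O.lift_diag_op, O.extμ_op]
      rw [reassoc_of% h₃]
  rw [reassoc_of% h₁, O.assoc, reassoc_of% h₂]

/-- The monoid of operations of a one-coloured operad over a strong monad, in which the product of
`x` and `y` is `y ∘ (x, …, x)`. -/
noncomputable def toMon : Mon E where
  X := O.Q
  mon :=
    { one := O.e
      mul := O.diag ≫ O.m
      one_mul := by
        have h : O.e ▷ O.Q ≫ O.diag = snd _ _ ≫ O.unitsBelow := by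
          have : O.e ▷ O.Q = lift (toUnit _ ≫ O.e) (snd _ _) := by
            rw [toUnit_unique (toUnit _) (fst _ _)]
            ext <;> simp
          rw [this]
          apply O.ext_hom
          · simp [O.lift_diag_labels, PreOperad.unitsBelow, P.const_point]
          · simp [O.lift_diag_op, PreOperad.unitsBelow]
        rw [reassoc_of% h, O.unit_below, leftUnitor_hom, Category.comp_id]
      mul_one := by
        have h : O.Q ◁ O.e ≫ O.diag = fst _ _ ≫ O.extη _ := by
          have : O.Q ◁ O.e = lift (fst _ _) (toUnit _ ≫ O.e) := by
            rw [toUnit_unique (toUnit _) (snd _ _)]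
            ext <;> simp
          rw [this]
          apply O.ext_hom
          · simp [O.lift_diag_labels, O.e_s, P.const_eta]
          · simp [O.lift_diag_op]
        rw [reassoc_of% h, O.unit_above, rightUnitor_hom, Category.comp_id]
      mul_assoc := by
        have h := O.diag_assoc (fst _ _ ≫ fst _ _) (fst _ _ ≫ snd _ _)
          (snd (O.Q ⊗ O.Q) O.Q)
        have h₁ : (O.diag ≫ O.m) ▷ O.Q = lift (lift (fst _ _ ≫ fst _ _) (fst _ _ ≫ snd _ _) ≫
          O.diag ≫ O.m) (snd (O.Q ⊗ O.Q) O.Q) := by ext <;> simp [← comp_lift_assoc]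
        have h₂ : (α_ O.Q O.Q O.Q).hom ≫ O.Q ◁ (O.diag ≫ O.m) =
            lift (fst _ _ ≫ fst _ _) (lift (fst _ _ ≫ snd _ _)
              (snd (O.Q ⊗ O.Q) O.Q) ≫ O.diag ≫ O.m) := by
          have : (α_ O.Q O.Q O.Q).hom ≫ snd _ _ = lift (fst _ _ ≫ snd _ _)
              (snd (O.Q ⊗ O.Q) O.Q) := by ext <;> simp
          ext <;> simp [reassoc_of% this]
        rw [h₁, h, reassoc_of% h₂] }

end Operad

section Pair

variable {P : Monad E} [PreservesProductSquares P]

/-- The gap map `P A ×_{P 𝟙} P B ⟶ P (A ⊗ B)`, inverse to the canonical comparison. -/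
noncomputable def pairing {Z A B : E} (a : Z ⟶ P.obj A) (b : Z ⟶ P.obj B)
    (h : a ≫ P.map (toUnit A) = b ≫ P.map (toUnit B)) : Z ⟶ P.obj (A ⊗ B) :=
  (PreservesProductSquares.isPullback A B).lift a b h

theorem pairing_fst {Z A B : E} (a : Z ⟶ P.obj A) (b : Z ⟶ P.obj B)
    (h : a ≫ P.map (toUnit A) = b ≫ P.map (toUnit B)) : pairing a b h ≫ P.map (fst A B) = a :=
  (PreservesProductSquares.isPullback A B).lift_fst a b h

theorem pairing_fst_assoc {Z A B : E} (a : Z ⟶ P.obj A) (b : Z ⟶ P.obj B)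
    (h : a ≫ P.map (toUnit A) = b ≫ P.map (toUnit B)) {V' : E} (v : _ ⟶ V') :
    pairing a b h ≫ P.map (fst A B) ≫ v = a ≫ v := by
  simpa only [Category.assoc] using congrArg (fun z => z ≫ v) (pairing_fst a b h)

theorem pairing_snd {Z A B : E} (a : Z ⟶ P.obj A) (b : Z ⟶ P.obj B)
    (h : a ≫ P.map (toUnit A) = b ≫ P.map (toUnit B)) : pairing a b h ≫ P.map (snd A B) = b :=
  (PreservesProductSquares.isPullback A B).lift_snd a b h

theorem eq_pairing {Z A B : E} (z : Z ⟶ P.obj (A ⊗ B)) (a : Z ⟶ P.obj A) (b : Z ⟶ P.obj B)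
    (h : a ≫ P.map (toUnit A) = b ≫ P.map (toUnit B)) (h₁ : z ≫ P.map (fst A B) = a)
    (h₂ : z ≫ P.map (snd A B) = b) : pairing a b h = z :=
  (PreservesProductSquares.isPullback A B).hom_ext
    ((pairing_fst _ _ _).trans h₁.symm) ((pairing_snd _ _ _).trans h₂.symm)

end Pair

namespace StrongMonad

variable (P : StrongMonad E)

/-- The strength on the other side. -/
noncomputable def rstr (A B : E) : P.obj A ⊗ B ⟶ P.obj (A ⊗ B) :=
  lift (snd _ _) (fst _ _) ≫ P.str B A ≫ P.map (lift (snd _ _) (fst _ _))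

variable {Z A A' B B' C : E}

theorem rstr_map (z : Z ⟶ P.obj A) (b : Z ⟶ B) (f : A ⟶ A') (g : B ⟶ B') :
    lift (z ≫ P.map f) (b ≫ g) ≫ P.rstr A' B' = lift z b ≫ P.rstr A B ≫ P.map (f ⊗ₘ g) := by
  simp only [rstr, comp_lift_assoc, lift_fst, lift_snd, Category.assoc]
  rw [P.str_map_assoc]
  simp only [← P.map_comp]
  congr 3
  ext <;> simp

theorem rstr_map_left (z : Z ⟶ P.obj A) (b : Z ⟶ B) (f : A ⟶ A') :
    lift (z ≫ P.map f) b ≫ P.rstr A' B = lift z b ≫ P.rstr A B ≫ P.map (f ▷ B) := by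
  have h := P.rstr_map z b f (𝟙 B)
  rwa [Category.comp_id, tensorHom_id] at h

theorem rstr_map_left_assoc (z : Z ⟶ P.obj A) (b : Z ⟶ B) (f : A ⟶ A') {V' : E} (v : _ ⟶ V') :
    lift (z ≫ P.map f) b ≫ P.rstr A' B ≫ v = lift z b ≫ P.rstr A B ≫ P.map (f ▷ B) ≫ v := by
  simpa only [Category.assoc] using congrArg (fun z => z ≫ v) (rstr_map_left P z b f)

theorem rstr_fst : P.rstr A B ≫ P.map (fst A B) = fst _ _ := by
  simp only [rstr, Category.assoc, ← P.map_comp, lift_fst, P.str_snd, lift_snd]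

theorem rstr_fst_assoc {V' : E} (v : _ ⟶ V') :
    P.rstr A B ≫ P.map (fst A B) ≫ v = fst _ _ ≫ v := by
  simpa only [Category.assoc] using congrArg (fun z => z ≫ v) (rstr_fst P)

theorem rstr_eta (z : Z ⟶ A) (b : Z ⟶ B) :
    lift (z ≫ P.η.app A) b ≫ P.rstr A B = lift z b ≫ P.η.app _ := by
  simp only [rstr, comp_lift_assoc, lift_fst, lift_snd, P.str_eta_assoc, ← P.unit_naturality,
    comp_lift]

theorem rstr_eta_assoc (z : Z ⟶ A) (b : Z ⟶ B) {V' : E} (v : _ ⟶ V') :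
    lift (z ≫ P.η.app A) b ≫ P.rstr A B ≫ v = lift z b ≫ P.η.app _ ≫ v := by
  simpa only [Category.assoc] using congrArg (fun z => z ≫ v) (rstr_eta P z b)

theorem rstr_mu (z : Z ⟶ P.obj (P.obj A)) (b : Z ⟶ B) :
    lift (z ≫ P.μ.app A) b ≫ P.rstr A B =
      lift z b ≫ P.rstr (P.obj A) B ≫ P.map (P.rstr A B) ≫ P.μ.app _ := by
  simp only [rstr, comp_lift_assoc, lift_fst, lift_snd, P.str_mu_assoc, Category.assoc,
    P.map_comp, P.mu_naturality]
  simp only [← P.map_comp_assoc, comp_lift_assoc, lift_fst, lift_snd]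
  simp

theorem rstr_mu_assoc (z : Z ⟶ P.obj (P.obj A)) (b : Z ⟶ B) {V' : E} (v : _ ⟶ V') :
    lift (z ≫ P.μ.app A) b ≫ P.rstr A B ≫ v = lift z b ≫ P.rstr (P.obj A) B ≫ P.map (P.rstr A B) ≫ P.μ.app _ ≫ v := by
  simpa only [Category.assoc] using congrArg (fun z => z ≫ v) (rstr_mu P z b)

theorem rstr_rstr (z : Z ⟶ P.obj A) (b : Z ⟶ B) (c : Z ⟶ C) :
    lift (lift z b ≫ P.rstr A B) c ≫ P.rstr (A ⊗ B) C ≫ P.map (α_ A B C).hom =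
      lift z (lift b c) ≫ P.rstr A (B ⊗ C) := by
  simp only [rstr, comp_lift_assoc, lift_fst, lift_snd, Category.assoc]
  have h := P.str_lift_lift c b z
  have h₁ := P.str_map_right c (lift b z ≫ P.str B A) (lift (snd _ _) (fst _ _))
  rw [Category.assoc] at h₁
  rw [reassoc_of% h₁, ← reassoc_of% h]
  have h₂ : lift (lift b c) z = lift (lift c b ≫ lift (snd _ _) (fst _ _)) (z ≫ P.map (𝟙 _)) := by
    simp
  rw [h₂, P.str_map_assoc]
  simp only [← P.map_comp]
  congr 3
  ext <;> simp

end StrongMonad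

section TConstruction

open MonObj

variable (P : StrongMonad E) (Y : Mon E)

/-- `f : Y` acts on a family in `P Y` by multiplying every member on the right by `f`. -/
noncomputable def rightMul : P.obj Y.X ⊗ Y.X ⟶ P.obj Y.X := P.rstr Y.X Y.X ≫ P.map μ[Y.X]

variable [PreservesProductSquares P.toMonad]

/-- The operations of the `P`-operad of a monoid `Y`: families in `P Y`. -/
abbrev tCollection : Collection P.toMonad where
  Q := P.obj Y.X
  s := P.map (toUnit Y.X)

/-- A family of families `(ζ_i)` and a family `(f_i)` with the same indices form a family of
pairs `(ζ_i, f_i)`. -/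
noncomputable def tPair : (tCollection P Y).ext (P.obj Y.X) ⟶ P.obj (P.obj Y.X ⊗ Y.X) :=
  pairing ((tCollection P Y).labels _) ((tCollection P Y).op _) ((tCollection P Y).ext_condition _)

theorem tPair_fst : tPair P Y ≫ P.map (fst _ _) = (tCollection P Y).labels _ := pairing_fst _ _ _

theorem tPair_fst_assoc {V' : E} (v : _ ⟶ V') :
    tPair P Y ≫ P.map (fst _ _) ≫ v = (tCollection P Y).labels _ ≫ v := by
  simpa only [Category.assoc] using congrArg (fun z => z ≫ v) (tPair_fst P Y)

theorem tPair_snd : tPair P Y ≫ P.map (snd _ _) = (tCollection P Y).op _ := pairing_snd _ _ _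

theorem eq_tPair {Z : E} (x : Z ⟶ (tCollection P Y).ext (P.obj Y.X))
    (z : Z ⟶ P.obj (P.obj Y.X ⊗ Y.X))
    (h₁ : z ≫ P.map (fst _ _) = x ≫ (tCollection P Y).labels _)
    (h₂ : z ≫ P.map (snd _ _) = x ≫ (tCollection P Y).op _) : x ≫ tPair P Y = z :=
  (PreservesProductSquares.isPullback (P := P.toMonad) (P.obj Y.X) Y.X).hom_ext
    ((Category.assoc _ _ _).trans ((congrArg _ (tPair_fst P Y)).trans h₁.symm))
    ((Category.assoc _ _ _).trans ((congrArg _ (tPair_snd P Y)).trans h₂.symm))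

theorem rightMul_map_toUnit : rightMul P Y ≫ P.map (toUnit Y.X) =
    fst _ _ ≫ P.map (toUnit Y.X) := by
  rw [rightMul, Category.assoc, ← P.map_comp,
    toUnit_unique (μ[Y.X] ≫ toUnit Y.X) (fst _ _ ≫ toUnit _), P.map_comp, P.rstr_fst_assoc]

theorem rightMul_rightMul {Z : E} (z : Z ⟶ P.obj Y.X) (g f : Z ⟶ Y.X) :
    lift (lift z g ≫ rightMul P Y) f ≫ rightMul P Y =
      lift z (lift g f ≫ μ[Y.X]) ≫ rightMul P Y := by
  have h₁ := P.rstr_map_left (lift z g ≫ P.rstr Y.X Y.X) f μ[Y.X]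
  have h₂ := P.rstr_map z (lift g f) (𝟙 _) μ[Y.X]
  rw [P.map_id, Category.comp_id, id_tensorHom] at h₂
  have h₃ := P.rstr_rstr z g f
  simp only [rightMul]
  rw [Category.assoc] at h₁
  rw [reassoc_of% h₁, reassoc_of% h₂, ← reassoc_of% h₃]
  simp only [← P.map_comp, MonObj.mul_assoc]

/-- Composition in the `P`-operad of `Y`: a family of families `(ζ_i)` and a family `(f_i)`
compose to the concatenation of the families `ζ_i · f_i`. -/
noncomputable def tComp : (tCollection P Y).ext (P.obj Y.X) ⟶ P.obj Y.X :=
  tPair P Y ≫ P.map (rightMul P Y) ≫ P.μ.app Y.X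

theorem tComp_s : tComp P Y ≫ P.map (toUnit Y.X) = (tCollection P Y).labels _ ≫
    P.map (P.map (toUnit Y.X)) ≫ P.μ.app _ := by
  have h : P.μ.app Y.X ≫ P.map (toUnit Y.X) = P.map (P.map (toUnit Y.X)) ≫ P.μ.app _ :=
    (Monad.mu_naturality E P.toMonad _).symm
  simp only [tComp, Category.assoc]
  rw [h, ← P.map_comp_assoc, rightMul_map_toUnit, P.map_comp_assoc, tPair_fst_assoc]

theorem tUnit_s : (η[Y.X] ≫ P.η.app Y.X) ≫ P.map (toUnit Y.X) = P.η.app (𝟙_ E) := by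
  rw [Category.assoc, ← P.unit_naturality, ← Category.assoc,
    toUnit_unique (η[Y.X] ≫ toUnit Y.X) (𝟙 _), Category.id_comp]

noncomputable def tPreOperad : PreOperad P.toMonad where
  toCollection := tCollection P Y
  e := η[Y.X] ≫ P.η.app Y.X
  m := tComp P Y
  e_s := tUnit_s P Y
  m_s := tComp_s P Y

noncomputable def tUnitsBelow : P.obj Y.X ⟶ (tCollection P Y).ext (P.obj Y.X) :=
  (tPreOperad P Y).unitsBelow

noncomputable def tExtη : P.obj Y.X ⟶ (tCollection P Y).ext (P.obj Y.X) :=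
  (tPreOperad P Y).extη (P.obj Y.X)

noncomputable def tExtμ : (tCollection P Y).ext ((tCollection P Y).ext (P.obj Y.X)) ⟶
    (tCollection P Y).ext (P.obj Y.X) :=
  (tPreOperad P Y).extμ (P.obj Y.X)

noncomputable def tOp (X : E) : (tCollection P Y).ext X ⟶ P.obj Y.X := (tCollection P Y).op X

noncomputable def tExtMap {X : E} (f : X ⟶ P.obj Y.X) :
    (tCollection P Y).ext X ⟶ (tCollection P Y).ext (P.obj Y.X) := (tCollection P Y).extMap f

theorem tExt_condition (X : E) : (tCollection P Y).labels X ≫ P.map (toUnit X) =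
    tOp P Y X ≫ P.map (toUnit Y.X) := (tCollection P Y).ext_condition X

theorem tUnitsBelow_tPair : tUnitsBelow P Y ≫ tPair P Y =
    P.map (lift (toUnit _ ≫ η[Y.X] ≫ P.η.app Y.X) (𝟙 Y.X)) := by
  apply eq_tPair
  · refine Eq.trans ?_ ((tPreOperad P Y).extLift_labels _ _ _).symm
    simp only [← P.map_comp, lift_fst]
    exact P.map_comp _ _
  · refine Eq.trans ?_ ((tPreOperad P Y).extLift_op _ _ _).symm
    simp only [← P.map_comp, lift_snd]
    exact P.map_id _

theorem tExtη_tPair : tExtη P Y ≫ tPair P Y = lift (𝟙 _) (toUnit _ ≫ η[Y.X]) ≫ P.η.app _ := by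
  apply eq_tPair
  · refine Eq.trans ?_ ((tPreOperad P Y).extη_labels _).symm
    rw [Category.assoc, ← P.unit_naturality, lift_fst_assoc, Category.id_comp]
  · refine Eq.trans ?_ ((tPreOperad P Y).extη_op _).symm
    rw [Category.assoc, ← P.unit_naturality, lift_snd_assoc]
    simp [tPreOperad]

theorem lift_unit_mul {Z : E} (f : Z ⟶ Y.X) :
    lift (toUnit Z ≫ η[Y.X]) f ≫ μ[Y.X] = f := by
  have h : lift (toUnit Z ≫ η[Y.X]) f = lift (toUnit Z) f ≫ η[Y.X] ▷ Y.X := by simp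
  rw [h, Category.assoc, MonObj.one_mul, leftUnitor_hom, lift_snd]

theorem lift_mul_unit {Z : E} (f : Z ⟶ Y.X) :
    lift f (toUnit Z ≫ η[Y.X]) ≫ μ[Y.X] = f := by
  have h : lift f (toUnit Z ≫ η[Y.X]) = lift f (toUnit Z) ≫ Y.X ◁ η[Y.X] := by simp
  rw [h, Category.assoc, MonObj.mul_one, rightUnitor_hom, lift_fst]

theorem tUnitsBelow_tComp : tUnitsBelow P Y ≫ tComp P Y = 𝟙 _ := by
  have h : lift (toUnit _ ≫ η[Y.X] ≫ P.η.app Y.X) (𝟙 Y.X) ≫ rightMul P Y = P.η.app _ := by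
    rw [← Category.assoc (toUnit _), rightMul, P.rstr_eta_assoc, ← P.unit_naturality,
      ← Category.assoc, lift_unit_mul, Category.id_comp]
  rw [tComp, ← Category.assoc, tUnitsBelow_tPair, ← P.map_comp_assoc, h, P.right_unit]
  rfl

theorem tExtη_tComp : tExtη P Y ≫ tComp P Y = 𝟙 _ := by
  have h : lift (𝟙 _) (toUnit _ ≫ η[Y.X]) ≫ rightMul P Y = 𝟙 _ := by
    have h₁ : lift (𝟙 (P.obj Y.X)) (toUnit _ ≫ η[Y.X]) ≫ P.rstr Y.X Y.X =
        P.map (lift (𝟙 _) (toUnit _ ≫ η[Y.X])) := by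
      have h₂ : lift (𝟙 (P.obj Y.X)) (toUnit _) ≫ P.rstr Y.X (𝟙_ E) =
          P.map (lift (𝟙 _) (toUnit _)) := by
        have := congrArg (fun x => lift (𝟙 (P.obj Y.X)) (toUnit _) ≫ x ≫
          P.map (lift (𝟙 _) (toUnit _))) (P.rstr_fst (A := Y.X) (B := 𝟙_ E))
        simp only [lift_fst_assoc, Category.assoc, ← P.map_comp, Category.id_comp] at this
        rw [← this, show fst Y.X (𝟙_ E) ≫ lift (𝟙 _) (toUnit _) = 𝟙 _ by ext <;> simp, P.map_id,
          Category.comp_id]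
      have h₃ := P.rstr_map (𝟙 (P.obj Y.X)) (toUnit _) (𝟙 _) η[Y.X]
      rw [P.map_id, Category.comp_id, reassoc_of% h₂, ← P.map_comp, lift_map,
        Category.comp_id] at h₃
      exact h₃
    rw [rightMul, reassoc_of% h₁, ← P.map_comp, lift_mul_unit, P.map_id]
  rw [tComp, ← Category.assoc, tExtη_tPair, Category.assoc, ← P.unit_naturality_assoc,
    reassoc_of% h, P.left_unit]
  rfl

noncomputable def tTriple : (tCollection P Y).ext ((tCollection P Y).ext (P.obj Y.X)) ⟶
    P.obj ((tCollection P Y).ext (P.obj Y.X) ⊗ Y.X) :=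
  pairing ((tCollection P Y).labels _) (tOp P Y _) (tExt_condition _ _ _)

noncomputable def tInner : (tCollection P Y).ext (P.obj Y.X) ⊗ Y.X ⟶
    (tCollection P Y).ext (P.obj Y.X) :=
  (tCollection P Y).extLift (fst _ _ ≫ (tCollection P Y).labels _)
    (tOp P Y _ ▷ Y.X ≫ rightMul P Y) (by
      rw [Category.assoc]
      refine (congrArg _ (tExt_condition _ _ _)).trans ?_
      refine Eq.trans ?_ (Category.assoc _ _ _).symm
      refine Eq.trans ?_ (congrArg _ (rightMul_map_toUnit P Y).symm)
      rw [whiskerRight_fst_assoc])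

theorem tInner_tPair : tInner P Y ≫ tPair P Y =
    tPair P Y ▷ Y.X ≫ P.rstr _ _ ≫ P.map ((α_ _ _ _).hom ≫ _ ◁ μ[Y.X]) := by
  apply eq_tPair
  · refine Eq.trans ?_ ((tCollection P Y).extLift_labels _ _ _).symm
    simp only [Category.assoc, ← P.map_comp, whiskerLeft_fst, associator_hom_fst]
    rw [P.map_comp, P.rstr_fst_assoc, whiskerRight_fst_assoc, tPair_fst]
  · refine Eq.trans ?_ ((tCollection P Y).extLift_op _ _ _).symm
    have h₁ : (α_ (P.obj Y.X) Y.X Y.X).hom ≫ P.obj Y.X ◁ μ[Y.X] ≫ snd _ _ =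
        snd _ _ ▷ _ ≫ μ[Y.X] := by
      rw [whiskerLeft_snd, ← Category.assoc]
      congr 1
      ext <;> simp
    have h₂ := P.rstr_map_left (fst _ _) (snd (P.obj (P.obj Y.X ⊗ Y.X)) Y.X) (snd _ _)
    have h₃ : lift (fst _ _ ≫ P.map (snd (P.obj Y.X) Y.X))
        (snd (P.obj (P.obj Y.X ⊗ Y.X)) Y.X) = P.map (snd _ _) ▷ _ := by ext <;> simp
    rw [h₃, lift_fst_snd, Category.id_comp] at h₂
    simp only [Category.assoc, ← P.map_comp]
    rw [h₁, P.map_comp, ← reassoc_of% h₂, ← comp_whiskerRight_assoc, tPair_snd]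
    rfl

theorem tInner_tComp : tInner P Y ≫ tComp P Y = tComp P Y ▷ Y.X ≫ rightMul P Y := by
  have h : tComp P Y = tPair P Y ≫ P.map (rightMul P Y) ≫ P.μ.app Y.X := rfl
  have h₁ := tInner_tPair P Y
  have h₂ : tComp P Y ▷ Y.X = lift ((fst _ _ ≫ tPair P Y ≫ P.map (rightMul P Y)) ≫ P.μ.app Y.X)
      (snd _ _) := by
    rw [h]
    ext <;> simp
  have h₃ : lift (fst _ _ ≫ tPair P Y) (snd _ _) = tPair P Y ▷ Y.X := by ext <;> simp
  have h₄ : rightMul P Y ▷ Y.X ≫ rightMul P Y =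
      (α_ _ _ _).hom ≫ _ ◁ μ[Y.X] ≫ rightMul P Y := by
    have := rightMul_rightMul P Y (fst _ _ ≫ fst _ _) (fst _ _ ≫ snd _ _)
      (snd (P.obj Y.X ⊗ Y.X) Y.X)
    have h₅ : lift (lift (fst _ _ ≫ fst _ _) (fst _ _ ≫ snd _ _) ≫ rightMul P Y)
      (snd (P.obj Y.X ⊗ Y.X) Y.X) = rightMul P Y ▷ Y.X := by
      rw [← comp_lift, lift_fst_snd, Category.comp_id]
      ext <;> simp
    have h₆ : lift (fst _ _ ≫ fst _ _) (lift (fst _ _ ≫ snd _ _)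
      (snd (P.obj Y.X ⊗ Y.X) Y.X) ≫ μ[Y.X]) = (α_ _ _ _).hom ≫ _ ◁ μ[Y.X] := by
      ext
      · simp
      · simp only [lift_snd, Category.assoc, whiskerLeft_snd]
        rw [← Category.assoc]
        congr 1
        ext <;> simp
    rw [h₅, h₆, Category.assoc] at this
    exact this
  rw [h₂, h, reassoc_of% h₁]
  conv_rhs => rw [rightMul, P.rstr_mu_assoc, ← Category.assoc (fst _ _), P.rstr_map_left_assoc, h₃]
  rw [← P.mu_naturality]
  simp only [← P.map_comp_assoc]
  congr 4
  have := h₄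
  rw [rightMul] at this ⊢
  simp only [Category.assoc] at this ⊢
  rw [this]

theorem tExtMap_tPair (f : (tCollection P Y).ext (P.obj Y.X) ⟶ P.obj Y.X) :
    tExtMap P Y f ≫ tPair P Y = tTriple P Y ≫ P.map (f ▷ Y.X) := by
  apply eq_tPair
  · refine Eq.trans ?_ ((tCollection P Y).extMap_labels _).symm
    rw [Category.assoc, ← P.map_comp, whiskerRight_fst, P.map_comp]
    exact pairing_fst_assoc _ _ _ _
  · refine Eq.trans ?_ ((tCollection P Y).extMap_op _).symm
    rw [Category.assoc, ← P.map_comp, whiskerRight_snd]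
    exact pairing_snd _ _ _

theorem tExtμ_tPair : tExtμ P Y ≫ tPair P Y =
    tTriple P Y ≫ P.map (tInner P Y ≫ tPair P Y) ≫ P.μ.app _ := by
  apply eq_tPair
  · refine Eq.trans ?_ ((tPreOperad P Y).extμ_labels _).symm
    simp only [Category.assoc]
    rw [← P.mu_naturality, ← P.map_comp_assoc, Category.assoc, tPair_fst]
    have : tInner P Y ≫ (tCollection P Y).labels _ = fst _ _ ≫ (tCollection P Y).labels _ :=
      (tCollection P Y).extLift_labels _ _ _
    rw [this, P.map_comp, Category.assoc]
    exact pairing_fst_assoc _ _ _ _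
  · refine Eq.trans ?_ ((tPreOperad P Y).extμ_op _).symm
    simp only [Category.assoc]
    rw [← P.mu_naturality, ← P.map_comp_assoc, Category.assoc, tPair_snd]
    have : tInner P Y ≫ tOp P Y _ = tOp P Y _ ▷ Y.X ≫ rightMul P Y :=
      (tCollection P Y).extLift_op _ _ _
    have h₁ : tExtMap P Y (tOp P Y _) ≫ tPair P Y = tTriple P Y ≫ P.map (tOp P Y _ ▷ Y.X) :=
      tExtMap_tPair P Y _
    refine (congrArg (fun x => tTriple P Y ≫ P.map x ≫ P.μ.app Y.X) this).trans ?_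
    rw [P.map_comp, Category.assoc, ← reassoc_of% h₁]
    rfl

theorem tComp_assoc : tExtMap P Y (tComp P Y) ≫ tComp P Y = tExtμ P Y ≫ tComp P Y := by
  have h : tComp P Y = tPair P Y ≫ P.map (rightMul P Y) ≫ P.μ.app Y.X := rfl
  have h₁ := tExtMap_tPair P Y (tComp P Y)
  have h₂ := tExtμ_tPair P Y
  calc _ = tTriple P Y ≫ P.map (tInner P Y ≫ tComp P Y) ≫ P.μ.app Y.X := by
        rw [tInner_tComp, P.map_comp, Category.assoc, ← reassoc_of% h₁]
        rfl
    _ = _ := by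
        rw [h, reassoc_of% h₂]
        simp only [P.map_comp, Category.assoc, P.assoc, Monad.mu_naturality_assoc]

/-- The `T`-construction: the `P`-operad of a monoid `Y`. -/
noncomputable def tOperad : Operad P.toMonad where
  toPreOperad := tPreOperad P Y
  unit_below := tUnitsBelow_tComp P Y
  unit_above := tExtη_tComp P Y
  assoc := tComp_assoc P Y

end TConstruction

end Operads

section Bar

variable {E : Type u} [Category.{v} E] [CartesianMonoidalCategory E]

section Act

variable (M : Monad E)

/-- `M` applied `n` times to the terminal object. -/
def iter : ℕ → E
  | 0 => 𝟙_ E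
  | n + 1 => M.obj (iter n)

/-- The map `M 𝟙 ⟶ 𝟙`, the target map of a one-coloured operad. -/
def iterC : iter M 1 ⟶ iter M 0 := toUnit (M.obj (𝟙_ E))

/-- The unit `M^n 𝟙 ⟶ M^(n+1) 𝟙` at the outermost place. -/
def iterη (n : ℕ) : iter M n ⟶ iter M (n + 1) := M.η.app (iter M n)

/-- The multiplication `M^(n+2) 𝟙 ⟶ M^(n+1) 𝟙` of the two outermost copies of `M`. -/
def iterμ (n : ℕ) : iter M (n + 2) ⟶ iter M (n + 1) := M.μ.app (iter M n)

def iterMap {n m : ℕ} (a : iter M n ⟶ iter M m) : iter M (n + 1) ⟶ iter M (m + 1) := M.map a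

theorem iterMap_comp {n m p : ℕ} (a : iter M n ⟶ iter M m) (b : iter M m ⟶ iter M p) :
    iterMap M (a ≫ b) = iterMap M a ≫ iterMap M b := M.map_comp a b

theorem iterMap_id (n : ℕ) : iterMap M (𝟙 (iter M n)) = 𝟙 _ := M.map_id _

theorem iterη_natural {n m : ℕ} (a : iter M n ⟶ iter M m) :
    iterη M n ≫ iterMap M a = a ≫ iterη M m := (M.unit_naturality _ a).symm

theorem iterη_natural_assoc {n m : ℕ} (a : iter M n ⟶ iter M m) {V' : E} (v : _ ⟶ V') :
    iterη M n ≫ iterMap M a ≫ v = a ≫ iterη M m ≫ v := by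
  simpa only [Category.assoc] using congrArg (fun z => z ≫ v) (iterη_natural M a)

theorem iterμ_natural {n m : ℕ} (a : iter M n ⟶ iter M m) :
    iterμ M n ≫ iterMap M a = iterMap M (iterMap M a) ≫ iterμ M m := (M.mu_naturality _ a).symm

theorem iterμ_natural_assoc {n m : ℕ} (a : iter M n ⟶ iter M m) {V' : E} (v : _ ⟶ V') :
    iterμ M n ≫ iterMap M a ≫ v = iterMap M (iterMap M a) ≫ iterμ M m ≫ v := by
  simpa only [Category.assoc] using congrArg (fun z => z ≫ v) (iterμ_natural M a)

theorem iterη_iterμ (n : ℕ) : iterη M (n + 1) ≫ iterμ M n = 𝟙 _ := M.left_unit _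

theorem iterMap_iterη (n : ℕ) : iterMap M (iterη M n) ≫ iterμ M n = 𝟙 _ := M.right_unit _

theorem iterμ_iterμ (n : ℕ) :
    iterμ M (n + 1) ≫ iterμ M n = iterMap M (iterμ M n) ≫ iterμ M n := (M.assoc _).symm

theorem iter_zero_hom {Z : E} (a b : Z ⟶ iter M 0) : a = b := toUnit_unique a b

/-- The map `M^n 𝟙 ⟶ M^m 𝟙` which, for `1 ≤ k ≤ n`, sends the `k`-th copy of `M` (counted from the
inside) to the `f k`-th copy of `M`, multiplying the copies with the same image, inserting units
where needed, and projecting the copies with `f k = 0` to the point. -/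
def act : (n m : ℕ) → (f : ℕ → ℕ) → (iter M n ⟶ iter M m)
  | 0, 0, _ => 𝟙 _
  | 0, m + 1, f => act 0 m f ≫ iterη M m
  | n + 1, 0, f => iterMap M (act n 0 f) ≫ iterC M
  | n + 1, m + 1, f =>
    if f (n + 1) ≤ m then act (n + 1) m f ≫ iterη M m
    else iterMap M (act n (m + 1) f) ≫ iterμ M m

theorem act_of_le {n m : ℕ} {f : ℕ → ℕ} (h : f n ≤ m) :
    act M n (m + 1) f = act M n m f ≫ iterη M m := by
  cases n with
  | zero => simp only [act]
  | succ n => simp only [act, if_pos h]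

theorem act_of_lt {n m : ℕ} {f : ℕ → ℕ} (h : m < f (n + 1)) :
    act M (n + 1) (m + 1) f = iterMap M (act M n (m + 1) f) ≫ iterμ M m := by
  simp only [act, if_neg (Nat.not_le.2 h)]

theorem act_comp (N : ℕ) : ∀ (n m p : ℕ) (f g : ℕ → ℕ), n + m + p ≤ N → Monotone f → Monotone g →
    f 0 = 0 → g 0 = 0 → f n ≤ m → g m ≤ p →
    act M n m f ≫ act M m p g = act M n p (g ∘ f) := by
  induction N with
  | zero =>
    intro n m p f g hN _ _ _ _ _ _
    obtain ⟨rfl, rfl, rfl⟩ : n = 0 ∧ m = 0 ∧ p = 0 := by omega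
    apply iter_zero_hom
  | succ N ih =>
    intro n m p f g hN hf hg f0 g0 hfm hgp
    cases p with
    | zero => apply iter_zero_hom
    | succ p =>
      by_cases hp : g m ≤ p
      · have h1 : (g ∘ f) n ≤ p := (hg hfm).trans hp
        rw [act_of_le M hp, act_of_le M h1,
          ← ih n m p f g (by omega) hf hg f0 g0 hfm hp, Category.assoc]
      · cases m with
        | zero => omega
        | succ m =>
          rw [act_of_lt M (by omega)]
          by_cases hm : f n ≤ m
          · have h2 : g m ≤ p + 1 := (hg (Nat.le_succ m)).trans hgp
            rw [act_of_le M hm, Category.assoc, iterη_natural_assoc, iterη_iterμ,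
              Category.comp_id, ← ih n m (p + 1) f g (by omega) hf hg f0 g0 hm h2]
          · cases n with
            | zero => omega
            | succ n =>
              have h1 : f (n + 1) = m + 1 := by omega
              have h2 : p < (g ∘ f) (n + 1) := by simp [h1]; omega
              have h3 : f n ≤ m + 1 := (hf (Nat.le_succ n)).trans hfm
              rw [act_of_lt M (by omega : m < f (n + 1)), act_of_lt M h2,
                ← ih n (m + 1) (p + 1) f g (by omega) hf hg f0 g0 h3 hgp,
                act_of_lt M (by omega : p < g (m + 1))]
              simp only [Category.assoc, iterMap_comp, iterμ_natural_assoc, iterμ_iterμ]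

theorem act_id (n : ℕ) : act M n n id = 𝟙 _ := by
  induction n with
  | zero => simp only [act]
  | succ n ih =>
    rw [act_of_lt M (by simp), act_of_le M (by simp), ih, Category.id_comp, iterMap_iterη]

end Act

variable {M R : Monad E} (χ : M ⟶ R)

/-- The right action of `M` on `R` along a monad map `χ`. -/
def top (n : ℕ) : R.obj (iter M (n + 1)) ⟶ R.obj (iter M n) :=
  R.map (χ.app (iter M n)) ≫ R.μ.app (iter M n)

theorem top_natural {n m : ℕ} (a : iter M n ⟶ iter M m) :
    top χ n ≫ R.map a = R.map (iterMap M a) ≫ top χ m := by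
  have h : M.map a ≫ χ.app (iter M m) = χ.app (iter M n) ≫ R.map a := χ.naturality a
  have h' := congrArg (fun x => R.map x ≫ R.μ.app _) h
  simp only [R.map_comp, Category.assoc, R.mu_naturality] at h'
  simp only [top, Category.assoc]
  exact h'.symm

theorem top_natural_assoc {n m : ℕ} (a : iter M n ⟶ iter M m) {V' : E} (v : _ ⟶ V') :
    top χ n ≫ R.map a ≫ v = R.map (iterMap M a) ≫ top χ m ≫ v := by
  simpa only [Category.assoc] using congrArg (fun z => z ≫ v) (top_natural χ a)

theorem top_top (n : ℕ) : top χ (n + 1) ≫ top χ n = R.map (iterμ M n) ≫ top χ n := by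
  have h := χ.app_μ (iter M n)
  have h' : M.map (χ.app (iter M n)) ≫ χ.app (R.obj (iter M n)) =
      χ.app (M.obj (iter M n)) ≫ R.map (χ.app (iter M n)) := χ.naturality _
  have h₂ := congrArg (fun x => R.map x ≫ R.μ.app _) h
  simp only [h', R.map_comp, Category.assoc, R.assoc, R.mu_naturality_assoc] at h₂
  simp only [top, Category.assoc]
  exact h₂.symm

theorem eta_top (n : ℕ) : R.map (iterη M n) ≫ top χ n = 𝟙 _ := by
  have h := congrArg (fun x => R.map x ≫ R.μ.app _) (χ.app_η (iter M n))
  simp only [R.map_comp, Category.assoc, R.right_unit] at h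
  exact h

/-- The map `R M^n 𝟙 ⟶ R M^m 𝟙` which treats the outer copies of `M` that `f` sends to `m + 1`
by letting them act on `R`. -/
def barMap (n m : ℕ) (f : ℕ → ℕ) : R.obj (iter M n) ⟶ R.obj (iter M m) :=
  R.map (act M n (m + 1) f) ≫ top χ m

theorem barMap_of_le {n m : ℕ} {f : ℕ → ℕ} (h : f n ≤ m) :
    barMap χ n m f = R.map (act M n m f) := by
  rw [barMap, act_of_le M h, R.map_comp, Category.assoc, eta_top, Category.comp_id]

theorem barMap_comp {n m p : ℕ} {f g : ℕ → ℕ} (hf : Monotone f) (hg : Monotone g)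
    (f0 : f 0 = 0) (g0 : g 0 = 0) (hm : f n ≤ m + 1) (hp : g (m + 1) = p + 1) :
    barMap χ n m f ≫ barMap χ m p g = barMap χ n p (g ∘ f) := by
  have h := act_of_lt M (by omega : p < g (m + 1))
  rw [barMap, barMap, barMap, ← act_comp M _ n (m + 1) (p + 1) f g le_rfl hf hg f0 g0 hm hp.le, h]
  simp only [R.map_comp, Category.assoc, ← top_top, top_natural_assoc]

/-- For a monotone map `θ : [m] → [n]`, the number of elements of `[m]` with `θ i < k`. The `k`-th
edge `k - 1 ⟶ k` of `[n]` is part of the image of the `j`-th edge of `[m]` exactly if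
`j = edge θ k`, where `0` stands for "below the image" and `m + 1` for "above the image". -/
def edge {n m : ℕ} (θ : Fin (m + 1) →o Fin (n + 1)) (k : ℕ) : ℕ :=
  (Finset.univ.filter fun i => (θ i : ℕ) < k).card

theorem edge_mono {n m : ℕ} (θ : Fin (m + 1) →o Fin (n + 1)) : Monotone (edge θ) := by
  intro k l h
  refine Finset.card_le_card fun i => ?_
  simp only [Finset.mem_filter]
  exact fun hi => ⟨hi.1, hi.2.trans_le h⟩

theorem edge_zero {n m : ℕ} (θ : Fin (m + 1) →o Fin (n + 1)) : edge θ 0 = 0 := by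
  simp [edge]

theorem edge_le {n m : ℕ} (θ : Fin (m + 1) →o Fin (n + 1)) (k : ℕ) : edge θ k ≤ m + 1 :=
  (Finset.card_filter_le _ _).trans (by simp)

theorem edge_top {n m : ℕ} (θ : Fin (m + 1) →o Fin (n + 1)) : edge θ (n + 1) = m + 1 := by
  rw [edge, Finset.filter_true_of_mem (fun i _ => (θ i).isLt)]
  simp

theorem lt_edge {n m : ℕ} (θ : Fin (m + 1) →o Fin (n + 1)) (k : ℕ) (i : Fin (m + 1)) :
    (i : ℕ) < edge θ k ↔ (θ i : ℕ) < k := by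
  constructor
  · intro h
    by_contra hk
    have : (Finset.univ.filter fun j => (θ j : ℕ) < k) ⊆ Finset.Iio i := by
      intro j hj
      simp only [Finset.mem_filter, Finset.mem_univ, true_and, Finset.mem_Iio] at hj ⊢
      by_contra hij
      have := θ.monotone (not_lt.1 hij)
      rw [Fin.le_def] at this
      omega
    have h2 := Finset.card_le_card this
    rw [Fin.card_Iio] at h2
    exact absurd h (not_lt.2 h2)
  · intro h
    have : Finset.Iic i ⊆ Finset.univ.filter fun j => (θ j : ℕ) < k := by
      intro j hj
      simp only [Finset.mem_filter, Finset.mem_univ, true_and, Finset.mem_Iic] at hj ⊢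
      have := θ.monotone hj
      rw [Fin.le_def] at this
      omega
    have h2 := Finset.card_le_card this
    rw [Fin.card_Iic] at h2
    exact h2

theorem edge_comp {n m p : ℕ} (θ : Fin (m + 1) →o Fin (n + 1)) (ψ : Fin (p + 1) →o Fin (m + 1)) :
    edge (θ.comp ψ) = edge ψ ∘ edge θ := by
  funext k
  rw [Function.comp, edge, edge]
  refine congrArg Finset.card (Finset.ext fun i => ?_)
  simp only [Finset.mem_filter, Finset.mem_univ, true_and]
  exact (lt_edge θ k (ψ i)).symm

theorem edge_id {n k : ℕ} (h : k ≤ n + 1) : edge (OrderHom.id : Fin (n + 1) →o Fin (n + 1)) k = k := by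
  cases k with
  | zero => exact edge_zero _
  | succ k =>
    apply le_antisymm
    · by_contra hk
      have h1 := edge_le (OrderHom.id : Fin (n + 1) →o Fin (n + 1)) (k + 1)
      have := (lt_edge (OrderHom.id : Fin (n + 1) →o Fin (n + 1)) (k + 1) ⟨k + 1, by omega⟩).1
        (by simpa using hk)
      simp at this
    · exact (lt_edge (OrderHom.id : Fin (n + 1) →o Fin (n + 1)) (k + 1) ⟨k, by omega⟩).2 (by simp)

theorem act_congr {n m : ℕ} {f g : ℕ → ℕ} (h : ∀ k ≤ n, f k = g k) :
    act M n m f = act M n m g := by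
  induction n generalizing m with
  | zero =>
    induction m with
    | zero => simp only [act]
    | succ m ih => simp only [act, ih]
  | succ n ih =>
    have ih' : ∀ m, act M n m f = act M n m g := fun m => ih fun k hk => h k (by omega)
    induction m with
    | zero => simp only [act, ih']
    | succ m ihm => simp only [act, ih', ihm, h (n + 1) le_rfl]

/-- The two-sided bar construction `B(R, M, 𝟙)` of a monad map `χ : M ⟶ R`: the simplicial object
with `n`-simplices `R M^n 𝟙`. -/
def bar : SimplicialObject E where
  obj n := R.obj (iter M n.unop.len)
  map {n m} θ := barMap χ n.unop.len m.unop.len (edge θ.unop.toOrderHom)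
  map_id n := by
    have h : ∀ k ≤ n.unop.len, edge (SimplexCategory.Hom.toOrderHom (𝟙 n.unop)) k = id k :=
      fun k hk => edge_id (by omega)
    rw [barMap_of_le, unop_id, act_congr h, act_id, R.map_id]
    exact (edge_id (by omega)).le
  map_comp {n m p} θ ψ := by
    rw [barMap_comp χ (edge_mono _) (edge_mono _) (edge_zero _) (edge_zero _) (edge_le _ _)
      (edge_top _), ← edge_comp]
    rfl

/-- The inner and bottom faces `M^(n+1) 𝟙 ⟶ M^n 𝟙`: multiply the copies `i` and `i + 1` of `M`,
or, for `i = 0`, project the innermost copy to the point. -/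
def innerFace : (n i : ℕ) → (iter M (n + 1) ⟶ iter M n)
  | 0, _ => iterC M
  | n + 1, i => if i = n + 1 then iterμ M n else iterMap M (innerFace n i)

/-- The degeneracies `M^n 𝟙 ⟶ M^(n+1) 𝟙`: insert a unit between the copies `i` and `i + 1`. -/
def degeneracy : (n i : ℕ) → (iter M n ⟶ iter M (n + 1))
  | 0, _ => iterη M 0
  | n + 1, i => if i = n + 1 then iterη M (n + 1) else iterMap M (degeneracy n i)

theorem act_face {n i : ℕ} (hi : i ≤ n) {f : ℕ → ℕ}
    (hf : ∀ k ≤ n + 1, f k = if k ≤ i then k else k - 1) :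
    act M (n + 1) n f = innerFace n i := by
  induction n with
  | zero => exact iter_zero_hom M _ _
  | succ n ih =>
    have h1 : f (n + 1 + 1) = n + 1 := by rw [hf _ le_rfl, if_neg (by omega)]; rfl
    rw [act_of_lt M (by omega)]
    by_cases h : i = n + 1
    · have h2 : act M (n + 1) (n + 1) f = 𝟙 _ := by
        rw [← act_id]
        exact act_congr fun k hk => by rw [hf k (by omega), if_pos (by omega)]; rfl
      rw [h2, innerFace, if_pos h, iterMap_id, Category.id_comp]
    · have h2 : f (n + 1) ≤ n := by rw [hf _ (by omega), if_neg (by omega)]; rfl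
      rw [act_of_le M h2, ih (by omega) fun k hk => hf k (by omega), innerFace, if_neg h,
        iterMap_comp, Category.assoc, iterMap_iterη, Category.comp_id]

theorem act_degeneracy {n i : ℕ} (hi : i ≤ n) {f : ℕ → ℕ}
    (hf : ∀ k ≤ n, f k = if k ≤ i then k else k + 1) :
    act M n (n + 1) f = degeneracy n i := by
  induction n with
  | zero =>
    rw [act_of_le M (by rw [hf 0 le_rfl, if_pos (by omega)]), degeneracy,
      iter_zero_hom M (act M 0 0 f) (𝟙 _), Category.id_comp]
  | succ n ih =>
    by_cases h : i = n + 1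
    · have h2 : act M (n + 1) (n + 1) f = 𝟙 _ := by
        rw [← act_id]
        exact act_congr fun k hk => by rw [hf k (by omega), if_pos (by omega)]; rfl
      rw [act_of_le M (by rw [hf _ le_rfl, if_pos (by omega)]), h2, degeneracy, if_pos h,
        Category.id_comp]
    · have h1 : f (n + 1) = n + 2 := by rw [hf _ le_rfl, if_neg (by omega)]
      have h3 : f n ≤ n + 1 := by rw [hf n (by omega)]; split_ifs <;> omega
      rw [act_of_lt M (by omega), act_of_le M h3, ih (by omega) fun k hk => hf k (by omega),
        degeneracy, if_neg h, iterMap_comp, Category.assoc, iterMap_iterη, Category.comp_id]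

theorem edge_eq_of {n m : ℕ} (θ : Fin (m + 1) →o Fin (n + 1)) {k j : ℕ} (hj : j ≤ m + 1)
    (h : ∀ i : Fin (m + 1), (θ i : ℕ) < k ↔ (i : ℕ) < j) : edge θ k = j := by
  rcases lt_trichotomy (edge θ k) j with h1 | h1 | h1
  · have := (h ⟨edge θ k, by omega⟩).2 h1
    rw [← lt_edge] at this
    simp at this
  · exact h1
  · have h2 := edge_le θ k
    have := (h ⟨j, by omega⟩).1 ((lt_edge _ _ _).1 h1)
    simp at this

/-- The top face of the bar construction is the action of `M` on `R`. -/
theorem bar_δ_last (n : ℕ) : (bar χ).δ (Fin.last (n + 1)) = top χ n := by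
  have h : ∀ k ≤ n + 1, edge (SimplexCategory.Hom.toOrderHom
      (SimplexCategory.δ (Fin.last (n + 1)))) k = id k := by
    intro k hk
    refine edge_eq_of _ (by simpa using hk) fun i => ?_
    simp [SimplexCategory.δ]
  change barMap χ (n + 1) n (edge (SimplexCategory.Hom.toOrderHom (SimplexCategory.δ _))) = _
  rw [barMap, act_congr h, act_id, R.map_id, Category.id_comp]

/-- The other faces of the bar construction. -/
theorem bar_δ (n : ℕ) (i : Fin (n + 2)) (hi : (i : ℕ) ≤ n) :
    (bar χ).δ i = R.map (innerFace n i) := by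
  have h : ∀ k ≤ n + 1, edge (SimplexCategory.Hom.toOrderHom (SimplexCategory.δ i)) k =
      if k ≤ i then k else k - 1 := by
    intro k hk
    refine edge_eq_of _ (by simp; split_ifs <;> omega) fun j => ?_
    simp [SimplexCategory.δ, Fin.succAbove, Fin.lt_def]
    split_ifs <;> simp <;> omega
  change barMap χ (n + 1) n (edge (SimplexCategory.Hom.toOrderHom (SimplexCategory.δ _))) = _
  rw [barMap_of_le, act_face hi h]
  rw [h _ le_rfl]
  split_ifs <;> omega

theorem bar_σ (n : ℕ) (i : Fin (n + 1)) : (bar χ).σ i = R.map (degeneracy n i) := by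
  have h : ∀ k ≤ n, edge (SimplexCategory.Hom.toOrderHom (SimplexCategory.σ i)) k =
      if k ≤ i then k else k + 1 := by
    intro k hk
    refine edge_eq_of _ (by simp; split_ifs <;> omega) fun j => ?_
    simp [SimplexCategory.σ, Fin.predAbove, Fin.lt_def]
    split_ifs <;> simp <;> omega
  change barMap χ n (n + 1) (edge (SimplexCategory.Hom.toOrderHom (SimplexCategory.σ _))) = _
  rw [barMap_of_le, act_degeneracy (by omega) h]
  rw [h _ le_rfl]
  split_ifs <;> omega

end Bar
section Families

/-- A set of admissible lengths: finite families of admissible length can be concatenated. -/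
class SeqClosed (K : ℕ → Prop) : Prop where
  one : K 1
  sum : ∀ (n : ℕ) (f : Fin n → ℕ), K n → (∀ i, K (f i)) → K (∑ i, f i)

/-- All lengths, including `0`. -/
def AnyLength (_ : ℕ) : Prop := True

/-- All positive lengths. -/
def PosLength (n : ℕ) : Prop := 0 < n

instance : SeqClosed AnyLength := ⟨trivial, fun _ _ _ _ => trivial⟩

instance : SeqClosed PosLength where
  one := Nat.one_pos
  sum n f hn hf := (hf ⟨0, hn⟩).trans_le
    (Finset.single_le_sum (fun i _ => Nat.zero_le (f i)) (Finset.mem_univ _))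

/-- A finite sequence of objects of `A` whose length satisfies `K`. -/
structure Fam (K : ℕ → Prop) (A : Type u) where
  n : ℕ
  len : K n
  el : Fin n → A

namespace Fam

variable {K : ℕ → Prop} {A : Type u} [Groupoid.{v} A]

/-- A morphism of sequences: a permutation `perm` together with a morphism from the `i`-th entry of
`X` to the `j`-th entry of `Y` whenever `perm i = j`. -/
structure Hom (X Y : Fam K A) where
  perm : Fin X.n ≃ Fin Y.n
  hom : ∀ (i : Fin X.n) (j : Fin Y.n), perm i = j → (X.el i ⟶ Y.el j)

theorem Hom.ext' {X Y : Fam K A} {f g : Hom X Y} (hp : ∀ i, f.perm i = g.perm i)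
    (hh : ∀ i j h h', f.hom i j h = g.hom i j h') : f = g := by
  obtain ⟨p, a⟩ := f
  obtain ⟨q, b⟩ := g
  obtain rfl : p = q := Equiv.ext hp
  congr
  funext i j h
  exact hh i j h h

instance : Groupoid (Fam K A) where
  Hom := Hom
  id X := ⟨Equiv.refl _, fun i j h => eqToHom (congrArg X.el h)⟩
  comp f g := ⟨f.perm.trans g.perm, fun i k h => f.hom i (f.perm i) rfl ≫ g.hom (f.perm i) k h⟩
  id_comp f := Hom.ext' (fun _ => rfl) (fun i j h h' => Category.id_comp _)
  comp_id f := Hom.ext' (fun _ => rfl) (fun i j h h' => by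
    obtain rfl := h'
    simp)
  assoc f g h := Hom.ext' (fun _ => rfl) (fun i j h h' => by simp)
  inv f := ⟨f.perm.symm, fun j i h => Groupoid.inv (f.hom i j ((Equiv.symm_apply_eq _).1 h).symm)⟩
  inv_comp f := Hom.ext' (fun i => by simp) (fun i j h h' => by
    simp only [Equiv.trans_apply, Equiv.apply_symm_apply, Equiv.refl_apply] at h h'
    subst h'
    simp)
  comp_inv f := Hom.ext' (fun i => by simp) (fun i j h h' => by
    simp only [Equiv.trans_apply, Equiv.symm_apply_apply, Equiv.refl_apply] at h h'
    subst h'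
    simp)

@[simp]
theorem id_perm (X : Fam K A) (i : Fin X.n) : Hom.perm (𝟙 X) i = i := rfl

@[simp]
theorem comp_perm {X Y Z : Fam K A} (f : X ⟶ Y) (g : Y ⟶ Z) (i : Fin X.n) :
    Hom.perm (f ≫ g) i = Hom.perm g (Hom.perm f i) := rfl

theorem id_hom (X : Fam K A) (i j : Fin X.n) (h : i = j) :
    Hom.hom (𝟙 X) i j h = eqToHom (congrArg X.el h) := rfl

theorem comp_hom {X Y Z : Fam K A} (f : X ⟶ Y) (g : Y ⟶ Z) (i : Fin X.n) (j : Fin Y.n)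
    (k : Fin Z.n) (h : Hom.perm f i = j) (h' : Hom.perm g j = k) :
    Hom.hom (f ≫ g) i k (by rw [comp_perm, h, h']) = Hom.hom f i j h ≫ Hom.hom g j k h' := by
  subst h
  rfl

theorem hom_heq {X X' Y Y' : Fam K A} (hX : X = X') (hY : Y = Y') {f : X ⟶ Y} {f' : X' ⟶ Y'}
    (hp : ∀ (i : Fin X.n) (i' : Fin X'.n), (i : ℕ) = i' →
      (Hom.perm f i : ℕ) = Hom.perm f' i')
    (hh : ∀ (i : Fin X.n) (i' : Fin X'.n) (j : Fin Y.n) (j' : Fin Y'.n), (i : ℕ) = i' →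
      (j : ℕ) = j' → ∀ h h', HEq (Hom.hom f i j h) (Hom.hom f' i' j' h')) : HEq f f' := by
  subst hX hY
  refine heq_of_eq (Hom.ext' (fun i => Fin.ext (hp i i rfl)) fun i j h h' => ?_)
  exact eq_of_heq (hh i i j j rfl rfl h h')

theorem obj_ext {X Y : Fam K A} (e : Fin X.n ≃o Fin Y.n) (h : ∀ i, X.el i = Y.el (e i)) :
    X = Y := by
  obtain ⟨n, hn, a⟩ := X
  obtain ⟨m, hm, b⟩ := Y
  obtain rfl : n = m := by simpa using Fintype.card_congr e.toEquiv
  congr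
  funext i
  have he : e i = i := by rw [Subsingleton.elim e (OrderIso.refl _)]; rfl
  simpa [he] using h i

theorem orderIso_val {n m : ℕ} (e : Fin n ≃o Fin m) (i : Fin n) : (e i : ℕ) = i := by
  obtain rfl : n = m := by simpa using Fintype.card_congr e.toEquiv
  rw [Subsingleton.elim e (OrderIso.refl _)]
  rfl

theorem functor_ext {C : Type*} [Category* C] {F G : C ⥤ Fam K A} (I : C → Type)
    (r : ∀ x, I x → I x → Prop) (T : ∀ x, I x → A) (p : ∀ {x y}, (x ⟶ y) → I x → I y)
    (H : ∀ {x y} (f : x ⟶ y) (s : I x) (t : I y), p f s = t → (T x s ⟶ T y t))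
    (a : ∀ x, Fin (F.obj x).n ≃ I x) (b : ∀ x, Fin (G.obj x).n ≃ I x)
    (ar : ∀ x k l, k < l ↔ r x (a x k) (a x l)) (br : ∀ x k l, k < l ↔ r x (b x k) (b x l))
    (aT : ∀ x k, (F.obj x).el k = T x (a x k)) (bT : ∀ x k, (G.obj x).el k = T x (b x k))
    (ap : ∀ x y (f : x ⟶ y) k, a y (Hom.perm (F.map f) k) = p f (a x k))
    (bp : ∀ x y (f : x ⟶ y) k, b y (Hom.perm (G.map f) k) = p f (b x k))
    (aH : ∀ x y (f : x ⟶ y) k l h h', HEq (Hom.hom (F.map f) k l h) (H f (a x k) (a y l) h'))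
    (bH : ∀ x y (f : x ⟶ y) k l h h', HEq (Hom.hom (G.map f) k l h) (H f (b x k) (b y l) h')) :
    F = G := by
  let e : ∀ x, Fin (F.obj x).n ≃o Fin (G.obj x).n := fun x =>
    { toEquiv := (a x).trans (b x).symm
      map_rel_iff' := by
        intro k l
        rw [← not_lt, ← not_lt, br, ar]
        simp }
  have he : ∀ x k, b x (e x k) = a x k := fun x k => Equiv.apply_symm_apply _ _
  have hobj : ∀ x, F.obj x = G.obj x := fun x => obj_ext (e x) fun k => by rw [aT, bT, he]
  have hv : ∀ x (k : Fin (F.obj x).n) (k' : Fin (G.obj x).n), (k : ℕ) = k' → k' = e x k :=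
    fun x k k' h => Fin.ext (by rw [orderIso_val, h])
  refine Functor.hext hobj fun x y f => hom_heq (hobj x) (hobj y) (fun k k' hk => ?_)
    fun k k' l l' hk hl h h' => ?_
  · obtain rfl := hv x k k' hk
    rw [← orderIso_val (e y)]
    refine congrArg _ ((b y).injective ?_)
    rw [he, ap, bp, he]
  · obtain rfl := hv x k k' hk
    obtain rfl := hv y l l' hl
    have h1 : p f (a x k) = a y l := by rw [← ap, h]
    have key : ∀ s s' t t' (u : p f s = t) (u' : p f s' = t'), s = s' → t = t' →
        HEq (H f s t u) (H f s' t' u') := by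
      rintro s _ t _ u u' rfl rfl
      rfl
    refine (aH x y f k l h h1).trans ((key _ _ _ _ _ ?_ (he x k).symm (he y l).symm).trans
      (bH x y f (e x k) (e y l) h' ?_).symm)
    · rw [he, he, h1]
    · rw [he, he, h1]

variable {B : Type*} [Groupoid B]

/-- Apply a functor to every entry. -/
def map (K : ℕ → Prop) (F : A ⥤ B) : Fam K A ⥤ Fam K B where
  obj X := ⟨X.n, X.len, fun i => F.obj (X.el i)⟩
  map f := ⟨f.perm, fun i j h => F.map (f.hom i j h)⟩
  map_id X := Hom.ext' (fun _ => rfl) fun i j h h' => by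
    obtain rfl := h'
    exact F.map_id _
  map_comp f g := Hom.ext' (fun _ => rfl) fun i j h h' => F.map_comp _ _

variable [SeqClosed K]

/-- Sequences of length one. -/
def unit (K : ℕ → Prop) [SeqClosed K] (A : Type u) [Groupoid.{v} A] : A ⥤ Fam K A where
  obj a := ⟨1, SeqClosed.one, fun _ => a⟩
  map f := ⟨Equiv.refl _, fun _ _ _ => f⟩
  map_id a := Hom.ext' (fun _ => rfl) fun i j h h' => rfl
  map_comp f g := Hom.ext' (fun _ => rfl) fun i j h h' => rfl

/-- The lexicographic enumeration of the pairs `(i, j)` with `i < n` and `j < f i`. -/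
noncomputable def lexIso {n : ℕ} (f : Fin n → ℕ) : Fin (∑ i, f i) ≃o Σₗ i, Fin (f i) :=
  (Fintype.orderIsoFinOfCardEq _ (by
    rw [Fintype.card_lex, Fintype.card_sigma]
    simp))

noncomputable def idx {n : ℕ} (f : Fin n → ℕ) : Fin (∑ i, f i) ≃ Σ i, Fin (f i) :=
  (lexIso f).toEquiv.trans ofLex

def sigmaPerm {X Y : Fam K (Fam K A)} (φ : X ⟶ Y) :
    (Σ i, Fin (X.el i).n) ≃ Σ j, Fin (Y.el j).n :=
  Equiv.sigmaCongr φ.perm fun i => (φ.hom i (φ.perm i) rfl).perm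

theorem sigmaPerm_eq_iff {X Y : Fam K (Fam K A)} (φ : X ⟶ Y) (s : Σ i, Fin (X.el i).n)
    (t : Σ j, Fin (Y.el j).n) :
    sigmaPerm φ s = t ↔ ∃ h : φ.perm s.1 = t.1, (φ.hom s.1 t.1 h).perm s.2 = t.2 := by
  obtain ⟨i, a⟩ := s
  obtain ⟨j, b⟩ := t
  constructor
  · intro h
    obtain ⟨h1, h2⟩ := Sigma.mk.inj_iff.1 h
    dsimp at h1
    subst h1
    exact ⟨rfl, eq_of_heq h2⟩
  · rintro ⟨h1, h2⟩
    dsimp at h1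
    subst h1
    exact Sigma.ext rfl (heq_of_eq h2)

def sigmaHom {X Y : Fam K (Fam K A)} (φ : X ⟶ Y) (s : Σ i, Fin (X.el i).n)
    (t : Σ j, Fin (Y.el j).n) (h : sigmaPerm φ s = t) :
    (X.el s.1).el s.2 ⟶ (Y.el t.1).el t.2 :=
  (φ.hom s.1 t.1 ((sigmaPerm_eq_iff φ s t).1 h).1).hom s.2 t.2 ((sigmaPerm_eq_iff φ s t).1 h).2

theorem sigmaPerm_id (X : Fam K (Fam K A)) (s : Σ i, Fin (X.el i).n) :
    sigmaPerm (𝟙 X) s = s :=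
  (sigmaPerm_eq_iff _ _ _).2 ⟨rfl, rfl⟩

theorem sigmaPerm_comp {X Y Z : Fam K (Fam K A)} (φ : X ⟶ Y) (ψ : Y ⟶ Z)
    (s : Σ i, Fin (X.el i).n) : sigmaPerm (φ ≫ ψ) s = sigmaPerm ψ (sigmaPerm φ s) := rfl

theorem sigmaHom_id (X : Fam K (Fam K A)) (s : Σ i, Fin (X.el i).n)
    (h : sigmaPerm (𝟙 X) s = s) : sigmaHom (𝟙 X) s s h = 𝟙 _ := rfl

theorem sigmaHom_comp {X Y Z : Fam K (Fam K A)} (φ : X ⟶ Y) (ψ : Y ⟶ Z)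
    (s : Σ i, Fin (X.el i).n) (t : Σ i, Fin (Y.el i).n) (r : Σ i, Fin (Z.el i).n)
    (h : sigmaPerm φ s = t) (h' : sigmaPerm ψ t = r) (h'' : sigmaPerm (φ ≫ ψ) s = r) :
    sigmaHom (φ ≫ ψ) s r h'' = sigmaHom φ s t h ≫ sigmaHom ψ t r h' := by
  subst h
  subst h'
  rfl

/-- Concatenation of a sequence of sequences, in lexicographic order. -/
noncomputable def flattenObj (X : Fam K (Fam K A)) : Fam K A where
  n := ∑ i, (X.el i).n
  len := SeqClosed.sum _ _ X.len fun i => (X.el i).len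
  el k := (X.el (idx _ k).1).el (idx _ k).2

noncomputable def pos (X : Fam K (Fam K A)) :
    Fin (flattenObj X).n ≃ Σ i, Fin (X.el i).n := idx _

noncomputable def flattenMap {X Y : Fam K (Fam K A)} (φ : X ⟶ Y) :
    flattenObj X ⟶ flattenObj Y where
  perm := ((pos X).trans (sigmaPerm φ)).trans (pos Y).symm
  hom k l h := sigmaHom φ (pos X k) (pos Y l) ((Equiv.symm_apply_eq _).1 h)

theorem pos_flattenMap {X Y : Fam K (Fam K A)} (φ : X ⟶ Y) (k : Fin (flattenObj X).n) :
    pos Y (Hom.perm (flattenMap φ) k) = sigmaPerm φ (pos X k) :=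
  Equiv.apply_symm_apply _ _

theorem sigmaPerm_pos {X Y : Fam K (Fam K A)} (φ : X ⟶ Y) {k : Fin (flattenObj X).n}
    {l : Fin (flattenObj Y).n} (h : Hom.perm (flattenMap φ) k = l) :
    sigmaPerm φ (pos X k) = pos Y l := by rw [← h, pos_flattenMap]

theorem flattenMap_hom {X Y : Fam K (Fam K A)} (φ : X ⟶ Y) (k : Fin (flattenObj X).n)
    (l : Fin (flattenObj Y).n) (h : Hom.perm (flattenMap φ) k = l) :
    Hom.hom (flattenMap φ) k l h =
      sigmaHom φ (pos X k) (pos Y l) (sigmaPerm_pos φ h) := rfl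

theorem pos_lt (X : Fam K (Fam K A)) (k l : Fin (flattenObj X).n) : k < l ↔
    (pos X k).1 < (pos X l).1 ∨ (pos X k).1 = (pos X l).1 ∧ ((pos X k).2 : ℕ) < (pos X l).2 := by
  have h : k < l ↔ toLex (pos X k) < toLex (pos X l) :=
    (lexIso fun i => (X.el i).n).lt_iff_lt.symm
  rw [h, Sigma.Lex.lt_def]
  generalize pos X k = s
  generalize pos X l = t
  obtain ⟨i, a⟩ := s
  obtain ⟨j, b⟩ := t
  refine or_congr Iff.rfl ⟨?_, ?_⟩
  · rintro ⟨h1, h2⟩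
    have h3 : i = j := h1
    subst h3
    exact ⟨rfl, h2⟩
  · rintro ⟨h1, h2⟩
    dsimp at h1
    subst h1
    exact ⟨rfl, h2⟩

/-- The concatenation functor. -/
noncomputable def flatten (K : ℕ → Prop) [SeqClosed K] (A : Type u) [Groupoid.{v} A] :
    Fam K (Fam K A) ⥤ Fam K A where
  obj := flattenObj
  map := flattenMap
  map_id X := Hom.ext' (fun i => (pos X).injective (by
      rw [pos_flattenMap, sigmaPerm_id, id_perm])) fun i j h h' => by
    obtain rfl : i = j := h'
    rfl
  map_comp {X Y Z} φ ψ := Hom.ext' (fun i => (pos Z).injective (by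
      rw [pos_flattenMap, sigmaPerm_comp, comp_perm, pos_flattenMap, pos_flattenMap]))
    fun i j h h' => by
      rw [comp_hom _ _ _ _ _ rfl h']
      exact sigmaHom_comp φ ψ _ _ _ (sigmaPerm_pos φ rfl) (sigmaPerm_pos ψ h')
        (sigmaPerm_pos (φ ≫ ψ) h)

theorem unit_natural (F : A ⥤ B) : F ⋙ unit K B = unit K A ⋙ map K F := rfl

theorem flatten_natural (F : A ⥤ B) :
    map K (map K F) ⋙ flatten K B = flatten K A ⋙ map K F := rfl

/-- Positions in a sequence with a single entry `X`. -/
def uniqueSigma (X : Fam K A) : (Σ _ : Fin 1, Fin X.n) ≃ Fin X.n where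
  toFun s := s.2
  invFun a := ⟨0, a⟩
  left_inv s := Sigma.ext (Subsingleton.elim _ _) HEq.rfl

noncomputable def unitPos (X : Fam K A) :
    Fin (flattenObj ((unit K (Fam K A)).obj X)).n ≃ Fin X.n :=
  (pos ((unit K (Fam K A)).obj X)).trans (uniqueSigma X)

theorem left_unit : unit K (Fam K A) ⋙ flatten K A = 𝟭 _ := by
  refine functor_ext (fun X => Fin X.n) (fun X k l => k < l) (fun X => X.el)
    (fun f => Hom.perm f) (fun f => Hom.hom f) unitPos
    (fun X => Equiv.refl _) (fun X k l => ?_) (fun X k l => Iff.rfl)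
    (fun X k => rfl) (fun X k => rfl)
    (fun X Y f k => ?_) (fun X Y f k => rfl) (fun X Y f k l h h' => HEq.rfl)
    (fun X Y f k l h h' => HEq.rfl)
  · refine (pos_lt _ k l).trans ⟨fun h => ?_, fun h => Or.inr ⟨Subsingleton.elim (α := Fin 1) _ _, h⟩⟩
    rcases h with h | h
    · exact absurd h (not_lt.2 (Subsingleton.elim (α := Fin 1) _ _).le)
    · exact h.2
  · exact congrArg (uniqueSigma Y) (pos_flattenMap ((unit K (Fam K A)).map f) k)

def sigmaUnique (X : Fam K A) : (Σ _ : Fin X.n, Fin 1) ≃ Fin X.n where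
  toFun s := s.1
  invFun a := ⟨a, 0⟩
  left_inv s := Sigma.ext rfl (heq_of_eq (Subsingleton.elim _ _))

noncomputable def mapUnitPos (X : Fam K A) :
    Fin (flattenObj ((map K (unit K A)).obj X)).n ≃ Fin X.n :=
  (pos ((map K (unit K A)).obj X)).trans (sigmaUnique X)

theorem right_unit : map K (unit K A) ⋙ flatten K A = 𝟭 _ := by
  refine functor_ext (fun X => Fin X.n) (fun X k l => k < l) (fun X => X.el)
    (fun f => Hom.perm f) (fun f => Hom.hom f) mapUnitPos
    (fun X => Equiv.refl _) (fun X k l => ?_) (fun X k l => Iff.rfl)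
    (fun X k => rfl) (fun X k => rfl)
    (fun X Y f k => ?_) (fun X Y f k => rfl) (fun X Y f k l h h' => HEq.rfl)
    (fun X Y f k l h h' => HEq.rfl)
  · refine (pos_lt _ k l).trans ⟨fun h => ?_, fun h => Or.inl h⟩
    rcases h with h | h
    · exact h
    · have h1 : ((pos ((map K (unit K A)).obj X) k).2 : ℕ) < 1 := Fin.isLt _
      have h2 : ((pos ((map K (unit K A)).obj X) l).2 : ℕ) < 1 := Fin.isLt _
      have := h.2
      omega
  · exact congrArg (sigmaUnique Y) (pos_flattenMap ((map K (unit K A)).map f) k)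

/-- Positions in a sequence of sequences of sequences. -/
abbrev Triple (X : Fam K (Fam K (Fam K A))) : Type :=
  Σ (i : Fin X.n) (j : Fin (X.el i).n), Fin ((X.el i).el j).n

def Triple.lt {X : Fam K (Fam K (Fam K A))} (s t : Triple X) : Prop :=
  s.1 < t.1 ∨ s.1 = t.1 ∧ ((s.2.1 : ℕ) < t.2.1 ∨ (s.2.1 : ℕ) = t.2.1 ∧ (s.2.2 : ℕ) < t.2.2)

def triplePerm {X Y : Fam K (Fam K (Fam K A))} (φ : X ⟶ Y) (s : Triple X) : Triple Y :=
  ⟨φ.perm s.1, sigmaPerm (φ.hom s.1 _ rfl) s.2⟩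

theorem triplePerm_eq {X Y : Fam K (Fam K (Fam K A))} {φ : X ⟶ Y} {s : Triple X} {t : Triple Y}
    (h : triplePerm φ s = t) :
    ∃ h : φ.perm s.1 = t.1, sigmaPerm (φ.hom s.1 t.1 h) s.2 = t.2 := by
  subst h
  exact ⟨rfl, rfl⟩

def tripleHom {X Y : Fam K (Fam K (Fam K A))} (φ : X ⟶ Y) (s : Triple X) (t : Triple Y)
    (h : triplePerm φ s = t) :
    ((X.el s.1).el s.2.1).el s.2.2 ⟶ ((Y.el t.1).el t.2.1).el t.2.2 :=
  sigmaHom (φ.hom s.1 t.1 (triplePerm_eq h).1) s.2 t.2 (triplePerm_eq h).2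

noncomputable def triple₁ (X : Fam K (Fam K (Fam K A))) :
    Fin (flattenObj ((map K (flatten K A)).obj X)).n ≃ Triple X :=
  (pos ((map K (flatten K A)).obj X)).trans
    (Equiv.sigmaCongrRight (β₁ := fun i : Fin X.n => Fin (flattenObj (X.el i)).n)
      fun i => pos (X.el i))

noncomputable def triple₂ (X : Fam K (Fam K (Fam K A))) :
    Fin (flattenObj (flattenObj X)).n ≃ Triple X :=
  (pos (flattenObj X)).trans
    ((Equiv.sigmaCongrLeft (β := fun s : Σ i, Fin (X.el i).n => Fin ((X.el s.1).el s.2).n)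
      (pos X)).trans
      (Equiv.sigmaAssoc fun i j => Fin ((X.el i).el j).n))

noncomputable def expand (X : Fam K (Fam K (Fam K A))) (s : Σ i, Fin (((map K (flatten K A)).obj X).el i).n) :
    Triple X := ⟨s.1, pos (X.el s.1) s.2⟩

theorem triple₁_apply (X : Fam K (Fam K (Fam K A)))
    (k : Fin (flattenObj ((map K (flatten K A)).obj X)).n) :
    triple₁ X k = expand X (pos _ k) := rfl

theorem triple₁_lt (X : Fam K (Fam K (Fam K A)))
    (k l : Fin (flattenObj ((map K (flatten K A)).obj X)).n) :
    k < l ↔ (triple₁ X k).lt (triple₁ X l) := by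
  refine (pos_lt _ k l).trans ?_
  rw [triple₁_apply, triple₁_apply]
  generalize pos ((map K (flatten K A)).obj X) k = s
  generalize pos ((map K (flatten K A)).obj X) l = t
  obtain ⟨i, a⟩ := s
  obtain ⟨j, b⟩ := t
  refine or_congr Iff.rfl (and_congr_right fun h1 => ?_)
  have h2 : i = j := h1
  subst h2
  refine (pos_lt (X.el i) a b).trans (or_congr Iff.rfl (and_congr_left fun _ => ?_))
  exact Fin.ext_iff

theorem triple₂_apply (X : Fam K (Fam K (Fam K A))) (k : Fin (flattenObj (flattenObj X)).n) :
    triple₂ X k = ⟨(pos X (pos (flattenObj X) k).1).1, (pos X (pos (flattenObj X) k).1).2,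
      (pos (flattenObj X) k).2⟩ := rfl

theorem triple₂_lt (X : Fam K (Fam K (Fam K A))) (k l : Fin (flattenObj (flattenObj X)).n) :
    k < l ↔ (triple₂ X k).lt (triple₂ X l) := by
  refine (pos_lt _ k l).trans ?_
  rw [triple₂_apply, triple₂_apply]
  generalize pos (flattenObj X) k = s
  generalize pos (flattenObj X) l = t
  obtain ⟨p, c⟩ := s
  obtain ⟨q, d⟩ := t
  change p < q ∨ p = q ∧ (c : ℕ) < d ↔ (pos X p).1 < (pos X q).1 ∨ (pos X p).1 = (pos X q).1 ∧
    (((pos X p).2 : ℕ) < (pos X q).2 ∨ ((pos X p).2 : ℕ) = (pos X q).2 ∧ (c : ℕ) < d)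
  have h1 : p = q ↔ (pos X p).1 = (pos X q).1 ∧ ((pos X p).2 : ℕ) = (pos X q).2 := by
    rw [← (pos X).injective.eq_iff]
    generalize pos X p = s
    generalize pos X q = t
    obtain ⟨i, a⟩ := s
    obtain ⟨j, b⟩ := t
    constructor
    · intro h
      obtain ⟨rfl, h2⟩ := Sigma.mk.inj_iff.1 h
      exact ⟨rfl, by rw [eq_of_heq h2]⟩
    · rintro ⟨h2, h3⟩
      have h4 : i = j := h2
      subst h4
      exact Sigma.ext rfl (heq_of_eq (Fin.ext h3))
  rw [pos_lt, h1]
  tauto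

theorem triple₁_perm {X Y : Fam K (Fam K (Fam K A))} (φ : X ⟶ Y)
    (k : Fin (flattenObj ((map K (flatten K A)).obj X)).n) :
    triple₁ Y (Hom.perm (flattenMap ((map K (flatten K A)).map φ)) k) =
      triplePerm φ (triple₁ X k) := by
  rw [triple₁_apply, triple₁_apply, pos_flattenMap]
  exact Sigma.ext rfl (heq_of_eq (pos_flattenMap _ _))

theorem triple₂_perm {X Y : Fam K (Fam K (Fam K A))} (φ : X ⟶ Y)
    (k : Fin (flattenObj (flattenObj X)).n) :
    triple₂ Y (Hom.perm (flattenMap (flattenMap φ)) k) = triplePerm φ (triple₂ X k) := by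
  rw [triple₂_apply, triple₂_apply, pos_flattenMap]
  generalize pos (flattenObj X) k = s
  obtain ⟨p, c⟩ := s
  have key : ∀ (t : Σ j, Fin (Y.el j).n) (h : sigmaPerm φ (pos X p) = t),
      (⟨t.1, t.2, Hom.perm (sigmaHom φ _ t h) c⟩ : Triple Y) =
        triplePerm φ ⟨(pos X p).1, (pos X p).2, c⟩ := by
    rintro t rfl
    rfl
  exact key _ (sigmaPerm_pos φ rfl)

theorem flatten_assoc : map K (flatten K A) ⋙ flatten K A =
    flatten K (Fam K A) ⋙ flatten K A :=
  functor_ext Triple (fun X => Triple.lt) (fun X s => ((X.el s.1).el s.2.1).el s.2.2)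
    triplePerm tripleHom triple₁ triple₂ triple₁_lt triple₂_lt
    (fun X k => rfl) (fun X k => rfl)
    (fun X Y f k => triple₁_perm f k) (fun X Y f k => triple₂_perm f k)
    (fun X Y f k l h h' => HEq.rfl) (fun X Y f k l h h' => HEq.rfl)

/-- The strength: `a` together with a sequence `(b_i)` gives the sequence `(a, b_i)`. -/
def strength (K : ℕ → Prop) (A B : Type*) [Groupoid A] [Groupoid B] :
    A × Fam K B ⥤ Fam K (A × B) where
  obj p := ⟨p.2.n, p.2.len, fun i => (p.1, p.2.el i)⟩
  map f := ⟨f.2.perm, fun i j h => (f.1, f.2.hom i j h)⟩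
  map_id p := Hom.ext' (fun _ => rfl) fun i j h h' => by
    obtain rfl := h'
    rfl
  map_comp f g := Hom.ext' (fun _ => rfl) fun i j h h' => rfl

theorem strength_flatten {A B : Type*} [Groupoid A] [Groupoid B] :
    (𝟭 A).prod (flatten K B) ⋙ strength K A B =
      strength K A (Fam K B) ⋙ map K (strength K A B) ⋙ flatten K (A × B) := rfl

end Fam

/-- The inclusion of sequences of one kind into sequences of another kind. -/
def Fam.incl {K K' : ℕ → Prop} (h : ∀ n, K n → K' n) (A : Type u) [Groupoid.{v} A] :
    Fam K A ⥤ Fam K' A where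
  obj X := ⟨X.n, h _ X.len, X.el⟩
  map f := ⟨f.perm, f.hom⟩
  map_id _ := rfl
  map_comp _ _ := rfl

end Families

section Groupoids

/-- The one-point groupoid. -/
structure Pt : Type u where

instance : Groupoid.{v} Pt.{u} where
  Hom _ _ := PUnit.{v + 1}
  id _ := PUnit.unit
  comp _ _ := PUnit.unit
  inv _ := PUnit.unit

def grpdTerminal : IsTerminal (Grpd.of.{v, u} Pt.{u}) :=
  IsTerminal.ofUniqueHom (fun C => ({ obj := fun _ => ⟨⟩, map := fun _ => PUnit.unit } : C ⥤ Pt))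
    fun _ _ => rfl

end Groupoids

section Groupoids

def grpdProd (A B : Grpd.{v, u}) : LimitCone (pair A B) where
  cone := BinaryFan.mk (P := Grpd.of (A × B)) (CategoryTheory.Prod.fst A B)
    (CategoryTheory.Prod.snd A B)
  isLimit := BinaryFan.isLimitMk (fun S => Functor.prod' S.fst S.snd) (fun _ => rfl)
    (fun _ => rfl) (fun S m h₁ h₂ => by
      have h₁' : (m : S.pt ⥤ A × B) ⋙ CategoryTheory.Prod.fst A B = S.fst := h₁
      have h₂' : (m : S.pt ⥤ A × B) ⋙ CategoryTheory.Prod.snd A B = S.snd := h₂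
      rw [← h₁', ← h₂']
      rfl)

/-- The cartesian structure of the category of groupoids, with the usual products. -/
instance : CartesianMonoidalCategory Grpd.{v, u} :=
  .ofChosenFiniteProducts ⟨_, grpdTerminal⟩ grpdProd

theorem grpd_tensorObj (A B : Grpd.{v, u}) : A ⊗ B = Grpd.of (A × B) := rfl

theorem grpd_fst (A B : Grpd.{v, u}) : fst A B = CategoryTheory.Prod.fst A B := rfl

theorem grpd_snd (A B : Grpd.{v, u}) : snd A B = CategoryTheory.Prod.snd A B := rfl

variable {A B C : Type u} [Groupoid.{v} A] [Groupoid.{v} B] [Groupoid.{v} C]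

/-- The strict fibre product of groupoids: pairs of objects with equal images. -/
structure StrictPullback (F : A ⥤ C) (G : B ⥤ C) where
  fst : A
  snd : B
  eq : F.obj fst = G.obj snd

namespace StrictPullback

variable {F : A ⥤ C} {G : B ⥤ C}

/-- Pairs of morphisms with equal images. -/
@[ext]
structure Hom (p q : StrictPullback F G) where
  fst : p.fst ⟶ q.fst
  snd : p.snd ⟶ q.snd
  eq : HEq (F.map fst) (G.map snd)

theorem comp_heq {a b c a' b' c' : C} (ha : a = a') (hb : b = b') (hc : c = c') {f : a ⟶ b}
    {f' : a' ⟶ b'} {g : b ⟶ c} {g' : b' ⟶ c'} (hf : HEq f f') (hg : HEq g g') :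
    HEq (f ≫ g) (f' ≫ g') := by
  subst ha hb hc hf hg
  rfl

theorem inv_heq {a b a' b' : C} (ha : a = a') (hb : b = b') {f : a ⟶ b}
    {f' : a' ⟶ b'} (hf : HEq f f') : HEq (Groupoid.inv f) (Groupoid.inv f') := by
  subst ha hb hf
  rfl

instance : Groupoid (StrictPullback F G) where
  Hom := Hom
  id p := ⟨𝟙 _, 𝟙 _, by rw [F.map_id, G.map_id, p.eq]⟩
  comp {p q r} f g := ⟨f.fst ≫ g.fst, f.snd ≫ g.snd, by
    rw [F.map_comp, G.map_comp]
    exact comp_heq p.eq q.eq r.eq f.eq g.eq⟩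
  id_comp _ := Hom.ext (Category.id_comp _) (Category.id_comp _)
  comp_id _ := Hom.ext (Category.comp_id _) (Category.comp_id _)
  assoc _ _ _ := Hom.ext (Category.assoc _ _ _) (Category.assoc _ _ _)
  inv {p q} f := ⟨Groupoid.inv f.fst, Groupoid.inv f.snd, by
    have h := inv_heq p.eq q.eq f.eq
    simp only [Groupoid.inv_eq_inv, Functor.map_inv] at h ⊢
    exact h⟩
  inv_comp _ := Hom.ext (Groupoid.inv_comp _) (Groupoid.inv_comp _)
  comp_inv _ := Hom.ext (Groupoid.comp_inv _) (Groupoid.comp_inv _)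

variable (F G)

def fstFunctor : StrictPullback F G ⥤ A where
  obj p := p.fst
  map f := f.fst

def sndFunctor : StrictPullback F G ⥤ B where
  obj p := p.snd
  map f := f.snd

theorem condition : fstFunctor F G ⋙ F = sndFunctor F G ⋙ G :=
  Functor.hext (fun p => p.eq) fun _ _ f => f.eq

variable {F G}

def liftFunctor {Z : Type*} [Category* Z] (a : Z ⥤ A) (b : Z ⥤ B) (h : a ⋙ F = b ⋙ G) :
    Z ⥤ StrictPullback F G where
  obj z := ⟨a.obj z, b.obj z, Functor.congr_obj h z⟩
  map f := ⟨a.map f, b.map f, by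
    have : ∀ H : Z ⥤ C, a ⋙ F = H → HEq (F.map (a.map f)) (H.map f) := by
      rintro _ rfl
      rfl
    exact this _ h⟩
  map_id z := Hom.ext (a.map_id z) (b.map_id z)
  map_comp f g := Hom.ext (a.map_comp f g) (b.map_comp f g)

theorem lift_unique {Z : Type*} [Category* Z] (m m' : Z ⥤ StrictPullback F G)
    (h₁ : m ⋙ fstFunctor F G = m' ⋙ fstFunctor F G)
    (h₂ : m ⋙ sndFunctor F G = m' ⋙ sndFunctor F G) : m = m' := by
  have e : ∀ n : Z ⥤ StrictPullback F G, n = liftFunctor (n ⋙ fstFunctor F G)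
    (n ⋙ sndFunctor F G) (by rw [Functor.assoc, Functor.assoc, condition]) := fun n => rfl
  rw [e m, e m']
  congr 1

end StrictPullback

/-- In the category of groupoids, the chosen pullbacks are the strict fibre products. -/
instance : ChosenPullbacks Grpd.{v, u} where
  choose {A B C} F G :=
    { obj := Grpd.of (StrictPullback (F : A ⥤ C) (G : B ⥤ C))
      fst := StrictPullback.fstFunctor F G
      snd := StrictPullback.sndFunctor F G
      isPullback := ⟨⟨StrictPullback.condition F G⟩, ⟨PullbackCone.IsLimit.mk _
        (fun s => StrictPullback.liftFunctor s.fst s.snd s.condition)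
        (fun s => rfl) (fun s => rfl)
        (fun s m h₁ h₂ => StrictPullback.lift_unique _ _ h₁ h₂)⟩⟩ }

end Groupoids

section FamilyMonads

variable (K : ℕ → Prop) [SeqClosed K]

/-- The monad on groupoids of finite sequences with length in `K`, with its strength. -/
noncomputable def famMonad : StrongMonad Grpd.{v, u} where
  obj A := Grpd.of (Fam K A)
  map {A B} F := Fam.map K (F : A ⥤ B)
  map_id _ := rfl
  map_comp _ _ := rfl
  η := { app := fun A => Fam.unit K A, naturality := fun A B F => Fam.unit_natural (F : A ⥤ B) }
  μ := { app := fun A => Fam.flatten K A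
         naturality := fun A B F => Fam.flatten_natural (F : A ⥤ B) }
  assoc A := Fam.flatten_assoc (A := A)
  left_unit A := Fam.left_unit (A := A)
  right_unit A := Fam.right_unit (A := A)
  str A B := Fam.strength K A B
  str_natural _ _ := rfl
  str_unit _ := rfl
  str_assoc _ _ _ := rfl
  str_η _ _ := rfl
  str_μ A B := Fam.strength_flatten (A := A) (B := B)

namespace Fam

variable {K} {A B : Type u} [Groupoid.{v} A] [Groupoid.{v} B] {Z : Type*} [Category* Z]

theorem prod_obj_ext {X Y : Fam K (A × B)}
    (h₁ : (map K (CategoryTheory.Prod.fst A B)).obj X = (map K (CategoryTheory.Prod.fst A B)).obj Y)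
    (h₂ : (map K (CategoryTheory.Prod.snd A B)).obj X = (map K (CategoryTheory.Prod.snd A B)).obj Y) :
    X = Y := by
  obtain ⟨n, hn, x⟩ := X
  obtain ⟨m, hm, y⟩ := Y
  simp only [map, mk.injEq] at h₁ h₂
  obtain ⟨rfl, h₁⟩ := h₁
  have h₃ := h₂.2
  congr
  funext i
  exact Prod.ext (congrFun (eq_of_heq h₁) i) (congrFun (eq_of_heq h₃) i)

theorem hom_congr {V W : Fam K A} {φ ψ : V ⟶ W} (e : φ = ψ) (i : Fin V.n) (j : Fin W.n)
    (h : Hom.perm φ i = j) (h' : Hom.perm ψ i = j) : Hom.hom φ i j h = Hom.hom ψ i j h' := by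
  subst e
  rfl

theorem prod_hom_ext {X Y X' Y' : Fam K (A × B)} (hX : X = X') (hY : Y = Y') {f : X ⟶ Y}
    {g : X' ⟶ Y'}
    (h₁ : HEq ((map K (CategoryTheory.Prod.fst A B)).map f)
      ((map K (CategoryTheory.Prod.fst A B)).map g))
    (h₂ : HEq ((map K (CategoryTheory.Prod.snd A B)).map f)
      ((map K (CategoryTheory.Prod.snd A B)).map g)) : HEq f g := by
  subst hX hY
  have h₃ := eq_of_heq h₁
  have h₄ := eq_of_heq h₂
  refine heq_of_eq (Hom.ext' (fun i => ?_) fun i j h h' => ?_)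
  · exact congrFun (congrArg (fun φ => (Hom.perm φ : _ → _)) h₃) i
  · exact Prod.ext (hom_congr h₃ i j h h') (hom_congr h₄ i j h h')

theorem prod_functor_ext {F G : Z ⥤ Fam K (A × B)}
    (h₁ : F ⋙ map K (CategoryTheory.Prod.fst A B) = G ⋙ map K (CategoryTheory.Prod.fst A B))
    (h₂ : F ⋙ map K (CategoryTheory.Prod.snd A B) = G ⋙ map K (CategoryTheory.Prod.snd A B)) :
    F = G := by
  have hobj : ∀ z, F.obj z = G.obj z := fun z =>
    prod_obj_ext (Functor.congr_obj h₁ z) (Functor.congr_obj h₂ z)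
  have k : ∀ {C : Type u} [Groupoid.{v} C] (U V : Z ⥤ Fam K C) (e : U = V) {z w : Z} (f : z ⟶ w),
      HEq (U.map f) (V.map f) := by
    rintro C _ U _ rfl z w f
    rfl
  exact Functor.hext hobj fun z w f =>
    prod_hom_ext (hobj z) (hobj w) (k _ _ h₁ f) (k _ _ h₂ f)

/-- Two families of functors with the same shape form a family of pairs. -/
def zip (F : Z ⥤ Fam K A) (G : Z ⥤ Fam K B) (hn : ∀ z, (F.obj z).n = (G.obj z).n)
    (hp : ∀ {z w} (f : z ⟶ w) i, Fin.cast (hn w) (Hom.perm (F.map f) i) =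
      Hom.perm (G.map f) (Fin.cast (hn z) i)) : Z ⥤ Fam K (A × B) where
  obj z := ⟨(F.obj z).n, (F.obj z).len,
    fun i => ((F.obj z).el i, (G.obj z).el (Fin.cast (hn z) i))⟩
  map {z w} f :=
    { perm := Hom.perm (X := F.obj z) (Y := F.obj w) (F.map f)
      hom := fun i j h => (Hom.hom (F.map f) i j h, Hom.hom (G.map f) (Fin.cast (hn z) i)
        (Fin.cast (hn w) j) ((hp f i).symm.trans (congrArg _ h))) }
  map_id z := Hom.ext' (fun i => congrArg (fun φ : F.obj z ⟶ F.obj z => Hom.perm φ i) (F.map_id z))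
    fun i j h h' => by
      obtain rfl : i = j := h'
      exact Prod.ext (hom_congr (F.map_id z) i i h rfl) (hom_congr (G.map_id z) _ _ _ rfl)
  map_comp {z w y} f g := Hom.ext'
    (fun i => congrArg (fun φ : F.obj z ⟶ F.obj y => Hom.perm φ i) (F.map_comp f g))
    fun i j h h' => by
      refine Prod.ext (hom_congr (F.map_comp f g) i j h h') ?_
      refine (hom_congr (G.map_comp f g) _ _ _ ?_).trans (comp_hom _ _ _ _ _ ?_ ?_)
      · refine Eq.trans ?_ ((hp (f ≫ g) i).symm.trans (congrArg (Fin.cast (hn y)) h))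
        exact congrArg (fun φ : G.obj z ⟶ G.obj y => Hom.perm φ _) (G.map_comp f g).symm
      · exact (hp f i).symm
      · exact (hp g _).symm.trans (congrArg (Fin.cast (hn y)) h')

theorem zip_fst (F : Z ⥤ Fam K A) (G : Z ⥤ Fam K B) (hn : ∀ z, (F.obj z).n = (G.obj z).n)
    (hp : ∀ {z w} (f : z ⟶ w) i, Fin.cast (hn w) (Hom.perm (F.map f) i) =
      Hom.perm (G.map f) (Fin.cast (hn z) i)) :
    zip F G hn hp ⋙ map K (CategoryTheory.Prod.fst A B) = F := rfl

theorem zip_snd (F : Z ⥤ Fam K A) (G : Z ⥤ Fam K B) (hn : ∀ z, (F.obj z).n = (G.obj z).n)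
    (hp : ∀ {z w} (f : z ⟶ w) i, Fin.cast (hn w) (Hom.perm (F.map f) i) =
      Hom.perm (G.map f) (Fin.cast (hn z) i)) :
    zip F G hn hp ⋙ map K (CategoryTheory.Prod.snd A B) = G :=
  functor_ext (fun z => Fin (G.obj z).n) (fun _ k l => k < l) (fun z => (G.obj z).el)
    (fun f => Hom.perm (G.map f)) (fun f => Hom.hom (G.map f))
    (fun z => finCongr (hn z)) (fun z => Equiv.refl _) (fun _ _ _ => Iff.rfl)
    (fun _ _ _ => Iff.rfl) (fun _ _ => rfl) (fun _ _ => rfl) (fun _ _ f k => hp f k)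
    (fun _ _ _ _ => rfl) (fun _ _ _ _ _ _ _ => HEq.rfl) (fun _ _ _ _ _ _ _ => HEq.rfl)

theorem shape_eq {F : Z ⥤ Fam K A} {G : Z ⥤ Fam K B} {f : A ⥤ Pt.{u}} {g : B ⥤ Pt.{u}}
    (h : F ⋙ map K f = G ⋙ map K g) (z : Z) : (F.obj z).n = (G.obj z).n :=
  congrArg Fam.n (Functor.congr_obj h z)

theorem shape_perm {F : Z ⥤ Fam K A} {G : Z ⥤ Fam K B} {f : A ⥤ Pt.{u}} {g : B ⥤ Pt.{u}}
    (h : F ⋙ map K f = G ⋙ map K g) {z w : Z} (φ : z ⟶ w) (i : Fin (F.obj z).n) :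
    Fin.cast (shape_eq h w) (Hom.perm (F.map φ) i) =
      Hom.perm (G.map φ) (Fin.cast (shape_eq h z) i) := by
  have key : ∀ (U V : Z ⥤ Fam K Pt.{u}) (e : U = V) (i : Fin (U.obj z).n) (j : Fin (V.obj z).n),
      (i : ℕ) = j → (Hom.perm (U.map φ) i : ℕ) = Hom.perm (V.map φ) j := by
    rintro U _ rfl i j hij
    rw [Fin.ext hij]
  exact Fin.ext (key _ _ h i _ rfl)

theorem product_square (f : A ⥤ Pt.{u}) (g : B ⥤ Pt.{u}) :
    IsPullback (C := Grpd.{v, u}) (P := Grpd.of (Fam K (A × B))) (X := Grpd.of (Fam K A))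
      (Y := Grpd.of (Fam K B)) (Z := Grpd.of (Fam K Pt))
      (map K (CategoryTheory.Prod.fst A B)) (map K (CategoryTheory.Prod.snd A B))
      (map K f) (map K g) :=
  ⟨⟨rfl⟩, ⟨PullbackCone.IsLimit.mk _
    (fun s => zip s.fst s.snd (shape_eq s.condition) (shape_perm s.condition))
    (fun s => zip_fst _ _ _ _) (fun s => zip_snd _ _ _ _)
    (fun s m h₁ h₂ => prod_functor_ext (h₁.trans (zip_fst _ _ _ _).symm)
      (h₂.trans (zip_snd _ _ _ _).symm))⟩⟩

end Fam

instance : PreservesProductSquares (famMonad.{v, u} K).toMonad where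
  isPullback A B := Fam.product_square (A := A) (B := B) (toUnit A) (toUnit B)

/-- The inclusion of nonempty sequences into all sequences, as a map of monads. -/
def famIncl {K K' : ℕ → Prop} [SeqClosed K] [SeqClosed K'] (h : ∀ n, K n → K' n) :
    (famMonad.{v, u} K).toMonad ⟶ (famMonad.{v, u} K').toMonad where
  app A := Fam.incl h A
  naturality _ _ _ := rfl
  app_η _ := rfl
  app_μ _ := rfl

end FamilyMonads

section Pyramids

/-- The positions `(i, j)` with `0 ≤ i ≤ j ≤ n` in a pyramid of height `n`. -/
@[ext]
structure Pyr (n : ℕ) where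
  i : Fin (n + 1)
  j : Fin (n + 1)
  le : i ≤ j

/-- The order generated by `(i, j) ⟶ (i, j - 1)`, `(i, j) ⟶ (i + 1, j)` and the horizontal steps
`(i, i) ⟶ (i + 1, i + 1)`. -/
instance (n : ℕ) : PartialOrder (Pyr n) where
  le p q := p.i ≤ q.i ∧ (q.j ≤ p.j ∨ q.i = q.j)
  le_refl p := ⟨le_rfl, Or.inl le_rfl⟩
  le_trans p q r h h' := by
    refine ⟨h.1.trans h'.1, ?_⟩
    rcases h'.2 with h₁ | h₁
    · rcases h.2 with h₂ | h₂
      · exact Or.inl (h₁.trans h₂)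
      · exact Or.inr (le_antisymm r.le ((h₁.trans h₂.ge).trans h'.1))
    · exact Or.inr h₁
  le_antisymm p q h h' := by
    have h₁ : p.i = q.i := le_antisymm h.1 h'.1
    refine Pyr.ext h₁ (le_antisymm ?_ ?_)
    · rcases h'.2 with h₂ | h₂
      · exact h₂
      · rw [← h₂, h₁]
        exact q.le
    · rcases h.2 with h₂ | h₂
      · exact h₂
      · rw [← h₂, ← h₁]
        exact p.le

theorem Pyr.le_iff {n : ℕ} (p q : Pyr n) : p ≤ q ↔ p.i ≤ q.i ∧ (q.j ≤ p.j ∨ q.i = q.j) := Iff.rfl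

/-- The map of positions induced by a monotone map. -/
def pyrMap {m n : ℕ} (θ : Fin (m + 1) →o Fin (n + 1)) : Pyr m ⥤ Pyr n :=
  Monotone.functor (f := fun p => ⟨θ p.i, θ p.j, θ.monotone p.le⟩) fun _ _ h =>
    ⟨θ.monotone h.1, h.2.imp (fun h' => θ.monotone h') (fun h' => congrArg θ h')⟩

/-- A pyramid of height `n` of sets in the class `C`: a commutative diagram of surjections
`t_ij ⟶ t_i,j-1`, `t_ij ⟶ t_i+1,j` and `t_ii ⟶ t_i+1,i+1`, in which all squares (equivalently, all
rectangles) are pullbacks. -/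
structure Pyramid (C : Type → Prop) (n : ℕ) where
  diagram : Pyr n ⥤ Type
  mem : ∀ p, C (diagram.obj p)
  surjective : ∀ {p q} (f : p ⟶ q), Function.Surjective (diagram.map f)
  isPullback : ∀ {i k l j : Fin (n + 1)} (hik : i ≤ k) (hkl : k ≤ l) (hlj : l ≤ j),
    IsPullback
      (diagram.map (homOfLE ⟨le_rfl, Or.inl hlj⟩ :
        (⟨i, j, hik.trans (hkl.trans hlj)⟩ : Pyr n) ⟶ ⟨i, l, hik.trans hkl⟩))
      (diagram.map (homOfLE ⟨hik, Or.inl le_rfl⟩ :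
        (⟨i, j, hik.trans (hkl.trans hlj)⟩ : Pyr n) ⟶ ⟨k, j, hkl.trans hlj⟩))
      (diagram.map (homOfLE ⟨hik, Or.inl le_rfl⟩ :
        (⟨i, l, hik.trans hkl⟩ : Pyr n) ⟶ ⟨k, l, hkl⟩))
      (diagram.map (homOfLE ⟨le_rfl, Or.inl hlj⟩ :
        (⟨k, j, hkl.trans hlj⟩ : Pyr n) ⟶ ⟨k, l, hkl⟩))

/-- The morphisms of pyramids are the levelwise bijections which commute with the maps. -/
instance (C : Type → Prop) (n : ℕ) : Groupoid (Pyramid C n) where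
  Hom X Y := X.diagram ≅ Y.diagram
  id X := Iso.refl _
  comp f g := f ≪≫ g
  inv f := f.symm

/-- Restriction of a pyramid along a monotone map. -/
def Pyramid.restrict {C : Type → Prop} {m n : ℕ} (θ : Fin (m + 1) →o Fin (n + 1)) :
    Pyramid C n ⥤ Pyramid C m where
  obj X :=
    { diagram := pyrMap θ ⋙ X.diagram
      mem := fun _ => X.mem _
      surjective := fun _ => X.surjective _
      isPullback := fun hik hkl hlj =>
        X.isPullback (θ.monotone hik) (θ.monotone hkl) (θ.monotone hlj) }
  map f := Functor.isoWhiskerLeft (pyrMap θ) f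
  map_id _ := rfl
  map_comp _ _ := rfl

/-- The simplicial groupoid of pyramids of sets in the class `C`. The face `d_i` removes the sets
`t_jk` with `j = i` or `k = i`, and the degeneracy `s_i` repeats the sets with index `i`. -/
def pyramids (C : Type → Prop) : SimplicialObject Grpd.{0, 1} where
  obj n := Grpd.of (Pyramid C n.unop.len)
  map θ := Pyramid.restrict θ.unop.toOrderHom
  map_id _ := rfl
  map_comp _ _ := rfl

/-- The simplicial groupoid `TS`. -/
def TS : SimplicialObject Grpd.{0, 1} := pyramids Finite

/-- The full simplicial subgroupoid of `TS` of the pyramids of nonempty sets. -/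
def TSpos : SimplicialObject Grpd.{0, 1} := pyramids fun X => Finite X ∧ Nonempty X

end Pyramids

section Main

/-- There is a map of simplicial groupoids from `X` to `Y` which is an equivalence of groupoids in
every simplicial degree. -/
def SimplicialEquivalence (X Y : SimplicialObject Grpd.{v, u}) : Prop :=
  ∃ F : X ⟶ Y, ∀ n, Functor.IsEquivalence (C := X.obj n) (D := Y.obj n) (F.app n)

/-- The monad `S^r`: `S^r A` is the free symmetric semimonoidal groupoid on `A`, with the nonempty
finite sequences of objects of `A` as objects. -/
noncomputable def Sr : StrongMonad Grpd.{v, u} := famMonad PosLength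

/-- The monad `S`: `S A` is the free symmetric monoidal groupoid on `A`, with all finite sequences
of objects of `A` as objects. -/
noncomputable def S : StrongMonad Grpd.{v, u} := famMonad AnyLength

instance : PreservesProductSquares (Sr.{v, u}).toMonad :=
  inferInstanceAs (PreservesProductSquares (famMonad PosLength).toMonad)

/-- The inclusion of `S^r` into `S`. -/
noncomputable def SrToS : Sr.{v, u}.toMonad ⟶ S.{v, u}.toMonad := famIncl fun _ _ => trivial

/-- The operad `Sym`, the terminal `S^r`-operad. -/
noncomputable def Sym : Operad Sr.{v, u}.toMonad := terminalOperad Sr.toMonad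

/-- The operad `T^(S^r)(Sym)`: the `T`-construction of the monoid of operations of `Sym`. -/
noncomputable def TSym : Operad Sr.{v, u}.toMonad := tOperad Sr Sym.toMon

/-- The two-sided bar construction of a `P`-operad, with `n`-simplices `P Q^n 𝟙`. -/
noncomputable def Operad.bar {E : Type u} [Category.{v} E] [CartesianMonoidalCategory E]
    [ChosenPullbacks E] {P : Monad E} (O : Operad P) : SimplicialObject E :=
  Plethysm.bar (M := O.monad) (R := P) O.toP

/-- The two-sided bar construction of a `P`-operad relative to a monad map `ψ : P ⟶ R`, with
`n`-simplices `R Q^n 𝟙`. -/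
noncomputable def Operad.barRel {E : Type u} [Category.{v} E] [CartesianMonoidalCategory E]
    [ChosenPullbacks E] {P R : Monad E} (O : Operad P) (ψ : P ⟶ R) : SimplicialObject E :=
  Plethysm.bar (M := O.monad) (R := R)
    ((show O.monad ⟶ P from O.toP) ≫ ψ)

end Main

end Plethysm

/-! The functor S^r preserves the pullback squares of products, so the fibre product S^r X ×_{S^r 1}
S^r Y is S^r(X × Y). Hence the monad of `TSym` is isomorphic to X ↦ S^r(X × S^r 1)
(`writerMonadHom_isIso`), and the bar construction may be computed with that monad (`barHom_isIso`).
An n-simplex becomes an n-fold nested sequence: a planar forest with levels n (the outermost), n-1,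
..., 0, in which every node below level n carries a label, an object of S^r 1, that is, a positive
number.

Let N_i be the number of nodes on level i, and let K_ij(a) be the product of the labels on the path
from a node a of level i up to its ancestor on level j, the latter excluded. The pyramid of the
forest has t_ij = {(a, e) : a < N_i, e < K_ij(a)}. The number e is read in mixed radix with the
labels as bases, the label of a belonging to the lowest digit. Dropping the top digit is the map
t_ij → t_i,j-1; dropping the bottom digit and passing to the parent of a is t_ij → t_i+1,j. The
squares are pullbacks because a number is determined by two overlapping strings of its digits, which
may be prescribed freely as long as they agree on the overlap. The maps are surjective because
families are nonempty and labels are positive.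

A product of labels k, l in the monoid of `Sym` is the lexicographic concatenation of l copies of k,
so a morphism acts on the quotient and the remainder modulo k separately (`mulF_pv`). This makes
morphisms of forests compatible with dropping digits. Since vertices, edges and triangles determine
all the data and all the laws, a model in dimensions at most 2 (`PyrModel`) gives a strict map of
simplicial groupoids (`toPyramids`).

It is an equivalence in each degree by induction on n. In a pyramid of height n+1 one has t_i,n+1 =
t_in ×_{t_nn} t_n,n+1, so the pyramid amounts to its last face together with the surjections t_nn →
t_n+1,n+1 and t_n,n+1 → t_nn (`Pyramid.hom_ext`, `Pyramid.exists_iso`). A forest of height n+1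
amounts to its top face, a forest of height n, with a partition of the N_n outer nodes into nonempty
blocks and a label on each of them (`families_hom_ext`, `exists_flat_map`, `exists_families`). The
partition is the first surjection, and the labels are the sizes of the fibres of the second. The two
statements of the proposition differ only in the set `L` of admissible lengths. -/

namespace Plethysm
universe v u

/-! ### Transport of monads, and naturality of the bar construction in the monad -/

section Transport

variable {E : Type u} [Category.{v} E]

/-- A monad structure transported along a natural isomorphism. -/
def monadOfIso (M : Monad E) (T : E ⥤ E) (φ : T ≅ M.toFunctor) (η' : 𝟭 E ⟶ T) (μ' : T ⋙ T ⟶ T)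
    (hη : ∀ X, η'.app X ≫ φ.hom.app X = M.η.app X)
    (hμ : ∀ X, μ'.app X ≫ φ.hom.app X = T.map (φ.hom.app X) ≫ φ.hom.app _ ≫ M.μ.app X) :
    Monad E where
  toFunctor := T
  η := η'
  μ := μ'
  assoc X := by
    have n₁ := φ.hom.naturality (μ'.app X)
    have n₃ := φ.hom.naturality (φ.hom.app X)
    have n₄ := M.μ.naturality (φ.hom.app X)
    have n₅ := μ'.naturality (φ.hom.app X)
    have n₆ := φ.hom.naturality (M.μ.app X)
    have n₇ := congrArg (fun x => T.map x) (hμ X)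
    have n₈ := hμ (M.obj X)
    have n₉ := M.assoc X
    simp only [Functor.id_obj, Functor.comp_obj, Functor.comp_map, T.map_comp] at *
    -- The components of `φ` are invertible, so the law may be tested after composing with
    -- `φ.hom.app X`, which turns each `μ'` into the multiplication of `M`.
    rw [← cancel_mono (φ.hom.app X), Category.assoc, Category.assoc, hμ, reassoc_of% n₇,
      reassoc_of% n₆, n₉, ← reassoc_of% n₅, reassoc_of% n₈]
  left_unit X := by
    have n₁ := η'.naturality (φ.hom.app X)
    simp only [Functor.id_obj, Functor.id_map] at *
    rw [← cancel_mono (φ.hom.app X), Category.assoc, hμ, ← reassoc_of% n₁, reassoc_of% hη,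
      M.left_unit]
    simp
  right_unit X := by
    rw [← cancel_mono (φ.hom.app X), Category.assoc, hμ, ← T.map_comp_assoc, hη,
      φ.hom.naturality_assoc, M.right_unit]
    simp

def monadOfIsoHom (M : Monad E) (T : E ⥤ E) (φ : T ≅ M.toFunctor) (η' : 𝟭 E ⟶ T)
    (μ' : T ⋙ T ⟶ T) (hη : ∀ X, η'.app X ≫ φ.hom.app X = M.η.app X)
    (hμ : ∀ X, μ'.app X ≫ φ.hom.app X = T.map (φ.hom.app X) ≫ φ.hom.app _ ≫ M.μ.app X) :
    monadOfIso M T φ η' μ' hη hμ ⟶ M :=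
  { toNatTrans := φ.hom
    app_η := hη
    app_μ := fun X => (hμ X).trans (Category.assoc _ _ _).symm }

end Transport

section MonadHoms

variable {E : Type u} [Category.{v} E] {M M' R : Monad E} (ψ : M' ⟶ M) {X X' Z Z' : E} (s : X ⟶ Z)

/-- These lemmas are the inductive steps in comparing iterates of two monads. The map `s` stands for
the comparison of the inner copies, and `ψ.app X ≫ M.map s` is the comparison with one more copy. -/
theorem monadHom_η : M'.η.app X ≫ ψ.app X ≫ M.map s = s ≫ M.η.app Z := by
  rw [← Category.assoc, ψ.app_η]
  exact (M.η.naturality s).symm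

theorem monadHom_map {a : X ⟶ X'} {b : Z ⟶ Z'} {s' : X' ⟶ Z'} (h : a ≫ s' = s ≫ b) :
    M'.map a ≫ ψ.app X' ≫ M.map s' = (ψ.app X ≫ M.map s) ≫ M.map b := by
  have h₁ : M'.map a ≫ ψ.app _ = ψ.app _ ≫ M.map a := ψ.naturality a
  rw [reassoc_of% h₁, Category.assoc, ← M.map_comp, ← M.map_comp, h]

theorem monadHom_μ : M'.μ.app X ≫ ψ.app X ≫ M.map s =
    (ψ.app (M'.obj X) ≫ M.map (ψ.app X ≫ M.map s)) ≫ M.μ.app Z := by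
  have h := ψ.app_μ X
  have h₂ : M'.map (ψ.app X) ≫ ψ.app _ = ψ.app _ ≫ M.map (ψ.app X) := ψ.naturality _
  rw [← Category.assoc, h, h₂, M.map_comp]
  simp only [Category.assoc]
  rw [M.mu_naturality]

theorem monadHom_top (χ : M ⟶ R) : (R.map ((ψ ≫ χ).app X) ≫ R.μ.app X) ≫ R.map s =
    R.map (ψ.app X ≫ M.map s) ≫ R.map (χ.app Z) ≫ R.μ.app Z := by
  have h : M.map s ≫ χ.app Z = χ.app X ≫ R.map s := χ.naturality _
  have h₁ : (ψ ≫ χ).app X = ψ.app X ≫ χ.app X := rfl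
  rw [h₁, Category.assoc, ← R.mu_naturality]
  simp only [← R.map_comp_assoc, Category.assoc, h]

end MonadHoms

section BarIso

variable {E : Type u} [Category.{v} E] [CartesianMonoidalCategory E] {M M' R : Monad E}
  (ψ : M' ⟶ M)

/-- The map of iterates induced by a map of monads. -/
def iterHom : (n : ℕ) → (iter M' n ⟶ iter M n)
  | 0 => 𝟙 _
  | n + 1 => ψ.app (iter M' n) ≫ M.map (iterHom n)

theorem iterHom_succ (n : ℕ) : iterHom ψ (n + 1) = ψ.app (iter M' n) ≫ M.map (iterHom ψ n) := rfl

theorem iterHom_η (n : ℕ) : iterη M' n ≫ iterHom ψ (n + 1) = iterHom ψ n ≫ iterη M n :=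
  monadHom_η ψ (iterHom ψ n)

theorem iterHom_map {n m : ℕ} {a : iter M' n ⟶ iter M' m} {b : iter M n ⟶ iter M m}
    (h : a ≫ iterHom ψ m = iterHom ψ n ≫ b) :
    iterMap M' a ≫ iterHom ψ (m + 1) = iterHom ψ (n + 1) ≫ iterMap M b :=
  monadHom_map ψ (iterHom ψ n) h

theorem iterHom_μ (n : ℕ) :
    iterμ M' n ≫ iterHom ψ (n + 1) = iterHom ψ (n + 2) ≫ iterμ M n :=
  monadHom_μ ψ (iterHom ψ n)

/-- The map `act` is built by recursion from units, multiplications and functor application, all of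
which commute with `iterHom`. For target index 0 both sides are maps to the terminal object. -/
theorem iterHom_act : ∀ (n m : ℕ) (f : ℕ → ℕ),
    act M' n m f ≫ iterHom ψ m = iterHom ψ n ≫ act M n m f
  | n, 0, f => iter_zero_hom M _ _
  | 0, m + 1, f => by
    rw [act, act, Category.assoc, iterHom_η, reassoc_of% iterHom_act 0 m f]
  | n + 1, m + 1, f => by
    rw [act, act]
    split_ifs
    · rw [Category.assoc, iterHom_η, reassoc_of% iterHom_act (n + 1) m f]
    · rw [Category.assoc, iterHom_μ, reassoc_of% (iterHom_map ψ (iterHom_act n (m + 1) f))]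

theorem iterHom_top (χ : M ⟶ R) (n : ℕ) :
    top (ψ ≫ χ) n ≫ R.map (iterHom ψ n) = R.map (iterHom ψ (n + 1)) ≫ top χ n :=
  monadHom_top ψ (iterHom ψ n) χ

theorem iterHom_isIso (h : ∀ X, IsIso (ψ.app X)) : ∀ n, IsIso (iterHom ψ n)
  | 0 => inferInstanceAs (IsIso (𝟙 _))
  | n + 1 => by
    have h₁ := h (iter M' n)
    have h₂ := iterHom_isIso h n
    rw [iterHom_succ]
    have h₃ : IsIso (M.map (iterHom ψ n)) := Functor.map_isIso M.toFunctor _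
    exact IsIso.comp_isIso' h₁ h₃

/-- Naturality of the bar construction in the monad. -/
def barHom (χ : M ⟶ R) : bar (ψ ≫ χ) ⟶ bar χ where
  app n := R.map (iterHom ψ n.unop.len)
  naturality n m θ := by
    change barMap (ψ ≫ χ) _ _ _ ≫ R.map _ = R.map _ ≫ barMap χ _ _ _
    rw [barMap, barMap, Category.assoc, iterHom_top, ← R.map_comp_assoc, iterHom_act, R.map_comp,
      Category.assoc]

theorem barHom_isIso (h : ∀ X, IsIso (ψ.app X)) (χ : M ⟶ R) : IsIso (barHom ψ χ) := by
  have : ∀ n, IsIso ((barHom ψ χ).app n) := fun n => by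
    have := iterHom_isIso ψ h n.unop.len
    exact Functor.map_isIso R.toFunctor (iterHom ψ n.unop.len)
  exact NatIso.isIso_of_isIso_app _

end BarIso

/-! ### The monad of the operad of a monoid Y as X ↦ P(X × Y) -/

section Writer

open MonObj

variable {E : Type u} [Category.{v} E] [CartesianMonoidalCategory E] [ChosenPullbacks E]
  (P : StrongMonad E) (Y : Mon E)

/-- The functor `X ↦ P (X ⊗ Y)`. -/
def writerFunctor : E ⥤ E where
  obj X := P.obj (X ⊗ Y.X)
  map f := P.map (f ▷ Y.X)
  map_id X := by rw [id_whiskerRight, P.map_id]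
  map_comp f g := by rw [comp_whiskerRight, P.map_comp]

def writerη (X : E) : X ⟶ P.obj (X ⊗ Y.X) := lift (𝟙 X) (toUnit X ≫ η[Y.X]) ≫ P.η.app _

/-- The map `P (X ⊗ Y) ⊗ Y ⟶ P (X ⊗ Y)` which multiplies every member of a family on the right. -/
noncomputable def writerAct (X : E) : P.obj (X ⊗ Y.X) ⊗ Y.X ⟶ P.obj (X ⊗ Y.X) :=
  P.rstr _ _ ≫ P.map ((α_ X Y.X Y.X).hom ≫ X ◁ μ[Y.X])

noncomputable def writerμ (X : E) : P.obj (P.obj (X ⊗ Y.X) ⊗ Y.X) ⟶ P.obj (X ⊗ Y.X) :=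
  P.map (writerAct P Y X) ≫ P.μ.app _

/-- Maps into the fibre product are tested on its two projections. This lemma and the next compute
them for the action: the X-parts stay, and the Y-parts undergo `rightMul`. -/
theorem writerAct_fst (X : E) : writerAct P Y X ≫ P.map (fst X Y.X) =
    fst _ _ ≫ P.map (fst X Y.X) := by
  rw [writerAct, Category.assoc, ← P.map_comp, Category.assoc, whiskerLeft_fst,
    associator_hom_fst, P.map_comp, P.rstr_fst_assoc]

theorem writerAct_snd (X : E) : writerAct P Y X ≫ P.map (snd X Y.X) =
    P.map (snd X Y.X) ▷ Y.X ≫ rightMul P Y := by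
  have h₁ : (α_ X Y.X Y.X).hom ≫ X ◁ μ[Y.X] ≫ snd _ _ = snd _ _ ▷ _ ≫ μ[Y.X] := by
    rw [whiskerLeft_snd, ← Category.assoc]
    congr 1
    ext <;> simp
  have h₂ := P.rstr_map_left (fst _ _) (snd (P.obj (X ⊗ Y.X)) Y.X) (snd _ _)
  have h₃ : lift (fst _ _ ≫ P.map (snd X Y.X)) (snd (P.obj (X ⊗ Y.X)) Y.X) =
      P.map (snd _ _) ▷ _ := by ext <;> simp
  rw [h₃, lift_fst_snd, Category.id_comp] at h₂
  rw [writerAct, Category.assoc, ← P.map_comp, Category.assoc, h₁, P.map_comp, ← reassoc_of% h₂]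
  rfl

/-- The comparison of `P (X ⊗ Y)` with the fibre product `P X ×_{P 𝟙} P Y`. -/
noncomputable def writerHom (X : E) : P.obj (X ⊗ Y.X) ⟶ (tCollection P Y).ext X :=
  (tCollection P Y).extLift (P.map (fst _ _)) (P.map (snd _ _)) (by
    rw [← P.map_comp, ← P.map_comp, toUnit_unique (fst X Y.X ≫ toUnit X)])

theorem writerHom_labels (X : E) : writerHom P Y X ≫ (tCollection P Y).labels X = P.map (fst _ _) :=
  (tCollection P Y).extLift_labels _ _ _

theorem writerHom_op (X : E) : writerHom P Y X ≫ tOp P Y X = P.map (snd _ _) :=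
  (tCollection P Y).extLift_op _ _ _

theorem writerHom_natural {X X' : E} (f : X ⟶ X') :
    P.map (f ▷ Y.X) ≫ writerHom P Y X' = writerHom P Y X ≫ (tCollection P Y).extMap f := by
  refine (tCollection P Y).ext_hom ?_ ?_
  · rw [Category.assoc, writerHom_labels, Category.assoc, (tCollection P Y).extMap_labels,
      reassoc_of% (writerHom_labels P Y X), ← P.map_comp, ← P.map_comp, whiskerRight_fst]
  · refine (Category.assoc _ _ _).trans ((congrArg _ (writerHom_op P Y X')).trans ?_)
    rw [Category.assoc, (tCollection P Y).extMap_op, ← P.map_comp, whiskerRight_snd]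
    exact (writerHom_op P Y X).symm

variable [PreservesProductSquares P.toMonad]

/-- By preservation of product squares, `P.obj (X ⊗ Y.X)` is itself a pullback of the cospan that
defines `ext X`. The inverse is its gap map `pairing`. -/
theorem writerHom_isIso (X : E) : IsIso (writerHom P Y X) := by
  refine ⟨pairing ((tCollection P Y).labels X) (tOp P Y X) (tExt_condition P Y X), ?_, ?_⟩
  · refine (PreservesProductSquares.isPullback (P := P.toMonad) X Y.X).hom_ext ?_ ?_
    · rw [Category.assoc, pairing_fst, writerHom_labels, Category.id_comp]
    · rw [Category.assoc, pairing_snd, writerHom_op, Category.id_comp]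
  · refine (tCollection P Y).ext_hom ?_ ?_
    · rw [Category.assoc, writerHom_labels, pairing_fst, Category.id_comp]
    · refine (Category.assoc _ _ _).trans ((congrArg _ (writerHom_op P Y X)).trans ?_)
      rw [pairing_snd, Category.id_comp]
      rfl

/-- The unit of the monad of the operad of a monoid. -/
noncomputable def tη (X : E) : X ⟶ (tCollection P Y).ext X := (tPreOperad P Y).extη X

/-- The multiplication of the monad of the operad of a monoid. -/
noncomputable def tμ (X : E) : (tCollection P Y).ext ((tCollection P Y).ext X) ⟶
    (tCollection P Y).ext X := (tPreOperad P Y).extμ X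

theorem tη_labels (X : E) : tη P Y X ≫ (tCollection P Y).labels X = P.η.app X :=
  (tPreOperad P Y).extη_labels X

theorem tη_op (X : E) : tη P Y X ≫ tOp P Y X = toUnit X ≫ η[Y.X] ≫ P.η.app Y.X :=
  (tPreOperad P Y).extη_op X

theorem tμ_labels (X : E) : tμ P Y X ≫ (tCollection P Y).labels X =
    (tCollection P Y).labels _ ≫ P.map ((tCollection P Y).labels X) ≫ P.μ.app X :=
  (tPreOperad P Y).extμ_labels X

theorem tμ_op (X : E) : tμ P Y X ≫ tOp P Y X =
    tExtMap P Y (tOp P Y X) ≫ tPair P Y ≫ P.map (rightMul P Y) ≫ P.μ.app Y.X :=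
  (tPreOperad P Y).extμ_op X

theorem tμ_natural {X X' : E} (f : X ⟶ X') :
    (tCollection P Y).extMap ((tCollection P Y).extMap f) ≫ tμ P Y X' =
      tμ P Y X ≫ (tCollection P Y).extMap f := (tPreOperad P Y).extμ_natural f

theorem writerη_hom (X : E) : writerη P Y X ≫ writerHom P Y X = tη P Y X := by
  refine (tCollection P Y).ext_hom ?_ ?_
  · rw [tη_labels, Category.assoc, writerHom_labels, writerη, Category.assoc,
      ← P.unit_naturality, lift_fst_assoc, Category.id_comp]
  · refine (Category.assoc _ _ _).trans ((congrArg _ (writerHom_op P Y X)).trans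
      (Eq.trans ?_ (tη_op P Y X).symm))
    rw [writerη, Category.assoc, ← P.unit_naturality, lift_snd_assoc, Category.assoc]

theorem writerμ_hom (X : E) : writerμ P Y X ≫ writerHom P Y X =
    P.map (writerHom P Y X ▷ Y.X) ≫ writerHom P Y _ ≫ tμ P Y X := by
  refine (tCollection P Y).ext_hom ?_ ?_
  · rw [Category.assoc, writerHom_labels, Category.assoc, Category.assoc, tμ_labels, writerμ,
      reassoc_of% (writerHom_labels P Y ((tCollection P Y).ext X)), Category.assoc,
      ← P.mu_naturality, ← P.map_comp_assoc, writerAct_fst, ← P.map_comp_assoc, ← P.map_comp_assoc,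
      whiskerRight_fst, Category.assoc, writerHom_labels]
  -- The pairing formed by `tPair` undoes the splitting made by `writerHom`, so only the map on the
  -- first components of the pairs remains.
  · have h₁ : writerHom P Y ((tCollection P Y).ext X) ≫ tExtMap P Y (tOp P Y X) ≫ tPair P Y =
        P.map (tOp P Y X ▷ Y.X) := by
      rw [← Category.assoc]
      refine eq_tPair P Y _ _ ?_ ?_
      · rw [← P.map_comp, whiskerRight_fst, P.map_comp, ← writerHom_labels, Category.assoc,
          Category.assoc]
        exact congrArg _ ((tCollection P Y).extMap_labels _).symm
      · rw [← P.map_comp, whiskerRight_snd, ← writerHom_op, Category.assoc]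
        exact congrArg _ ((tCollection P Y).extMap_op _).symm
    have h₂ : writerμ P Y X ≫ writerHom P Y X ≫ tOp P Y X =
        P.map (writerHom P Y X ▷ Y.X) ≫ writerHom P Y _ ≫ tμ P Y X ≫ tOp P Y X := by
      rw [writerHom_op, tμ_op, reassoc_of% h₁, writerμ, Category.assoc, ← P.mu_naturality,
        ← P.map_comp_assoc, writerAct_snd, ← P.map_comp_assoc, ← comp_whiskerRight, writerHom_op,
        P.map_comp_assoc]
    exact (Category.assoc _ _ _).trans (h₂.trans ((congrArg _ (Category.assoc _ _ _).symm).trans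
      (Category.assoc _ _ _).symm))

noncomputable def writerIso : writerFunctor P Y ≅ (tOperad P Y).monad.toFunctor :=
  NatIso.ofComponents (fun X => @asIso _ _ _ _ (writerHom P Y X) (writerHom_isIso P Y X))
    fun f => writerHom_natural P Y f

/-- Naturality is inherited from the multiplication of the operad's monad, by cancelling the
isomorphism `writerHom`. -/
theorem writerμ_natural {X X' : E} (f : X ⟶ X') :
    P.map (P.map (f ▷ Y.X) ▷ Y.X) ≫ writerμ P Y X' = writerμ P Y X ≫ P.map (f ▷ Y.X) := by
  have h := writerHom_isIso P Y
  have n := tμ_natural P Y f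
  have h₁ := writerHom_natural P Y f
  have h₂ := writerHom_natural P Y ((tCollection P Y).extMap f)
  have h₃ := congrArg (fun x => P.map (x ▷ Y.X)) h₁
  simp only [comp_whiskerRight, P.map_comp] at h₃
  rw [← cancel_mono (writerHom P Y X'), Category.assoc, writerμ_hom, reassoc_of% h₃,
    reassoc_of% h₂, Category.assoc, h₁, reassoc_of% (writerμ_hom P Y X), n]

/-- The monad `X ↦ P (X ⊗ Y)`. -/
noncomputable def writerMonad : Monad E :=
  monadOfIso (tOperad P Y).monad (writerFunctor P Y) (writerIso P Y)
    { app := fun X => writerη P Y X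
      naturality := fun X X' f => by
        change f ≫ writerη P Y X' = writerη P Y X ≫ P.map (f ▷ Y.X)
        rw [writerη, writerη, Category.assoc, ← P.unit_naturality, comp_lift_assoc,
          ← Category.assoc (lift _ _) (f ▷ Y.X)]
        congr 1
        ext <;> simp }
    { app := fun X => writerμ P Y X
      naturality := fun _ _ f => writerμ_natural P Y f }
    (fun X => writerη_hom P Y X) (fun X => writerμ_hom P Y X)

/-- The monad of the operad of a monoid `Y` is `X ↦ P (X ⊗ Y)`. -/
noncomputable def writerMonadHom : writerMonad P Y ⟶ (tOperad P Y).monad :=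
  monadOfIsoHom _ _ _ _ _ _ _

theorem writerMonadHom_isIso (X : E) : IsIso ((writerMonadHom P Y).app X) :=
  writerHom_isIso P Y X

end Writer

end Plethysm

namespace Plethysm
universe v u

/-! ### Pyramids from numerical data, by mixed-radix arithmetic -/

section Codes

/-- Numerical data describing a pyramid of height `n`: the set at position `(i, j)` consists of the
pairs `(a, e)` with `a < N i` and `e < K (i, j) a`. -/
@[ext]
structure PyrCode (L : ℕ → Prop) (n : ℕ) where
  N : Fin (n + 1) → ℕ
  anc : Pyr n → ℕ → ℕ
  K : Pyr n → ℕ → ℕ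
  mem : ∀ i, L (N i)
  anc_lt : ∀ (s : Pyr n) {a : ℕ}, a < N s.i → anc s a < N s.j
  anc_surj : ∀ (s : Pyr n) {b : ℕ}, b < N s.j → ∃ a < N s.i, anc s a = b
  K_pos : ∀ (s : Pyr n) {a : ℕ}, a < N s.i → 0 < K s a
  anc_comp : ∀ {i k j : Fin (n + 1)} (h : i ≤ k) (h' : k ≤ j) {a : ℕ}, a < N i →
    anc ⟨i, j, h.trans h'⟩ a = anc ⟨k, j, h'⟩ (anc ⟨i, k, h⟩ a)
  K_mul : ∀ {i k j : Fin (n + 1)} (h : i ≤ k) (h' : k ≤ j) {a : ℕ}, a < N i →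
    K ⟨i, j, h.trans h'⟩ a = K ⟨i, k, h⟩ a * K ⟨k, j, h'⟩ (anc ⟨i, k, h⟩ a)

namespace PyrCode

variable {L : ℕ → Prop} {n : ℕ} (c : PyrCode L n)

/-- The law `anc_comp` with three equal indices makes this map idempotent, and an idempotent
surjection is the identity. Likewise `K_mul` gives K = K · K on the diagonal, so a positive K is 1.
-/
theorem anc_self (i : Fin (n + 1)) {a : ℕ} (ha : a < c.N i) : c.anc ⟨i, i, le_rfl⟩ a = a := by
  obtain ⟨b, hb, rfl⟩ := c.anc_surj ⟨i, i, le_rfl⟩ ha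
  exact (c.anc_comp le_rfl le_rfl hb).symm

theorem K_self (i : Fin (n + 1)) {a : ℕ} (ha : a < c.N i) : c.K ⟨i, i, le_rfl⟩ a = 1 := by
  have h := c.K_mul le_rfl le_rfl ha
  rw [c.anc_self i ha] at h
  have := c.K_pos ⟨i, i, le_rfl⟩ ha
  exact Nat.eq_of_mul_eq_mul_left this (by rw [← h, mul_one])

/-- The pairs at a position. -/
def carrier (s : Pyr n) : Set (ℕ × ℕ) := {v | v.1 < c.N s.i ∧ v.2 < c.K s v.1}

/-- The map between the sets at two comparable positions. -/
def step (s t : Pyr n) (h : s ≤ t) (v : ℕ × ℕ) : ℕ × ℕ :=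
  -- Division drops the digits below level `t.i`, and the remainder keeps those below level `t.j`.
  -- If `t` is diagonal the modulus is 1 and the result is 0, so one formula also covers the
  -- horizontal maps, where the quotient carries no meaning.
  (c.anc ⟨s.i, t.i, h.1⟩ v.1,
    v.2 / c.K ⟨s.i, t.i, h.1⟩ v.1 % c.K t (c.anc ⟨s.i, t.i, h.1⟩ v.1))

theorem step_mem {s t : Pyr n} (h : s ≤ t) {v : ℕ × ℕ} (hv : v ∈ c.carrier s) :
    c.step s t h v ∈ c.carrier t :=
  have h₁ := c.anc_lt ⟨s.i, t.i, h.1⟩ hv.1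
  ⟨h₁, Nat.mod_lt _ (c.K_pos t h₁)⟩

theorem step_self (s : Pyr n) {v : ℕ × ℕ} (hv : v ∈ c.carrier s) : c.step s s le_rfl v = v := by
  have h₁ := c.anc_self s.i hv.1
  refine Prod.ext h₁ ?_
  simp only [step, h₁, c.K_self s.i hv.1, Nat.div_one]
  exact Nat.mod_eq_of_lt hv.2

theorem step_step {s t r : Pyr n} (h : s ≤ t) (h' : t ≤ r) {v : ℕ × ℕ} (hv : v ∈ c.carrier s) :
    c.step t r h' (c.step s t h v) = c.step s r (h.trans h') v := by
  have h₁ := c.anc_comp h.1 h'.1 hv.1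
  have hb := c.anc_lt ⟨s.i, t.i, h.1⟩ hv.1
  have hd := c.anc_lt ⟨t.i, r.i, h'.1⟩ hb
  refine Prod.ext h₁.symm ?_
  simp only [step, h₁]
  rcases h'.2 with h₂ | h₂
  · obtain ⟨i, j, hij⟩ := t
    obtain ⟨k, l, hkl⟩ := r
    dsimp only at *
    -- Successive divisions amount to division by the product. The intermediate remainder only loses
    -- digits from level `t.j` upwards, which do not matter for `r` because `r.j ≤ t.j`.
    rw [c.K_mul h.1 h'.1 hv.1, ← Nat.div_div_eq_div_mul, c.K_mul h'.1 (hkl.trans h₂) hb,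
      Nat.mod_mul_right_div_self, c.K_mul hkl h₂ hd,
      Nat.mod_mod_of_dvd _ (Nat.dvd_mul_right _ _)]
  -- Over a diagonal target both sides are remainders modulo 1.
  · have h₃ : c.K r (c.anc ⟨t.i, r.i, h'.1⟩ (c.anc ⟨s.i, t.i, h.1⟩ v.1)) = 1 := by
      obtain ⟨k, l, hkl⟩ := r
      dsimp only at h₂
      subst h₂
      exact c.K_self _ hd
    rw [h₃, Nat.mod_one, Nat.mod_one]

theorem step_surj {s t : Pyr n} (h : s ≤ t) {w : ℕ × ℕ} (hw : w ∈ c.carrier t) :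
    ∃ v ∈ c.carrier s, c.step s t h v = w := by
  obtain ⟨a, ha, e⟩ := c.anc_surj ⟨s.i, t.i, h.1⟩ hw.1
  have hp := c.K_pos ⟨s.i, t.i, h.1⟩ ha
  obtain ⟨w₁, w₂⟩ := w
  dsimp only at e ha
  subst e
  rcases h.2 with h₂ | h₂
  -- The factor shifts the digits of `w₂` above those of the levels below `t.i`, which are set to
  -- zero, as are the digits from level `t.j` upwards.
  · refine ⟨(a, w₂ * c.K ⟨s.i, t.i, h.1⟩ a), ⟨ha, ?_⟩, ?_⟩
    · have h₃ := c.K_mul h.1 (t.le.trans h₂) ha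
      have h₄ := c.K_mul t.le h₂ hw.1
      have h₅ := c.K_pos ⟨t.j, s.j, h₂⟩ (c.anc_lt t hw.1)
      have h₆ := hw.2
      change _ < c.K ⟨s.i, s.j, _⟩ a
      rw [h₃, mul_comm, h₄]
      refine (Nat.mul_lt_mul_left hp).2 (h₆.trans_le (Nat.le_mul_of_pos_right _ h₅))
    · refine Prod.ext rfl ?_
      simp only [step]
      rw [Nat.mul_div_cancel _ hp]
      exact Nat.mod_eq_of_lt hw.2
  · refine ⟨(a, 0), ⟨ha, c.K_pos s ha⟩, Prod.ext rfl ?_⟩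
    have h₃ := hw.2
    obtain ⟨k, l, hkl⟩ := t
    dsimp only at h₂
    subst h₂
    rw [c.K_self _ hw.1] at h₃
    simp only [step, Nat.zero_div, Nat.zero_mod]
    omega

/-- The image at (i, l) determines the node and the number modulo K_il, hence modulo its divisor
K_ik. The image at (k, j) determines the quotient by K_ik. Quotient and remainder determine the
number. -/
theorem step_injective {i k l j : Fin (n + 1)} (hik : i ≤ k) (hkl : k ≤ l) (hlj : l ≤ j)
    {v w : ℕ × ℕ} (hv : v ∈ c.carrier ⟨i, j, hik.trans (hkl.trans hlj)⟩)
    (hw : w ∈ c.carrier ⟨i, j, hik.trans (hkl.trans hlj)⟩)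
    (h₁ : c.step ⟨i, j, hik.trans (hkl.trans hlj)⟩ ⟨i, l, hik.trans hkl⟩ ⟨le_rfl, Or.inl hlj⟩ v =
      c.step ⟨i, j, hik.trans (hkl.trans hlj)⟩ ⟨i, l, hik.trans hkl⟩ ⟨le_rfl, Or.inl hlj⟩ w)
    (h₂ : c.step ⟨i, j, hik.trans (hkl.trans hlj)⟩ ⟨k, j, hkl.trans hlj⟩ ⟨hik, Or.inl le_rfl⟩ v =
      c.step ⟨i, j, hik.trans (hkl.trans hlj)⟩ ⟨k, j, hkl.trans hlj⟩ ⟨hik, Or.inl le_rfl⟩ w) :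
    v = w := by
  obtain ⟨a, e⟩ := v
  obtain ⟨b, f⟩ := w
  have ha : a < c.N i := hv.1
  have hb : b < c.N i := hw.1
  simp only [step, Prod.mk.injEq, c.anc_self i ha, c.anc_self i hb, c.K_self i ha, c.K_self i hb,
    Nat.div_one] at h₁ h₂
  obtain ⟨rfl, h₁⟩ := h₁
  have h₃ : e < _ := hv.2
  have h₄ : f < _ := hw.2
  have hm := c.K_mul hik (hkl.trans hlj) ha
  simp only [hm] at h₃ h₄
  have h₅ := h₂.2
  rw [Nat.mod_eq_of_lt (Nat.div_lt_of_lt_mul h₃), Nat.mod_eq_of_lt (Nat.div_lt_of_lt_mul h₄)] at h₅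
  have h₆ : e % c.K ⟨i, k, hik⟩ a = f % c.K ⟨i, k, hik⟩ a := by
    have := congrArg (· % c.K ⟨i, k, hik⟩ a) h₁
    simpa only [c.K_mul hik hkl ha, Nat.mod_mod_of_dvd _ (Nat.dvd_mul_right _ _)] using this
  rw [← Nat.div_add_mod e (c.K ⟨i, k, hik⟩ a), h₅, h₆, Nat.div_add_mod]

/-- The glued number takes its digits below level k from `e` and all further digits from `f`. The
hypothesis says that the digits of `e` from level k upwards are the low digits of `f`, so that
reduction modulo K_il gives `e` back. -/
theorem step_glue {i k l j : Fin (n + 1)} (hik : i ≤ k) (hkl : k ≤ l) (hlj : l ≤ j)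
    {v w : ℕ × ℕ} (hv : v ∈ c.carrier ⟨i, l, hik.trans hkl⟩)
    (hw : w ∈ c.carrier ⟨k, j, hkl.trans hlj⟩)
    (h : c.step ⟨i, l, hik.trans hkl⟩ ⟨k, l, hkl⟩ ⟨hik, Or.inl le_rfl⟩ v =
      c.step ⟨k, j, hkl.trans hlj⟩ ⟨k, l, hkl⟩ ⟨le_rfl, Or.inl hlj⟩ w) :
    ∃ x ∈ c.carrier ⟨i, j, hik.trans (hkl.trans hlj)⟩,
      c.step ⟨i, j, hik.trans (hkl.trans hlj)⟩ ⟨i, l, hik.trans hkl⟩ ⟨le_rfl, Or.inl hlj⟩ x = v ∧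
      c.step ⟨i, j, hik.trans (hkl.trans hlj)⟩ ⟨k, j, hkl.trans hlj⟩ ⟨hik, Or.inl le_rfl⟩ x = w := by
  obtain ⟨a, e⟩ := v
  obtain ⟨b, f⟩ := w
  have ha : a < c.N i := hv.1
  have hb : b < c.N k := hw.1
  simp only [step, Prod.mk.injEq, c.anc_self k hb, c.K_self k hb, Nat.div_one] at h
  obtain ⟨rfl, h⟩ := h
  have he : e < _ := hv.2
  have hf : f < _ := hw.2
  have hp := c.K_pos ⟨i, k, hik⟩ ha
  dsimp only at he hf
  have hd : (f * c.K ⟨i, k, hik⟩ a + e % c.K ⟨i, k, hik⟩ a) / c.K ⟨i, k, hik⟩ a = f := by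
    rw [mul_comm, Nat.mul_add_div hp, Nat.div_eq_of_lt (Nat.mod_lt _ hp), add_zero]
  have hl : (f * c.K ⟨i, k, hik⟩ a + e % c.K ⟨i, k, hik⟩ a) % c.K ⟨i, l, hik.trans hkl⟩ a = e := by
    rw [c.K_mul hik hkl ha] at he ⊢
    rw [Nat.mod_mul, hd, ← h, Nat.mod_eq_of_lt (Nat.div_lt_of_lt_mul he), mul_comm f,
      Nat.mul_add_mod, Nat.mod_mod, Nat.mod_add_div]
  refine ⟨(a, f * c.K ⟨i, k, hik⟩ a + e % c.K ⟨i, k, hik⟩ a), ⟨ha, ?_⟩, ?_, ?_⟩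
  · change _ < c.K ⟨i, j, _⟩ a
    rw [c.K_mul hik (hkl.trans hlj) ha, mul_comm]
    calc _ < c.K ⟨i, k, hik⟩ a * f + c.K ⟨i, k, hik⟩ a := Nat.add_lt_add_left (Nat.mod_lt _ hp) _
      _ = c.K ⟨i, k, hik⟩ a * (f + 1) := rfl
      _ ≤ _ := Nat.mul_le_mul_left _ hf
  · simp only [step, c.anc_self i ha, c.K_self i ha, Nat.div_one, hl]
  · simp only [step, hd, Nat.mod_eq_of_lt hf]

/-- The diagram of sets described by a code. -/
def diagram : Pyr n ⥤ Type where
  obj s := c.carrier s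
  map {s t} f := TypeCat.ofHom fun v => ⟨c.step s t (leOfHom f) v.1, c.step_mem _ v.2⟩
  map_id s := ConcreteCategory.hom_ext _ _ fun v => Subtype.ext (c.step_self s v.2)
  map_comp f g := ConcreteCategory.hom_ext _ _ fun v =>
    Subtype.ext (c.step_step (leOfHom f) (leOfHom g) v.2).symm

instance finite_carrier (s : Pyr n) : Finite (c.carrier s) := by
  have : c.carrier s ⊆ ⋃ a ∈ Finset.range (c.N s.i), (fun e => (a, e)) '' Set.Iio (c.K s a) := by
    rintro ⟨a, e⟩ ⟨h₁, h₂⟩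
    simp only [Set.mem_iUnion, Finset.mem_range]
    exact ⟨a, h₁, e, h₂, rfl⟩
  refine Set.Finite.subset ?_ this
  exact Set.Finite.biUnion (Finset.finite_toSet _) fun a _ => (Set.finite_Iio _).image _

/-- All positive numbers satisfy `L`. The set is empty only if there are no nodes, and then 0 is the
admissible number `c.N s.i`. -/
theorem card_carrier (hL : ∀ m, 0 < m → L m) (s : Pyr n) : L (Nat.card (c.carrier s)) := by
  rcases Nat.eq_zero_or_pos (Nat.card (c.carrier s)) with h | h
  · rw [h]
    have h₁ : IsEmpty (c.carrier s) := (Finite.card_eq_zero_iff).1 h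
    have h₂ : c.N s.i = 0 := by
      by_contra h₃
      have h₄ := Nat.pos_of_ne_zero h₃
      exact h₁.false ⟨(0, 0), h₄, c.K_pos s h₄⟩
    rw [← h₂]
    exact c.mem _
  · exact hL _ h

variable {C : Type → Prop} (hL : ∀ m, 0 < m → L m) (hC : ∀ T, C T ↔ Finite T ∧ L (Nat.card T))

/-- The pyramid described by a code. -/
def pyramid : Pyramid C n where
  diagram := c.diagram
  mem s := (hC _).2 ⟨c.finite_carrier s, c.card_carrier hL s⟩
  surjective f w := by
    obtain ⟨v, hv, h⟩ := c.step_surj (leOfHom f) w.2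
    exact ⟨⟨v, hv⟩, Subtype.ext h⟩
  isPullback {i k l j} hik hkl hlj := by
    rw [Types.isPullback_iff]
    refine ⟨?_, ?_, ?_⟩
    · rw [← Functor.map_comp, ← Functor.map_comp]
      rfl
    · rintro v w ⟨h₁, h₂⟩
      exact Subtype.ext (c.step_injective hik hkl hlj v.2 w.2 (congrArg Subtype.val h₁)
        (congrArg Subtype.val h₂))
    · intro v w h
      obtain ⟨x, hx, h₁, h₂⟩ := c.step_glue hik hkl hlj v.2 w.2 (congrArg Subtype.val h)
      exact ⟨⟨x, hx⟩, Subtype.ext h₁, Subtype.ext h₂⟩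

/-- Restriction of a code along a monotone map. -/
def restrict {m : ℕ} (θ : Fin (m + 1) →o Fin (n + 1)) : PyrCode L m where
  N i := c.N (θ i)
  anc s := c.anc ((pyrMap θ).obj s)
  K s := c.K ((pyrMap θ).obj s)
  mem _ := c.mem _
  anc_lt s _ := c.anc_lt ((pyrMap θ).obj s)
  anc_surj s _ := c.anc_surj ((pyrMap θ).obj s)
  K_pos s _ := c.K_pos ((pyrMap θ).obj s)
  anc_comp h h' _ := c.anc_comp (θ.monotone h) (θ.monotone h')
  K_mul h h' _ := c.K_mul (θ.monotone h) (θ.monotone h')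

/-- Numerical data describing a map between the pyramids of two codes. -/
structure Hom (c d : PyrCode L n) where
  p : Fin (n + 1) → ℕ → ℕ
  q : Pyr n → ℕ → ℕ → ℕ
  p_lt : ∀ i {a : ℕ}, a < c.N i → p i a < d.N i
  q_lt : ∀ (s : Pyr n) {a e : ℕ}, a < c.N s.i → e < c.K s a → q s a e < d.K s (p s.i a)
  anc_p : ∀ (s : Pyr n) {a : ℕ}, a < c.N s.i → d.anc s (p s.i a) = p s.j (c.anc s a)
  q_mul : ∀ {i k j : Fin (n + 1)} (h : i ≤ k) (h' : k ≤ j) {a e : ℕ}, a < c.N i →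
    e < c.K ⟨i, j, h.trans h'⟩ a →
    q ⟨i, j, h.trans h'⟩ a e =
      q ⟨k, j, h'⟩ (c.anc ⟨i, k, h⟩ a) (e / c.K ⟨i, k, h⟩ a) * d.K ⟨i, k, h⟩ (p i a) +
      q ⟨i, k, h⟩ a (e % c.K ⟨i, k, h⟩ a)

namespace Hom

variable {c} {d : PyrCode L n} (f : Hom c d)

def app (s : Pyr n) (v : ℕ × ℕ) : ℕ × ℕ := (f.p s.i v.1, f.q s v.1 v.2)

theorem app_mem {s : Pyr n} {v : ℕ × ℕ} (hv : v ∈ c.carrier s) : f.app s v ∈ d.carrier s :=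
  ⟨f.p_lt _ hv.1, f.q_lt _ hv.1 hv.2⟩

/-- By `q_mul` the map acts on low and high digits separately, with the low part staying below its
base. It therefore commutes with taking quotients and remainders. -/
theorem app_step {s t : Pyr n} (h : s ≤ t) {v : ℕ × ℕ} (hv : v ∈ c.carrier s) :
    d.step s t h (f.app s v) = f.app t (c.step s t h v) := by
  obtain ⟨a, e⟩ := v
  have ha : a < c.N s.i := hv.1
  have he : e < c.K s a := hv.2
  have hb := c.anc_lt ⟨s.i, t.i, h.1⟩ ha
  have h₁ := f.anc_p ⟨s.i, t.i, h.1⟩ ha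
  have hpa := f.p_lt _ ha
  have hK := c.K_pos ⟨s.i, t.i, h.1⟩ ha
  have hK' := d.K_pos ⟨s.i, t.i, h.1⟩ hpa
  refine Prod.ext h₁ ?_
  simp only [step, app, h₁]
  rcases h.2 with h₂ | h₂
  · obtain ⟨i, j, hij⟩ := s
    obtain ⟨k, l, hkl⟩ := t
    dsimp only at *
    have he' := he
    rw [c.K_mul h.1 (hkl.trans h₂) ha] at he'
    have hdiv := Nat.div_lt_of_lt_mul he'
    have hb' := f.anc_p ⟨k, l, hkl⟩ hb
    rw [f.q_mul h.1 (hkl.trans h₂) ha he, mul_comm, Nat.mul_add_div hK',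
      Nat.div_eq_of_lt (f.q_lt ⟨i, k, h.1⟩ ha (Nat.mod_lt _ hK)), add_zero,
      f.q_mul hkl h₂ hb hdiv, mul_comm, Nat.mul_add_mod, Nat.mod_eq_of_lt]
    exact f.q_lt ⟨k, l, hkl⟩ hb (Nat.mod_lt _ (c.K_pos ⟨k, l, hkl⟩ hb))
  -- At a diagonal target all second coordinates are below 1, so both sides are 0.
  · obtain ⟨k, l, hkl⟩ := t
    dsimp only at h₂ hb ⊢
    subst h₂
    have h₃ := d.K_self k (f.p_lt k hb)
    have h₄ := f.q_lt ⟨k, k, le_rfl⟩ (e := e / c.K ⟨s.i, k, h.1⟩ a % c.K ⟨k, k, le_rfl⟩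
      (c.anc ⟨s.i, k, h.1⟩ a)) hb (Nat.mod_lt _ (c.K_pos ⟨k, k, le_rfl⟩ hb))
    dsimp only at h₄
    rw [h₃] at h₄ ⊢
    rw [Nat.mod_one]
    omega

/-- The map of diagrams described by a map of codes. -/
def natTrans : c.diagram ⟶ d.diagram where
  app s := TypeCat.ofHom fun v => ⟨f.app s v.1, f.app_mem v.2⟩
  naturality _ _ g := ConcreteCategory.hom_ext _ _ fun v =>
    Subtype.ext (f.app_step (leOfHom g) v.2).symm

end Hom

end PyrCode

end Codes

/-! ### From data in dimensions at most 2 to a map into the simplicial groupoid of pyramids -/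

section Models

variable {L : ℕ → Prop} {C : Type → Prop} (hL : ∀ m, 0 < m → L m)
  (hC : ∀ T, C T ↔ Finite T ∧ L (Nat.card T))

/-- Strict naturality compares morphisms between pyramids of codes that are provably, not
definitionally, equal. All elements are pairs of numbers, so the comparison can be made on
underlying values. -/
theorem PyrCode.Hom.pyramid_heq {n : ℕ} {c d c' d' : PyrCode L n} (hc : c = c') (hd : d = d')
    {f : c.pyramid hL hC ⟶ d.pyramid hL hC} {g : c'.pyramid hL hC ⟶ d'.pyramid hL hC}
    (h : ∀ s v hv hv', (f.hom.app s ⟨v, hv⟩).1 = (g.hom.app s ⟨v, hv'⟩).1) : HEq f g := by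
  subst hc hd
  refine heq_of_eq (Iso.ext (NatTrans.ext (funext fun s => ConcreteCategory.hom_ext _ _ ?_)))
  exact fun v => Subtype.ext (h s v.1 v.2 v.2)

/-- A numerical invariant takes values in a fixed type, so it passes across an equality of functors
without any transport of morphisms. The simplicial identities are used in this form throughout. -/
theorem apply_map_eq {D D' : Type*} [Category* D] [Category* D'] {T : Sort*} {F G : D ⥤ D'}
    (h : F = G) (φ : ∀ {x y : D'}, (x ⟶ y) → T) {x y : D} (f : x ⟶ y) :
    φ (F.map f) = φ (G.map f) := by
  subst h
  rfl

theorem apply_obj_eq {D D' : Type*} [Category* D] [Category* D'] {T : Sort*} {F G : D ⥤ D'}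
    (h : F = G) (φ : D' → T) (x : D) : φ (F.obj x) = φ (G.obj x) := by
  subst h
  rfl

open Simplicial Opposite

def vertexMap {Δ : SimplexCategory} (i : Fin (Δ.len + 1)) : ⦋0⦌ ⟶ Δ :=
  SimplexCategory.Hom.mk ⟨fun _ => i, fun _ _ _ => le_rfl⟩

def edgeMap {Δ : SimplexCategory} (s : Pyr Δ.len) : ⦋1⦌ ⟶ Δ :=
  SimplexCategory.Hom.mk ⟨![s.i, s.j], by
    intro a b h
    fin_cases a <;> fin_cases b <;> first | (exact le_rfl) | (exact s.le) | (simp at h)⟩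

def triangleMap {Δ : SimplexCategory} {i k j : Fin (Δ.len + 1)} (h : i ≤ k) (h' : k ≤ j) :
    ⦋2⦌ ⟶ Δ :=
  SimplexCategory.Hom.mk ⟨![i, k, j], by
    intro a b hab
    fin_cases a <;> fin_cases b <;>
      first | (exact le_rfl) | (exact h) | (exact h') | (exact h.trans h') | (simp at hab)⟩

section

variable {Δ : SimplexCategory}

theorem δ_one_edgeMap (s : Pyr Δ.len) :
    SimplexCategory.δ (1 : Fin 2) ≫ edgeMap s = vertexMap s.i := by
  refine SimplexCategory.Hom.ext _ _ (OrderHom.ext _ _ (funext fun a => ?_))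
  fin_cases a
  rfl

theorem δ_zero_edgeMap (s : Pyr Δ.len) :
    SimplexCategory.δ (0 : Fin 2) ≫ edgeMap s = vertexMap s.j := by
  refine SimplexCategory.Hom.ext _ _ (OrderHom.ext _ _ (funext fun a => ?_))
  fin_cases a
  rfl

variable {i k j : Fin (Δ.len + 1)} (h : i ≤ k) (h' : k ≤ j)

theorem δ_zero_triangleMap :
    SimplexCategory.δ (0 : Fin 3) ≫ triangleMap h h' = edgeMap ⟨k, j, h'⟩ := by
  refine SimplexCategory.Hom.ext _ _ (OrderHom.ext _ _ (funext fun a => ?_))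
  fin_cases a <;> rfl

theorem δ_one_triangleMap :
    SimplexCategory.δ (1 : Fin 3) ≫ triangleMap h h' = edgeMap ⟨i, j, h.trans h'⟩ := by
  refine SimplexCategory.Hom.ext _ _ (OrderHom.ext _ _ (funext fun a => ?_))
  fin_cases a <;> rfl

theorem δ_two_triangleMap :
    SimplexCategory.δ (2 : Fin 3) ≫ triangleMap h h' = edgeMap ⟨i, k, h⟩ := by
  refine SimplexCategory.Hom.ext _ _ (OrderHom.ext _ _ (funext fun a => ?_))
  fin_cases a <;> rfl

theorem vertexMap_comp {Δ' : SimplexCategory} (θ : Δ ⟶ Δ') (i : Fin (Δ.len + 1)) :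
    vertexMap i ≫ θ = vertexMap (θ.toOrderHom i) := rfl

theorem edgeMap_comp {Δ' : SimplexCategory} (θ : Δ ⟶ Δ') (s : Pyr Δ.len) :
    edgeMap s ≫ θ = edgeMap ((pyrMap θ.toOrderHom).obj s) := by
  refine SimplexCategory.Hom.ext _ _ (OrderHom.ext _ _ (funext fun a => ?_))
  fin_cases a <;> rfl

end

/-- Numerical data on the simplices of dimension at most `2` of a simplicial groupoid with
faces `d_i` and `e_i`, from which a map to the simplicial groupoid of pyramids is constructed. -/
structure PyrModel (L : ℕ → Prop) {X₀ X₁ X₂ : Type*} [Category* X₀] [Category* X₁]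
    [Category* X₂] (d₀ d₁ : X₁ ⥤ X₀) (e₀ e₁ e₂ : X₂ ⥤ X₁) where
  N : X₀ → ℕ
  p : ∀ {x y : X₀}, (x ⟶ y) → ℕ → ℕ
  par : X₁ → ℕ → ℕ
  K : X₁ → ℕ → ℕ
  q : ∀ {x y : X₁}, (x ⟶ y) → ℕ → ℕ → ℕ
  mem : ∀ x, L (N x)
  p_lt : ∀ {x y : X₀} (f : x ⟶ y) {a : ℕ}, a < N x → p f a < N y
  p_id : ∀ (x : X₀) {a : ℕ}, a < N x → p (𝟙 x) a = a
  p_comp : ∀ {x y z : X₀} (f : x ⟶ y) (g : y ⟶ z) {a : ℕ}, a < N x →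
    p (f ≫ g) a = p g (p f a)
  par_lt : ∀ (x : X₁) {a : ℕ}, a < N (d₁.obj x) → par x a < N (d₀.obj x)
  par_surj : ∀ (x : X₁) {b : ℕ}, b < N (d₀.obj x) →
    ∃ a < N (d₁.obj x), par x a = b
  K_pos : ∀ (x : X₁) {a : ℕ}, a < N (d₁.obj x) → 0 < K x a
  q_lt : ∀ {x y : X₁} (f : x ⟶ y) {a e : ℕ}, a < N (d₁.obj x) → e < K x a →
    q f a e < K y (p (d₁.map f) a)
  q_id : ∀ (x : X₁) {a e : ℕ}, a < N (d₁.obj x) → e < K x a → q (𝟙 x) a e = e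
  q_comp : ∀ {x y z : X₁} (f : x ⟶ y) (g : y ⟶ z) {a e : ℕ}, a < N (d₁.obj x) →
    e < K x a → q (f ≫ g) a e = q g (p (d₁.map f) a) (q f a e)
  par_p : ∀ {x y : X₁} (f : x ⟶ y) {a : ℕ}, a < N (d₁.obj x) →
    par y (p (d₁.map f) a) = p (d₀.map f) (par x a)
  par_par : ∀ (x : X₂) {a : ℕ}, a < N (d₁.obj (e₂.obj x)) →
    par (e₁.obj x) a = par (e₀.obj x) (par (e₂.obj x) a)
  K_mul : ∀ (x : X₂) {a : ℕ}, a < N (d₁.obj (e₂.obj x)) →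
    K (e₁.obj x) a = K (e₂.obj x) a * K (e₀.obj x) (par (e₂.obj x) a)
  q_mul : ∀ {x y : X₂} (f : x ⟶ y) {a e : ℕ}, a < N (d₁.obj (e₂.obj x)) →
    e < K (e₁.obj x) a →
    q (e₁.map f) a e = q (e₀.map f) (par (e₂.obj x) a)
      (e / K (e₂.obj x) a) * K (e₂.obj y) (p (d₁.map (e₂.map f)) a) +
      q (e₂.map f) a (e % K (e₂.obj x) a)

namespace PyrModel

variable {X : SimplicialObject Grpd.{0, 1}}
  (M : PyrModel L (X.δ 0 : X _⦋1⦌ ⥤ X _⦋0⦌) (X.δ 1 : X _⦋1⦌ ⥤ X _⦋0⦌)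
    (X.δ 0 : X _⦋2⦌ ⥤ X _⦋1⦌) (X.δ 1 : X _⦋2⦌ ⥤ X _⦋1⦌) (X.δ 2 : X _⦋2⦌ ⥤ X _⦋1⦌))
  {Δ : SimplexCategory}

/-- Restriction to a vertex. -/
def vertex (i : Fin (Δ.len + 1)) : X.obj (op Δ) ⥤ X _⦋0⦌ := X.map (vertexMap i).op

/-- Restriction to an edge. -/
def edgeAt (s : Pyr Δ.len) : X.obj (op Δ) ⥤ X _⦋1⦌ := X.map (edgeMap s).op

def triangle {i k j : Fin (Δ.len + 1)} (h : i ≤ k) (h' : k ≤ j) : X.obj (op Δ) ⥤ X _⦋2⦌ :=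
  X.map (triangleMap h h').op

section

variable {m n l : SimplexCategory} {f : m ⟶ n} {g : n ⟶ l} {e : m ⟶ l}

theorem map_comp_eq (h : f ≫ g = e) :
    (X.map g.op : X.obj (op l) ⥤ X.obj (op n)) ⋙ (X.map f.op : X.obj (op n) ⥤ X.obj (op m)) =
      (X.map e.op : X.obj (op l) ⥤ X.obj (op m)) := by
  rw [← h, op_comp]
  exact (X.map_comp _ _).symm

end

variable (X) in
theorem edge_δ_one (s : Pyr Δ.len) :
    edgeAt s ⋙ (X.δ 1 : X _⦋1⦌ ⥤ X _⦋0⦌) = (vertex s.i : X.obj (op Δ) ⥤ _) :=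
  map_comp_eq (δ_one_edgeMap s)

variable (X) in
theorem edge_δ_zero (s : Pyr Δ.len) :
    edgeAt s ⋙ (X.δ 0 : X _⦋1⦌ ⥤ X _⦋0⦌) = (vertex s.j : X.obj (op Δ) ⥤ _) :=
  map_comp_eq (δ_zero_edgeMap s)

section

variable {i k j : Fin (Δ.len + 1)} (h : i ≤ k) (h' : k ≤ j)

variable (X) in
theorem triangle_δ_zero :
    triangle h h' ⋙ (X.δ 0 : X _⦋2⦌ ⥤ X _⦋1⦌) = (edgeAt ⟨k, j, h'⟩ : X.obj (op Δ) ⥤ _) :=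
  map_comp_eq (δ_zero_triangleMap h h')

variable (X) in
theorem triangle_δ_one :
    triangle h h' ⋙ (X.δ 1 : X _⦋2⦌ ⥤ X _⦋1⦌) =
      (edgeAt ⟨i, j, h.trans h'⟩ : X.obj (op Δ) ⥤ _) :=
  map_comp_eq (δ_one_triangleMap h h')

variable (X) in
theorem triangle_δ_two :
    triangle h h' ⋙ (X.δ 2 : X _⦋2⦌ ⥤ X _⦋1⦌) = (edgeAt ⟨i, k, h⟩ : X.obj (op Δ) ⥤ _) :=
  map_comp_eq (δ_two_triangleMap h h')

variable (X) in
theorem triangle_δ_two_δ_one :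
    (triangle h h' ⋙ (X.δ 2 : X _⦋2⦌ ⥤ X _⦋1⦌)) ⋙ (X.δ 1 : X _⦋1⦌ ⥤ X _⦋0⦌) =
      (vertex i : X.obj (op Δ) ⥤ _) := by
  rw [triangle_δ_two]
  exact edge_δ_one X ⟨i, k, h⟩

end

section

variable (x : X.obj (op Δ)) (s : Pyr Δ.len)

theorem N_edge_one : M.N ((X.δ 1).obj ((edgeAt s).obj x)) = M.N ((vertex s.i).obj x) :=
  apply_obj_eq (edge_δ_one X s) M.N x

theorem N_edge_zero : M.N ((X.δ 0).obj ((edgeAt s).obj x)) = M.N ((vertex s.j).obj x) :=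
  apply_obj_eq (edge_δ_zero X s) M.N x

end

/-- The code of a simplex. -/
def code (x : X.obj (op Δ)) : PyrCode L Δ.len where
  N i := M.N ((vertex i).obj x)
  anc s := M.par ((edgeAt s).obj x)
  K s := M.K ((edgeAt s).obj x)
  mem _ := M.mem _
  anc_lt s a ha := by
    rw [← N_edge_one] at ha
    rw [← N_edge_zero]
    exact M.par_lt _ ha
  anc_surj s b hb := by
    rw [← N_edge_one]
    rw [← N_edge_zero] at hb
    exact M.par_surj _ hb
  K_pos s a ha := by
    rw [← N_edge_one] at ha
    exact M.K_pos _ ha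
  -- Faces 0, 1, 2 of the triangle i ≤ k ≤ j are the edges (k, j), (i, j), (i, k), so the laws of
  -- codes are those of the model on 2-simplices.
  anc_comp {i k j} h h' a ha := by
    have h₀ := apply_obj_eq (triangle_δ_zero X h h') M.par x
    have h₁ := apply_obj_eq (triangle_δ_one X h h') M.par x
    have h₂ := apply_obj_eq (triangle_δ_two X h h') M.par x
    rw [← h₀, ← h₁, ← h₂]
    refine M.par_par _ (ha.trans_eq ?_)
    exact (apply_obj_eq (triangle_δ_two_δ_one X h h') M.N x).symm
  K_mul {i k j} h h' a ha := by
    have h₀ := apply_obj_eq (triangle_δ_zero X h h') M.K x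
    have h₁ := apply_obj_eq (triangle_δ_one X h h') M.K x
    have h₂ := apply_obj_eq (triangle_δ_two X h h') M.K x
    have h₃ := apply_obj_eq (triangle_δ_two X h h') M.par x
    rw [← h₀, ← h₁, ← h₂, ← h₃]
    refine M.K_mul _ (ha.trans_eq ?_)
    exact (apply_obj_eq (triangle_δ_two_δ_one X h h') M.N x).symm

/-- The map of codes of a morphism of simplices. -/
def codeHom {x y : X.obj (op Δ)} (f : x ⟶ y) : PyrCode.Hom (M.code x) (M.code y) where
  p i := M.p ((vertex i).map f)
  q s := M.q ((edgeAt s).map f)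
  p_lt i a ha := M.p_lt _ ha
  q_lt s a e ha he := by
    have h := apply_map_eq (edge_δ_one X s) M.p f
    rw [← h]
    exact M.q_lt _ (ha.trans_eq (M.N_edge_one x s).symm) he
  anc_p s a ha := by
    have h := apply_map_eq (edge_δ_one X s) M.p f
    have h' := apply_map_eq (edge_δ_zero X s) M.p f
    rw [← h, ← h']
    exact M.par_p _ (ha.trans_eq (M.N_edge_one x s).symm)
  q_mul {i k j} h h' a e ha he := by
    have h₀ := apply_map_eq (triangle_δ_zero X h h') M.q f
    have h₁ := apply_map_eq (triangle_δ_one X h h') M.q f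
    have h₂ := apply_map_eq (triangle_δ_two X h h') M.q f
    have h₃ := apply_obj_eq (triangle_δ_two X h h') M.par x
    have h₄ := apply_obj_eq (triangle_δ_two X h h') M.K x
    have h₅ := apply_obj_eq (triangle_δ_two X h h') M.K y
    have h₆ := apply_map_eq (triangle_δ_two_δ_one X h h') M.p f
    have h₇ := apply_obj_eq (triangle_δ_one X h h') M.K x
    change M.q ((edgeAt ⟨i, j, _⟩).map f) a e = M.q ((edgeAt ⟨k, j, _⟩).map f)
      (M.par ((edgeAt ⟨i, k, _⟩).obj x) a) (e / M.K ((edgeAt ⟨i, k, _⟩).obj x) a) *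
      M.K ((edgeAt ⟨i, k, _⟩).obj y) (M.p ((vertex i).map f) a) +
      M.q ((edgeAt ⟨i, k, _⟩).map f) a (e % M.K ((edgeAt ⟨i, k, _⟩).obj x) a)
    rw [← h₀, ← h₁, ← h₂, ← h₃, ← h₄, ← h₅, ← h₆]
    refine M.q_mul _ (ha.trans_eq ?_) (he.trans_eq (congrFun h₇ a).symm)
    exact (apply_obj_eq (triangle_δ_two_δ_one X h h') M.N x).symm

/-- The functor sending a simplex to the diagram of its code. -/
def diagramFunctor (Δ : SimplexCategory) : X.obj (op Δ) ⥤ (Pyr Δ.len ⥤ Type) where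
  obj x := (M.code x).diagram
  map f := (M.codeHom f).natTrans
  map_id x := NatTrans.ext (funext fun s => ConcreteCategory.hom_ext _ _ fun v => Subtype.ext (by
    refine Prod.ext ?_ ?_
    · exact (congrArg (fun f => M.p f v.1.1) ((vertex s.i).map_id x)).trans (M.p_id _ v.2.1)
    · exact (congrArg (fun f => M.q f v.1.1 v.1.2) ((edgeAt s).map_id x)).trans
        (M.q_id _ (lt_of_lt_of_eq v.2.1 (M.N_edge_one x s).symm) v.2.2)))
  map_comp {x y z} f g :=
    NatTrans.ext (funext fun s => ConcreteCategory.hom_ext _ _ fun v => Subtype.ext (by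
    refine Prod.ext ?_ ?_
    · change M.p ((vertex s.i).map (f ≫ g)) v.1.1 = M.p _ (M.p _ _)
      rw [Functor.map_comp]
      exact M.p_comp _ _ v.2.1
    · change M.q ((edgeAt s).map (f ≫ g)) v.1.1 v.1.2 =
        M.q _ (M.p ((vertex s.i).map f) v.1.1) (M.q _ v.1.1 v.1.2)
      rw [Functor.map_comp, ← apply_map_eq (edge_δ_one X s) M.p f]
      exact M.q_comp _ _ (lt_of_lt_of_eq v.2.1 (M.N_edge_one x s).symm) v.2.2))

/-- The functor sending a simplex to the pyramid of its code. -/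
noncomputable def pyramidFunctor (Δ : SimplexCategory) : X.obj (op Δ) ⥤ Pyramid C Δ.len where
  obj x := (M.code x).pyramid hL hC
  map f := (M.diagramFunctor Δ).mapIso (asIso f)
  map_id x := Iso.ext ((M.diagramFunctor Δ).map_id x)
  map_comp f g := Iso.ext ((M.diagramFunctor Δ).map_comp f g)

/-- Vertices and edges of a restricted simplex are vertices and edges of the original one. The codes
are therefore equal on the nose, and the comparison map is strictly simplicial. -/
theorem code_map {Δ' : SimplexCategory} (θ : Δ' ⟶ Δ) (x : X.obj (op Δ)) :
    M.code ((X.map θ.op).obj x) = (M.code x).restrict θ.toOrderHom :=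
  PyrCode.ext (funext fun i => apply_obj_eq (map_comp_eq (vertexMap_comp θ i)) M.N x)
    (funext fun s => apply_obj_eq (map_comp_eq (edgeMap_comp θ s)) M.par x)
    (funext fun s => apply_obj_eq (map_comp_eq (edgeMap_comp θ s)) M.K x)

theorem codeHom_map_p {Δ' : SimplexCategory} (θ : Δ' ⟶ Δ) {x y : X.obj (op Δ)} (f : x ⟶ y)
    (i : Fin (Δ'.len + 1)) :
    (M.codeHom ((X.map θ.op : X.obj (op Δ) ⥤ X.obj (op Δ')).map f)).p i =
      (M.codeHom f).p (θ.toOrderHom i) :=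
  apply_map_eq (map_comp_eq (vertexMap_comp θ i)) M.p f

theorem codeHom_map_q {Δ' : SimplexCategory} (θ : Δ' ⟶ Δ) {x y : X.obj (op Δ)} (f : x ⟶ y)
    (s : Pyr Δ'.len) :
    (M.codeHom ((X.map θ.op : X.obj (op Δ) ⥤ X.obj (op Δ')).map f)).q s =
      (M.codeHom f).q ((pyrMap θ.toOrderHom).obj s) :=
  apply_map_eq (map_comp_eq (edgeMap_comp θ s)) M.q f

/-- The map of simplicial groupoids from `X` to pyramids. -/
noncomputable def toPyramids : X ⟶ pyramids C where
  app Δ := M.pyramidFunctor hL hC Δ.unop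
  naturality Δ Δ' θ := by
    refine Functor.hext (fun x => ?_) fun x y f => ?_
    · exact congrArg (fun c => c.pyramid hL hC) (M.code_map θ.unop x)
    · refine PyrCode.Hom.pyramid_heq hL hC (M.code_map θ.unop x) (M.code_map θ.unop y)
        fun s v hv hv' => Prod.ext ?_ ?_
      · exact congrFun (M.codeHom_map_p θ.unop f s.i) v.1
      · exact congrFun (congrFun (M.codeHom_map_q θ.unop f s) v.1) v.2

end PyrModel

end Models

end Plethysm

namespace Plethysm
universe v u

/-! ### A pyramid is determined by its last face, last edge and last vertex -/

section Extension

/-- The inclusion of the vertices of `[n]` in `[n + 1]` which omits the last vertex. -/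
def castSuccHom (n : ℕ) : Fin (n + 1) →o Fin (n + 2) := ⟨Fin.castSucc, Fin.strictMono_castSucc.monotone⟩

namespace Pyr

variable {n : ℕ}

/-- The position `(i, n + 1)` in a pyramid of height `n + 1`. -/
def rim (i : Fin (n + 1)) : Pyr (n + 1) := ⟨i.castSucc, Fin.last _, Fin.le_last _⟩

/-- The position `(n + 1, n + 1)` in a pyramid of height `n + 1`. -/
def tip (n : ℕ) : Pyr (n + 1) := ⟨Fin.last _, Fin.last _, le_rfl⟩

/-- The position `(i, j)` with `j ≤ n` in a pyramid of height `n + 1`. -/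
def base (s : Pyr n) : Pyr (n + 1) := ⟨s.i.castSucc, s.j.castSucc, s.le⟩

theorem base_le_base {s t : Pyr n} (h : base s ≤ base t) : s ≤ t :=
  ⟨h.1, h.2.imp (fun h => h) fun h => Fin.castSucc_injective _ h⟩

theorem base_mono {s t : Pyr n} (h : s ≤ t) : base s ≤ base t :=
  ⟨h.1, h.2.imp (fun h => h) fun h => congrArg Fin.castSucc h⟩

theorem base_rim_tip (p : Pyr (n + 1)) : (∃ s, p = base s) ∨ (∃ i, p = rim i) ∨ p = tip n := by
  obtain ⟨i, j, h⟩ := p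
  rcases Fin.eq_castSucc_or_eq_last j with ⟨j, rfl⟩ | rfl
  · obtain ⟨i, rfl⟩ : ∃ i', i = Fin.castSucc i' :=
      (Fin.eq_castSucc_or_eq_last i).resolve_right fun e => by
        subst e
        exact absurd (h.trans_lt (Fin.castSucc_lt_last j)) (lt_irrefl _)
    exact Or.inl ⟨⟨i, j, h⟩, rfl⟩
  · rcases Fin.eq_castSucc_or_eq_last i with ⟨i, rfl⟩ | rfl
    · exact Or.inr (Or.inl ⟨i, rfl⟩)
    · exact Or.inr (Or.inr rfl)

theorem le_last_diag (s : Pyr n) : s ≤ ⟨Fin.last n, Fin.last n, le_rfl⟩ :=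
  ⟨Fin.le_last _, Or.inr rfl⟩

theorem diag_le_tip : base (⟨Fin.last n, Fin.last n, le_rfl⟩ : Pyr n) ≤ tip n :=
  ⟨Fin.le_last _, Or.inr rfl⟩

theorem rim_le_base (i : Fin (n + 1)) : rim i ≤ base ⟨i, Fin.last n, Fin.le_last _⟩ :=
  ⟨le_rfl, Or.inl (Fin.le_last _)⟩

theorem rim_le_rim {i k : Fin (n + 1)} (h : i ≤ k) : rim i ≤ rim k := ⟨h, Or.inl le_rfl⟩

theorem not_base_le_rim (s : Pyr n) (i : Fin (n + 1)) : ¬ base s ≤ rim i := fun h =>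
  h.2.elim (fun h => absurd (h.trans_lt (Fin.castSucc_lt_last s.j)) (lt_irrefl _))
    fun h => absurd h (Fin.castSucc_lt_last i).ne

theorem base_of_rim_le {i : Fin (n + 1)} {s : Pyr n} (h : rim i ≤ base s) :
    (⟨i, Fin.last n, Fin.le_last _⟩ : Pyr n) ≤ s := ⟨h.1, Or.inl (Fin.le_last _)⟩

theorem not_tip_le_base (s : Pyr n) : ¬ tip n ≤ base s := fun h =>
  absurd (h.1.trans_lt (Fin.castSucc_lt_last s.i)) (lt_irrefl _)

theorem not_tip_le_rim (i : Fin (n + 1)) : ¬ tip n ≤ rim i := fun h =>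
  absurd (h.1.trans_lt (Fin.castSucc_lt_last i)) (lt_irrefl _)

end Pyr

namespace Pyramid

variable {C : Type → Prop} {n : ℕ}

/-- The map of a pyramid between two comparable positions. -/
def res (S : Pyramid C n) {p q : Pyr n} (h : p ≤ q) (v : S.diagram.obj p) : S.diagram.obj q :=
  S.diagram.map (homOfLE h) v

theorem res_self (S : Pyramid C n) {p : Pyr n} (v : S.diagram.obj p) : S.res le_rfl v = v :=
  congrArg (fun f => (ConcreteCategory.hom f) v) (S.diagram.map_id p)

theorem res_res (S : Pyramid C n) {p q r : Pyr n} (h : p ≤ q) (h' : q ≤ r) (v : S.diagram.obj p) :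
    S.res h' (S.res h v) = S.res (h.trans h') v :=
  (congrArg (fun f => (ConcreteCategory.hom f) v) (S.diagram.map_comp (homOfLE h) (homOfLE h'))).symm

theorem app_res {S T : Pyramid C n} (α : S.diagram ⟶ T.diagram) {p q : Pyr n} (h : p ≤ q)
    (v : S.diagram.obj p) : α.app q (S.res h v) = T.res h (α.app p v) :=
  congrArg (fun f => (ConcreteCategory.hom f) v) (α.naturality (homOfLE h))

variable {S T U : Pyramid C (n + 1)}

/-- This and `rim_glue` are the two halves of the pullback condition for k = l = n: the set at (i,
n+1) is the fibre product of those at (i, n) and (n, n+1) over (n, n). -/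
theorem rim_ext (i : Fin (n + 1)) {v w : S.diagram.obj (Pyr.rim i)}
    (h₁ : S.res (Pyr.rim_le_base i) v = S.res (Pyr.rim_le_base i) w)
    (h₂ : S.res (Pyr.rim_le_rim (Fin.le_last i)) v = S.res (Pyr.rim_le_rim (Fin.le_last i)) w) :
    v = w :=
  ((Types.isPullback_iff _ _ _ _).1 (S.isPullback (i := i.castSucc) (k := (Fin.last n).castSucc)
    (l := (Fin.last n).castSucc) (j := Fin.last (n + 1)) (Fin.le_last i) le_rfl
    (Fin.le_last _))).2.1 v w ⟨h₁, h₂⟩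

theorem rim_glue (i : Fin (n + 1))
    (v : S.diagram.obj (Pyr.base ⟨i, Fin.last n, Fin.le_last _⟩))
    (w : S.diagram.obj (Pyr.rim (Fin.last n)))
    (h : S.res (Pyr.base_mono (Pyr.le_last_diag _)) v =
      S.res (Pyr.rim_le_base (Fin.last n)) w) :
    ∃ x, S.res (Pyr.rim_le_base i) x = v ∧ S.res (Pyr.rim_le_rim (Fin.le_last i)) x = w :=
  ((Types.isPullback_iff _ _ _ _).1 (S.isPullback (i := i.castSucc) (k := (Fin.last n).castSucc)
    (l := (Fin.last n).castSucc) (j := Fin.last (n + 1)) (Fin.le_last i) le_rfl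
    (Fin.le_last _))).2.2 v w h

/-- Two maps of pyramids agree if they agree on the last face, the last edge and the last
vertex. -/
theorem hom_ext {α β : S.diagram ⟶ T.diagram}
    (h₁ : ∀ s (v : S.diagram.obj (Pyr.base s)), α.app _ v = β.app _ v)
    (h₂ : ∀ v : S.diagram.obj (Pyr.rim (Fin.last n)), α.app _ v = β.app _ v)
    (h₃ : ∀ v : S.diagram.obj (Pyr.tip n), α.app _ v = β.app _ v) : α = β := by
  refine NatTrans.ext (funext fun p => ConcreteCategory.hom_ext _ _ ?_)
  rcases Pyr.base_rim_tip p with ⟨s, rfl⟩ | ⟨i, rfl⟩ | rfl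
  · exact h₁ s
  · intro v
    refine rim_ext i ?_ ?_
    · rw [← app_res, ← app_res, h₁]
    · rw [← app_res, ← app_res, h₂]
  · exact h₃

variable (S T) in
/-- The restriction of a map of pyramids to the last face, the last edge and the last vertex. -/
structure LocalHom where
  α : ∀ s : Pyr n, S.diagram.obj (Pyr.base s) → T.diagram.obj (Pyr.base s)
  β : S.diagram.obj (Pyr.rim (Fin.last n)) → T.diagram.obj (Pyr.rim (Fin.last n))
  γ : S.diagram.obj (Pyr.tip n) → T.diagram.obj (Pyr.tip n)
  hα : ∀ {s t : Pyr n} (h : s ≤ t) (v : S.diagram.obj (Pyr.base s)),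
    α t (S.res (Pyr.base_mono h) v) = T.res (Pyr.base_mono h) (α s v)
  hβ : ∀ v, T.res (Pyr.rim_le_base _) (β v) = α ⟨Fin.last n, Fin.last n, le_rfl⟩
    (S.res (Pyr.rim_le_base _) v)
  hγ : ∀ v, γ (S.res Pyr.diag_le_tip v) = T.res Pyr.diag_le_tip
    (α ⟨Fin.last n, Fin.last n, le_rfl⟩ v)

namespace LocalHom

variable (f : LocalHom S T)

/-- `w` is the image of `v` under every extension of `f`. -/
structure Rel {p : Pyr (n + 1)} (v : S.diagram.obj p) (w : T.diagram.obj p) : Prop where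
  base : ∀ (s : Pyr n) (h : p ≤ Pyr.base s), T.res h w = f.α s (S.res h v)
  rim : ∀ h : p ≤ Pyr.rim (Fin.last n), T.res h w = f.β (S.res h v)
  tip : ∀ h : p ≤ Pyr.tip n, T.res h w = f.γ (S.res h v)

/-- On the base and at the tip the image is prescribed. On the rim it is glued from its images at
(i, n) and (n, n+1), which agree over (n, n) by `hα` and `hβ`. -/
theorem exists_rel {p : Pyr (n + 1)} (v : S.diagram.obj p) : ∃ w, f.Rel v w := by
  rcases Pyr.base_rim_tip p with ⟨s, rfl⟩ | ⟨i, rfl⟩ | rfl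
  · refine ⟨f.α s v, fun t h => (f.hα (Pyr.base_le_base h) v).symm,
      fun h => absurd h (Pyr.not_base_le_rim _ _), fun h => ?_⟩
    -- The map from the base to the tip factors through (n, n), where `hγ` applies.
    have h₁ := f.hα (Pyr.le_last_diag s) v
    have h₂ := f.hγ (S.res (Pyr.base_mono (Pyr.le_last_diag s)) v)
    rw [res_res, h₁, res_res] at h₂
    exact h₂.symm
  · have h₀ : (⟨i, Fin.last n, Fin.le_last _⟩ : Pyr n) ≤ ⟨Fin.last n, Fin.last n, le_rfl⟩ :=
      ⟨Fin.le_last _, Or.inl le_rfl⟩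
    have h₁ := f.hα h₀ (S.res (Pyr.rim_le_base i) v)
    have h₂ := f.hβ (S.res (Pyr.rim_le_rim (Fin.le_last i)) v)
    rw [res_res] at h₁ h₂
    obtain ⟨w, h₃, h₄⟩ := T.rim_glue i (f.α _ (S.res (Pyr.rim_le_base i) v))
      (f.β (S.res (Pyr.rim_le_rim (Fin.le_last i)) v)) (h₁.symm.trans h₂.symm)
    refine ⟨w, fun s h => ?_, fun h => h₄, fun h => ?_⟩
    · have h₅ := f.hα (Pyr.base_of_rim_le h) (S.res (Pyr.rim_le_base i) v)
      rw [← h₃, res_res, res_res] at h₅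
      exact h₅.symm
    · have h₅ := f.hγ (S.res (Pyr.base_mono h₀) (S.res (Pyr.rim_le_base i) v))
      rw [f.hα h₀, ← h₃, res_res, res_res, res_res, res_res] at h₅
      exact h₅.symm
  · exact ⟨f.γ v, fun s h => absurd h (Pyr.not_tip_le_base s),
      fun h => absurd h (Pyr.not_tip_le_rim _), fun h => by rw [res_self, res_self]⟩

theorem Rel.unique {p : Pyr (n + 1)} {v : S.diagram.obj p} {w w' : T.diagram.obj p}
    (h : f.Rel v w) (h' : f.Rel v w') : w = w' := by
  rcases Pyr.base_rim_tip p with ⟨s, rfl⟩ | ⟨i, rfl⟩ | rfl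
  · rw [← T.res_self w, ← T.res_self w', h.base s le_rfl, h'.base s le_rfl]
  · exact rim_ext i ((h.base _ _).trans (h'.base _ _).symm) ((h.rim _).trans (h'.rim _).symm)
  · rw [← T.res_self w, ← T.res_self w', h.tip le_rfl, h'.tip le_rfl]

/-- The relation is stable under the maps of the pyramids. Together with existence and uniqueness of
images, this makes the extension natural without a case distinction on pairs of positions. -/
theorem Rel.res {p q : Pyr (n + 1)} {v : S.diagram.obj p} {w : T.diagram.obj p}
    (h : f.Rel v w) (hpq : p ≤ q) : f.Rel (S.res hpq v) (T.res hpq w) where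
  base s hs := by rw [res_res, res_res, h.base]
  rim hs := by rw [res_res, res_res, h.rim]
  tip hs := by rw [res_res, res_res, h.tip]

/-- The map of pyramids with a given restriction to the last face, edge and vertex. -/
noncomputable def extend : S.diagram ⟶ T.diagram where
  app _ := TypeCat.ofHom fun v => (f.exists_rel v).choose
  naturality _ _ g := ConcreteCategory.hom_ext _ _ fun v =>
    Rel.unique f (f.exists_rel (S.res (leOfHom g) v)).choose_spec
      (Rel.res f (f.exists_rel v).choose_spec (leOfHom g))

theorem extend_rel {p : Pyr (n + 1)} (v : S.diagram.obj p) : f.Rel v (f.extend.app p v) :=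
  (f.exists_rel v).choose_spec

theorem extend_base (s : Pyr n) (v : S.diagram.obj (Pyr.base s)) :
    f.extend.app (Pyr.base s) v = f.α s v := by
  have h := (f.extend_rel v).base s le_rfl
  rwa [res_self, res_self] at h

theorem extend_rim (v : S.diagram.obj (Pyr.rim (Fin.last n))) : f.extend.app _ v = f.β v := by
  have h := (f.extend_rel v).rim le_rfl
  rwa [res_self, res_self] at h

theorem extend_tip (v : S.diagram.obj (Pyr.tip n)) : f.extend.app _ v = f.γ v := by
  have h := (f.extend_rel v).tip le_rfl
  rwa [res_self, res_self] at h

end LocalHom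

/-- Isomorphisms of the last faces, edges and vertices of two pyramids which are compatible with
each other extend to an isomorphism of pyramids. -/
theorem exists_iso
    (α : ∀ s : Pyr n, S.diagram.obj (Pyr.base s) ≃ T.diagram.obj (Pyr.base s))
    (β : S.diagram.obj (Pyr.rim (Fin.last n)) ≃ T.diagram.obj (Pyr.rim (Fin.last n)))
    (γ : S.diagram.obj (Pyr.tip n) ≃ T.diagram.obj (Pyr.tip n))
    (hα : ∀ {s t : Pyr n} (h : s ≤ t) (v : S.diagram.obj (Pyr.base s)),
      α t (S.res (Pyr.base_mono h) v) = T.res (Pyr.base_mono h) (α s v))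
    (hβ : ∀ v, T.res (Pyr.rim_le_base _) (β v) = α ⟨Fin.last n, Fin.last n, le_rfl⟩
      (S.res (Pyr.rim_le_base _) v))
    (hγ : ∀ v, γ (S.res Pyr.diag_le_tip v) = T.res Pyr.diag_le_tip
      (α ⟨Fin.last n, Fin.last n, le_rfl⟩ v)) :
    ∃ h : S.diagram ≅ T.diagram,
      (∀ s (v : S.diagram.obj (Pyr.base s)), h.hom.app _ v = α s v) ∧
      (∀ v : S.diagram.obj (Pyr.rim (Fin.last n)), h.hom.app _ v = β v) ∧
      ∀ v : S.diagram.obj (Pyr.tip n), h.hom.app _ v = γ v := by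
  let f : LocalHom S T := ⟨fun s => α s, β, γ, hα, hβ, hγ⟩
  let g : LocalHom T S := ⟨fun s => (α s).symm, β.symm, γ.symm,
    fun {s t} h v => by
      obtain ⟨v, rfl⟩ := (α s).surjective v
      rw [← hα h, (α s).symm_apply_apply, (α t).symm_apply_apply],
    fun v => by
      obtain ⟨v, rfl⟩ := β.surjective v
      rw [hβ, Equiv.symm_apply_apply, Equiv.symm_apply_apply],
    fun v => by
      obtain ⟨v, rfl⟩ := (α _).surjective v
      rw [← hγ, γ.symm_apply_apply, Equiv.symm_apply_apply]⟩
  -- Both composites are identities on the last face, edge and vertex, which suffices by `hom_ext`.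
  refine ⟨⟨f.extend, g.extend, hom_ext (fun s v => ?_) (fun v => ?_) (fun v => ?_),
    hom_ext (fun s v => ?_) (fun v => ?_) (fun v => ?_)⟩, f.extend_base, f.extend_rim,
    f.extend_tip⟩
  · exact (congrArg _ (f.extend_base s v)).trans
      ((g.extend_base s _).trans ((α s).symm_apply_apply v))
  · exact (congrArg _ (f.extend_rim v)).trans ((g.extend_rim _).trans (β.symm_apply_apply v))
  · exact (congrArg _ (f.extend_tip v)).trans ((g.extend_tip _).trans (γ.symm_apply_apply v))
  · exact (congrArg _ (g.extend_base s v)).trans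
      ((f.extend_base s _).trans ((α s).apply_symm_apply v))
  · exact (congrArg _ (g.extend_rim v)).trans ((f.extend_rim _).trans (β.apply_symm_apply v))
  · exact (congrArg _ (g.extend_tip v)).trans ((f.extend_tip _).trans (γ.apply_symm_apply v))

end Pyramid

end Extension

end Plethysm

namespace Plethysm
universe v u

namespace Fam

/-! ### Permutations and positions in concatenated sequences as numbers -/

section Values

variable {L : ℕ → Prop} {A : Type u} [Groupoid.{v} A]

/-- The permutation of a morphism of sequences, as a map of numbers. -/
def pv {x y : Fam L A} (f : x ⟶ y) (a : ℕ) : ℕ := if h : a < x.n then Hom.perm f ⟨a, h⟩ else 0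

theorem pv_val {x y : Fam L A} (f : x ⟶ y) (k : Fin x.n) : pv f k = Hom.perm f k := dif_pos k.2

theorem pv_lt {x y : Fam L A} (f : x ⟶ y) {a : ℕ} (ha : a < x.n) : pv f a < y.n := by
  rw [pv, dif_pos ha]
  exact Fin.isLt _

theorem pv_id (x : Fam L A) {a : ℕ} (ha : a < x.n) : pv (𝟙 x) a = a := dif_pos ha

theorem pv_comp {x y z : Fam L A} (f : x ⟶ y) (g : y ⟶ z) {a : ℕ} (ha : a < x.n) :
    pv (f ≫ g) a = pv g (pv f a) := by
  lift a to Fin x.n using ha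
  rw [pv_val, pv_val, pv_val, comp_perm]

end Values

section Flat

variable {L : ℕ → Prop} [SeqClosed L] (hL : ∀ n, PosLength n → L n) {A : Type u} [Groupoid.{v} A]

/-- A sequence of nonempty sequences, as a sequence of sequences. -/
def inclMap (A : Type u) [Groupoid.{v} A] : Fam L (Fam PosLength A) ⥤ Fam L (Fam L A) :=
  map L (incl hL A)

/-- Concatenation of a sequence of nonempty sequences. -/
noncomputable def flat (A : Type u) [Groupoid.{v} A] : Fam L (Fam PosLength A) ⥤ Fam L A :=
  inclMap hL A ⋙ flatten L A

/-- The position in a sequence of nonempty sequences which corresponds to a position in its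
concatenation. -/
noncomputable def fpos (x : Fam L (Fam PosLength A)) :
    Fin ((flat hL A).obj x).n ≃ Σ i : Fin x.n, Fin (x.el i).n := pos ((inclMap hL A).obj x)

theorem fpos_perm {x y : Fam L (Fam PosLength A)} (f : x ⟶ y) (k : Fin ((flat hL A).obj x).n) :
    fpos hL y (Hom.perm ((flat hL A).map f) k) =
      ⟨Hom.perm f (fpos hL x k).1, Hom.perm (Hom.hom f (fpos hL x k).1 _ rfl) (fpos hL x k).2⟩ :=
  pos_flattenMap ((inclMap hL A).map f) k

theorem fpos_perm_fst {x y : Fam L (Fam PosLength A)} (f : x ⟶ y)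
    (k : Fin ((flat hL A).obj x).n) :
    (fpos hL y (Hom.perm ((flat hL A).map f) k)).1 = Hom.perm f (fpos hL x k).1 := by
  rw [fpos_perm]

/-- The index of the sequence to which a position of the concatenation belongs. -/
noncomputable def par (x : Fam L (Fam PosLength A)) (a : ℕ) : ℕ :=
  if h : a < ((flat hL A).obj x).n then (fpos hL x ⟨a, h⟩).1 else 0

theorem par_val (x : Fam L (Fam PosLength A)) (k : Fin ((flat hL A).obj x).n) :
    par hL x k = (fpos hL x k).1 := dif_pos k.2

theorem par_lt (x : Fam L (Fam PosLength A)) {a : ℕ} (ha : a < ((flat hL A).obj x).n) :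
    par hL x a < x.n := by
  lift a to Fin _ using ha
  rw [par_val]
  exact Fin.isLt _

theorem par_surj (x : Fam L (Fam PosLength A)) {b : ℕ} (hb : b < x.n) :
    ∃ a < ((flat hL A).obj x).n, par hL x a = b := by
  -- The witness is the first entry of the `b`-th sequence, which exists because the inner sequences
  -- are nonempty.
  refine ⟨(fpos hL x).symm ⟨⟨b, hb⟩, ⟨0, (x.el ⟨b, hb⟩).len⟩⟩, Fin.isLt _, ?_⟩
  rw [par_val, Equiv.apply_symm_apply]

theorem par_pv {x y : Fam L (Fam PosLength A)} (f : x ⟶ y) {a : ℕ}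
    (ha : a < ((flat hL A).obj x).n) :
    par hL y (pv ((flat hL A).map f) a) = pv f (par hL x a) := by
  lift a to Fin _ using ha
  rw [pv_val, par_val, par_val, pv_val, fpos_perm_fst]

end Flat

/-! ### Labels and their lexicographic product -/

section Labels

/-- The labels of the nodes: nonempty finite sequences of points. -/
abbrev Label : Type 1 := Fam PosLength Pt.{1}

instance : Groupoid.{0} Label := inferInstanceAs (Groupoid.{0} (Fam PosLength Pt.{1}))

variable {L : ℕ → Prop} {Z : Type 1}

/-- A label is a sequence of points, so its length is its only information. The value 0 out of range
is never used: the laws of codes are only required below the number of nodes. -/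
def label (u : Fam L (Z × Label)) (a : ℕ) : ℕ := if h : a < u.n then (u.el ⟨a, h⟩).2.n else 0

theorem label_val (u : Fam L (Z × Label)) (k : Fin u.n) : label u k = (u.el k).2.n := dif_pos k.2

theorem label_pos (u : Fam L (Z × Label)) {a : ℕ} (ha : a < u.n) : 0 < label u a := by
  rw [label, dif_pos ha]
  exact (u.el _).2.len

variable [Groupoid.{0} Z]

/-- The permutation of the label of the `a`-th member, as a map of numbers. -/
def lv {u w : Fam L (Z × Label)} (f : u ⟶ w) (a e : ℕ) : ℕ :=
  if h : a < u.n then pv (Hom.hom f ⟨a, h⟩ _ rfl).2 e else 0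

theorem lv_val {u w : Fam L (Z × Label)} (f : u ⟶ w) (k : Fin u.n) (l : Fin w.n)
    (h : Hom.perm f k = l) (e : ℕ) : lv f k e = pv (Hom.hom f k l h).2 e := by
  subst h
  exact dif_pos k.2

theorem lv_lt {u w : Fam L (Z × Label)} (f : u ⟶ w) {a e : ℕ} (ha : a < u.n)
    (he : e < label u a) : lv f a e < label w (pv f a) := by
  lift a to Fin _ using ha
  rw [label_val] at he
  rw [lv_val f a _ rfl, pv_val, label_val]
  exact pv_lt _ he

theorem lv_id (u : Fam L (Z × Label)) {a e : ℕ} (ha : a < u.n) (he : e < label u a) :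
    lv (𝟙 u) a e = e := by
  lift a to Fin _ using ha
  rw [label_val] at he
  rw [lv_val (𝟙 u) a a rfl]
  exact pv_id _ he

theorem lv_comp {u w t : Fam L (Z × Label)} (f : u ⟶ w) (g : w ⟶ t) {a e : ℕ} (ha : a < u.n)
    (he : e < label u a) : lv (f ≫ g) a e = lv g (pv f a) (lv f a e) := by
  lift a to Fin _ using ha
  rw [label_val] at he
  rw [lv_val f a _ rfl, pv_val, lv_val g _ _ rfl, lv_val (f ≫ g) a _ rfl]
  exact pv_comp _ _ he

end Labels

section Mul

/-- The product of labels: `l` copies of `k`. -/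
noncomputable def mulF : Label × Label ⥤ Label :=
  strength PosLength Label Pt.{1} ⋙ map PosLength (CategoryTheory.Prod.fst Label Pt.{1}) ⋙
    flatten PosLength Pt.{1}

/-- The sequence of `l` copies of `k`. -/
def copies (k l : Label) : Fam PosLength Label := ⟨l.n, l.len, fun _ => k⟩

/-- Lexicographic position and the number k · i + r order the pairs (i, r) in the same way, because
r < k. An order isomorphism between initial segments of ℕ preserves values, so positions in the
product are mixed-radix numbers. -/
noncomputable def copiesIso (k l : Label) : Fin (flattenObj (copies k l)).n ≃o Fin (l.n * k.n) :=
  StrictMono.orderIsoOfSurjective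
    (fun e => finProdFinEquiv (Equiv.sigmaEquivProd (Fin l.n) (Fin k.n) (pos (copies k l) e)))
    (fun e e' h => by
      replace h := (pos_lt.{0, 1} (copies k l) e e').1 h
      change (finProdFinEquiv (Equiv.sigmaEquivProd (Fin l.n) (Fin k.n) (pos (copies k l) e)) : ℕ) <
        finProdFinEquiv (Equiv.sigmaEquivProd (Fin l.n) (Fin k.n) (pos (copies k l) e'))
      generalize pos (copies k l) e = s at h ⊢
      generalize pos (copies k l) e' = t at h ⊢
      obtain ⟨i, r⟩ := s
      obtain ⟨j, q⟩ := t
      have hr : (r : ℕ) < k.n := r.2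
      change (r : ℕ) + k.n * i < q + k.n * j
      rcases h with h | ⟨h, h'⟩
      · have h₁ : (i : ℕ) + 1 ≤ j := h
        have := Nat.mul_le_mul_left k.n h₁
        rw [Nat.mul_add] at this
        omega
      · have h₁ : i = j := h
        subst h₁
        exact Nat.add_lt_add_right h' _)
    (finProdFinEquiv.surjective.comp ((Equiv.sigmaEquivProd _ _).surjective.comp
      (pos (copies k l)).surjective))

theorem pos_copies (k l : Label) (e : Fin (flattenObj (copies k l)).n) :
    (e : ℕ) = k.n * (pos (copies k l) e).1 + (pos (copies k l) e).2 := by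
  rw [← orderIso_val (copiesIso k l) e, add_comm]
  rfl

theorem pos_copies_fst (k l : Label) (e : Fin (flattenObj (copies k l)).n) :
    ((pos (copies k l) e).1 : ℕ) = e / k.n := by
  have h : ((pos (copies k l) e).2 : ℕ) < k.n := Fin.isLt _
  rw [pos_copies, Nat.mul_add_div (Nat.zero_lt_of_lt h), Nat.div_eq_of_lt h, add_zero]

theorem pos_copies_snd (k l : Label) (e : Fin (flattenObj (copies k l)).n) :
    ((pos (copies k l) e).2 : ℕ) = e % k.n := by
  have h : ((pos (copies k l) e).2 : ℕ) < k.n := Fin.isLt _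
  rw [pos_copies, Nat.mul_add_mod, Nat.mod_eq_of_lt h]

theorem mulF_n (k l : Label) : (mulF.obj (k, l)).n = k.n * l.n := by
  change ∑ _ : Fin l.n, k.n = _
  rw [Finset.sum_const, Finset.card_univ, Fintype.card_fin, smul_eq_mul, mul_comm]

/-- The quotient by `k.n` names the copy, which `f.2` permutes; the remainder is the place within
the copy, which `f.1` permutes. This is the source of the law `q_mul`. -/
theorem mulF_pv {k l k' l' : Label} (f : (k, l) ⟶ (k', l')) {e : ℕ} (he : e < k.n * l.n) :
    pv (mulF.map f) e = pv f.2 (e / k.n) * k'.n + pv f.1 (e % k.n) := by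
  rw [← mulF_n] at he
  lift e to Fin (mulF.obj (k, l)).n using he
  have h := pos_copies k' l' (Hom.perm (mulF.map f) e)
  have h₁ : pos (copies k' l') (Hom.perm (mulF.map f) e) =
      ⟨Hom.perm f.2 (pos (copies k l) e).1, Hom.perm f.1 (pos (copies k l) e).2⟩ :=
    pos_flattenMap (X := copies k l) (Y := copies k' l') ⟨f.2.perm, fun _ _ _ => f.1⟩ e
  rw [h₁] at h
  have h₂ := pos_copies_fst k l e
  have h₃ := pos_copies_snd k l e
  rw [pv_val, ← h₂, ← h₃, mul_comm]
  refine h.trans (congrArg₂ (fun a b => k'.n * a + b) ?_ ?_)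
  · exact (pv_val f.2 _).symm
  · exact (pv_val f.1 _).symm

end Mul

end Fam

end Plethysm

namespace Plethysm
universe v u

namespace Fam

/-! ### Multiplication of labelled families: parents and labels -/

section Triples

variable {K : ℕ → Prop} [SeqClosed K] {A : Type u} [Groupoid.{v} A]

/-- Both ways of concatenating three levels enumerate the triples increasingly for the same
lexicographic order, and such an enumeration of a finite order is unique. -/
theorem triple_eq (X : Fam K (Fam K (Fam K A)))
    (k : Fin (flattenObj ((map K (flatten K A)).obj X)).n)
    (l : Fin (flattenObj (flattenObj X)).n) (h : (k : ℕ) = l) : triple₁ X k = triple₂ X l := by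
  let e : Fin (flattenObj ((map K (flatten K A)).obj X)).n ≃o Fin (flattenObj (flattenObj X)).n :=
    StrictMono.orderIsoOfSurjective (fun k => (triple₂ X).symm (triple₁ X k))
      (fun k k' hk => by
        rw [triple₁_lt] at hk
        rw [triple₂_lt, Equiv.apply_symm_apply, Equiv.apply_symm_apply]
        exact hk)
      ((triple₂ X).symm.surjective.comp (triple₁ X).surjective)
  have h₁ : e k = l := Fin.ext ((orderIso_val e k).trans h)
  rw [← h₁]
  exact ((triple₂ X).apply_symm_apply _).symm

end Triples

section Writers

/-- Nonempty families of objects of `Z` with labels. -/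
abbrev Writer (Z : Type 1) [Groupoid.{0} Z] : Type 1 := Fam PosLength (Z × Label)

variable {L : ℕ → Prop} [SeqClosed L] (hL : ∀ n, PosLength n → L n)
  (Z : Type 1) [Groupoid.{0} Z] {Z' : Type 1} [Groupoid.{0} Z']

/-- Multiply all labels of a family on the right by a label. -/
noncomputable def actF : Writer Z × Label ⥤ Writer Z where
  obj p := ⟨p.1.n, p.1.len, fun i => ((p.1.el i).1, mulF.obj ((p.1.el i).2, p.2))⟩
  map f := ⟨f.1.perm, fun i j h => ((f.1.hom i j h).1, mulF.map ((f.1.hom i j h).2, f.2))⟩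
  map_id p := Hom.ext' (fun _ => rfl) fun i j h h' => by
    obtain rfl := h'
    exact Prod.ext rfl (mulF.map_id _)
  map_comp f g := Hom.ext' (fun _ => rfl) fun i j h h' =>
    Prod.ext rfl (mulF.map_comp (X := (_, _)) (Y := (_, _)) (Z := (_, _)) (_, _) (_, _))

/-- The concrete form of the multiplication of `labelMonad`; `labelMonad_μ` identifies the two. -/
noncomputable def writerMul : Writer (Writer Z) ⥤ Writer Z :=
  map PosLength (actF Z) ⋙ flatten PosLength (Z × Label)

def writerMap (T : Z ⥤ Z') : Writer Z ⥤ Writer Z' := map PosLength (T.prod (𝟭 Label))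

/-- Concatenation of a sequence of labelled families, forgetting the labels. -/
noncomputable def topF : Fam L (Writer Z) ⥤ Fam L Z :=
  flat hL (Z × Label) ⋙ map L (CategoryTheory.Prod.fst Z Label)

variable {Z} {A : Type u} [Groupoid.{v} A]

theorem par_of_lt (x : Fam L (Fam PosLength A)) {a : ℕ} (ha : a < ((flat hL A).obj x).n) :
    par hL x a = (fpos hL x ⟨a, ha⟩).1 := dif_pos ha

theorem label_of_lt (u : Fam L (Z × Label)) {a : ℕ} (ha : a < u.n) :
    label u a = (u.el ⟨a, ha⟩).2.n := dif_pos ha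

theorem lv_of_lt {u w : Fam L (Z × Label)} (f : u ⟶ w) {a : ℕ} (ha : a < u.n) (l : Fin w.n)
    (h : Hom.perm f ⟨a, ha⟩ = l) (e : ℕ) : lv f a e = pv (Hom.hom f ⟨a, ha⟩ l h).2 e :=
  lv_val f ⟨a, ha⟩ l h e

section Act

variable (Z) in
/-- The families of a sequence of labelled families. -/
def fams : Fam L (Writer Z × Label) ⥤ Fam L (Writer Z) := map L (CategoryTheory.Prod.fst _ _)

variable (Z) in
/-- Multiply each family by its label, and concatenate. -/
noncomputable def actFlat : Fam L (Writer Z × Label) ⥤ Fam L (Z × Label) :=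
  map L (actF Z) ⋙ flat hL (Z × Label)

variable {u w : Fam L (Writer Z × Label)} (f : u ⟶ w)

theorem actFlat_el (u : Fam L (Writer Z × Label)) {a : ℕ} (h : a < ((actFlat hL Z).obj u).n)
    (ha : a < ((flat hL (Z × Label)).obj ((fams Z).obj u)).n) :
    ((actFlat hL Z).obj u).el ⟨a, h⟩ =
      ((((flat hL (Z × Label)).obj ((fams Z).obj u)).el ⟨a, ha⟩).1,
        mulF.obj ((((flat hL (Z × Label)).obj ((fams Z).obj u)).el ⟨a, ha⟩).2,
          (u.el (fpos hL ((fams Z).obj u) ⟨a, ha⟩).1).2)) := rfl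

theorem label_actFlat (u : Fam L (Writer Z × Label)) {a : ℕ}
    (ha : a < ((flat hL (Z × Label)).obj ((fams Z).obj u)).n) :
    label ((actFlat hL Z).obj u) a =
      label ((flat hL (Z × Label)).obj ((fams Z).obj u)) a *
        label u (par hL ((fams Z).obj u) a) := by
  have h : a < ((actFlat hL Z).obj u).n := ha
  rw [label_of_lt _ h, actFlat_el hL u h ha, par_of_lt hL _ ha, label_of_lt _ ha]
  refine Eq.trans ?_ (congrArg (_ * ·) (label_val u (fpos hL ((fams Z).obj u) ⟨a, ha⟩).1).symm)
  exact mulF_n _ _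

/-- The label of a member is its own label times the label of its family, so `mulF_pv` applies with
the member's label as lower base and the family's label as upper digit. -/
theorem lv_actFlat {a e : ℕ} (ha : a < ((flat hL (Z × Label)).obj ((fams Z).obj u)).n)
    (he : e < label ((actFlat hL Z).obj u) a) :
    lv ((actFlat hL Z).map f) a e =
      lv f (par hL ((fams Z).obj u) a) (e / label ((flat hL (Z × Label)).obj ((fams Z).obj u)) a) *
        label ((flat hL (Z × Label)).obj ((fams Z).obj w))
          (pv ((flat hL (Z × Label)).map ((fams Z).map f)) a) +
      lv ((flat hL (Z × Label)).map ((fams Z).map f)) a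
        (e % label ((flat hL (Z × Label)).obj ((fams Z).obj u)) a) := by
  have h : a < ((actFlat hL Z).obj u).n := ha
  have hp : Hom.perm f (fpos hL ((fams Z).obj u) ⟨a, ha⟩).1 =
      (fpos hL ((fams Z).obj w) (Hom.perm ((flat hL (Z × Label)).map ((fams Z).map f)) ⟨a, ha⟩)).1 :=
    (fpos_perm_fst hL ((fams Z).map f) ⟨a, ha⟩).symm
  have h₁ := lv_val f _ _ hp
  have h₂ := label_val u (fpos hL ((fams Z).obj u) ⟨a, ha⟩).1
  have h₃ := pv_val ((flat hL (Z × Label)).map ((fams Z).map f)) ⟨a, ha⟩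
  rw [label_actFlat hL u ha, par_of_lt hL _ ha, label_of_lt _ ha] at he
  rw [par_of_lt hL _ ha, label_of_lt _ ha, lv_of_lt _ ha _ rfl, lv_of_lt _ h _ rfl]
  refine Eq.trans ?_ (congrArg₂ (fun a b => a * b + _) (h₁ _).symm
    ((congrArg (label _) h₃).trans (label_val _ _)).symm)
  exact mulF_pv _ (he.trans_eq (congrArg (_ * ·) h₂))

end Act

/-- The sequence of sequences of families of `x`, with all labels multiplied. -/
noncomputable def cube (x : Fam L (Writer (Writer Z))) : Fam L (Fam L (Fam L (Z × Label))) :=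
  (map L (map PosLength (actF Z ⋙ incl hL (Z × Label)) ⋙ incl hL (Fam L (Z × Label)))).obj x

variable (Z) in
-- Associativity of concatenation: the inner or the outer two levels may be concatenated first. In
-- the second order the middle nodes sit in one sequence, and the labels can be read off member by
-- member.
theorem map_writerMul_flat : map L (writerMul Z) ⋙ flat hL (Z × Label) =
    flat hL (Writer Z × Label) ⋙ actFlat hL Z := by
  have h : map L (map PosLength (actF Z ⋙ incl hL (Z × Label)) ⋙ incl hL (Fam L (Z × Label))) ⋙
      flatten L (Fam L (Z × Label)) = flat hL (Writer Z × Label) ⋙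
      map L (actF Z ⋙ incl hL (Z × Label)) := rfl
  have h₁ : map L (writerMul Z) ⋙ flat hL (Z × Label) = map L (map PosLength (actF Z ⋙
      incl hL (Z × Label)) ⋙ incl hL (Fam L (Z × Label))) ⋙ map L (flatten L (Z × Label)) ⋙
      flatten L (Z × Label) := rfl
  rw [h₁, flatten_assoc, ← Functor.assoc, h]
  rfl

variable {x y : Fam L (Writer (Writer Z))}

theorem cube_length (x : Fam L (Writer (Writer Z))) :
    (flattenObj (flattenObj (cube hL x))).n =
      ((flat hL (Z × Label)).obj ((topF hL (Writer Z)).obj x)).n := rfl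

theorem cube_length' (x : Fam L (Writer (Writer Z))) :
    (flattenObj ((map L (flatten L (Z × Label))).obj (cube hL x))).n =
      ((flat hL (Z × Label)).obj ((map L (writerMul Z)).obj x)).n := rfl

theorem length_mul (x : Fam L (Writer (Writer Z))) :
    ((flat hL (Z × Label)).obj ((map L (writerMul Z)).obj x)).n =
      ((flat hL (Z × Label)).obj ((topF hL (Writer Z)).obj x)).n :=
  apply_obj_eq (map_writerMul_flat hL Z) Fam.n x

theorem triple₁_cube (x : Fam L (Writer (Writer Z))) {a : ℕ}
    (h : a < (flattenObj ((map L (flatten L (Z × Label))).obj (cube hL x))).n)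
    (h' : a < ((flat hL (Z × Label)).obj ((map L (writerMul Z)).obj x)).n) :
    ((triple₁ (cube hL x) ⟨a, h⟩).1 : ℕ) =
      (fpos hL ((map L (writerMul Z)).obj x) ⟨a, h'⟩).1 := rfl

/-- A position in the sequence of families of `x`. -/
noncomputable def topPos (x : Fam L (Writer (Writer Z)))
    (k : Fin ((flat hL (Z × Label)).obj ((topF hL (Writer Z)).obj x)).n) :
    Fin ((flat hL (Writer Z × Label)).obj x).n := (fpos hL ((topF hL (Writer Z)).obj x) k).1

theorem triple₂_cube (x : Fam L (Writer (Writer Z))) {a : ℕ}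
    (h : a < (flattenObj (flattenObj (cube hL x))).n)
    (h' : a < ((flat hL (Z × Label)).obj ((topF hL (Writer Z)).obj x)).n) :
    ((triple₂ (cube hL x) ⟨a, h⟩).1 : ℕ) = (fpos hL x (topPos hL x ⟨a, h'⟩)).1 := rfl

theorem par_topPos (x : Fam L (Writer (Writer Z))) {a : ℕ}
    (ha : a < ((flat hL (Z × Label)).obj ((topF hL (Writer Z)).obj x)).n) :
    par hL ((topF hL (Writer Z)).obj x) a = topPos hL x ⟨a, ha⟩ := dif_pos ha

/-- Both sides are the outermost coordinate of the triple at position `a`, computed through the two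
orders of concatenation that `triple_eq` compares. -/
theorem par_par_cube (x : Fam L (Writer (Writer Z))) {a : ℕ}
    (ha : a < ((flat hL (Z × Label)).obj ((topF hL (Writer Z)).obj x)).n) :
    par hL ((map L (writerMul Z)).obj x) a = par hL x (par hL ((topF hL (Writer Z)).obj x) a) := by
  have h₀ := ha.trans_eq (length_mul hL x).symm
  have h₁ := ha.trans_eq (cube_length hL x).symm
  have h₂ := h₀.trans_eq (cube_length' hL x).symm
  rw [par_of_lt hL _ h₀, par_topPos hL x ha, par_val, ← triple₁_cube hL x h₂,
    ← triple₂_cube hL x h₁, triple_eq _ _ ⟨a, h₁⟩ rfl]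

/-- The label of a member of the multiplied family. -/
theorem label_mul (x : Fam L (Writer (Writer Z))) {a : ℕ}
    (ha : a < ((flat hL (Z × Label)).obj ((topF hL (Writer Z)).obj x)).n) :
    label ((flat hL (Z × Label)).obj ((map L (writerMul Z)).obj x)) a =
      label ((flat hL (Z × Label)).obj ((topF hL (Writer Z)).obj x)) a *
        label ((flat hL (Writer Z × Label)).obj x) (par hL ((topF hL (Writer Z)).obj x) a) :=
  (congrFun (apply_obj_eq (map_writerMul_flat hL Z) label x) a).trans (label_actFlat hL _ ha)

theorem lv_mul (f : x ⟶ y) {a e : ℕ}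
    (ha : a < ((flat hL (Z × Label)).obj ((topF hL (Writer Z)).obj x)).n)
    (he : e < label ((flat hL (Z × Label)).obj ((map L (writerMul Z)).obj x)) a) :
    lv ((flat hL (Z × Label)).map ((map L (writerMul Z)).map f)) a e =
      lv ((flat hL (Writer Z × Label)).map f) (par hL ((topF hL (Writer Z)).obj x) a)
        (e / label ((flat hL (Z × Label)).obj ((topF hL (Writer Z)).obj x)) a) *
        label ((flat hL (Z × Label)).obj ((topF hL (Writer Z)).obj y))
          (pv ((flat hL (Z × Label)).map ((topF hL (Writer Z)).map f)) a) +
      lv ((flat hL (Z × Label)).map ((topF hL (Writer Z)).map f)) a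
        (e % label ((flat hL (Z × Label)).obj ((topF hL (Writer Z)).obj x)) a) :=
  (congrFun (congrFun (apply_map_eq (map_writerMul_flat hL Z) lv f) a) e).trans
    (lv_actFlat hL ((flat hL (Writer Z × Label)).map f) ha (he.trans_eq
      (congrFun (apply_obj_eq (map_writerMul_flat hL Z) label x) a)))

end Writers

section Model

variable {L : ℕ → Prop} [SeqClosed L] (hL : ∀ n, PosLength n → L n)
  (Z : Type 1) [Groupoid.{0} Z] (T : Writer Z ⥤ Z)

/-- The numerical data of sequences of families of objects of the point. -/
noncomputable def pyrModel : PyrModel L (map L T) (topF hL Z) (map L (writerMap (Writer Z) T))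
    (map L (writerMul Z)) (topF hL (Writer Z)) where
  -- The faces `map L T` and `map L (writerMap _ T)` alter the innermost entries, but no lengths,
  -- outer permutations or labels. The laws that involve them thus refer to unchanged numbers.
  N x := x.n
  p f := pv f
  par x := par hL x
  K x := label ((flat hL _).obj x)
  q f := lv ((flat hL _).map f)
  mem x := x.len
  p_lt f _ := pv_lt f
  p_id x _ := pv_id x
  p_comp f g _ := pv_comp f g
  par_lt x _ := par_lt hL x
  par_surj x _ := par_surj hL x
  K_pos _ _ := label_pos _
  q_lt _ _ _ := lv_lt _
  q_id x _ _ ha he := (congrArg (fun f => lv f _ _) ((flat hL _).map_id x)).trans (lv_id _ ha he)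
  q_comp f g _ _ ha he :=
    (congrArg (fun f => lv f _ _) ((flat hL _).map_comp f g)).trans (lv_comp _ _ ha he)
  par_p f _ := par_pv hL f
  par_par x _ := par_par_cube hL x
  K_mul x _ := label_mul hL x
  q_mul f _ _ := lv_mul hL f

end Model

end Fam

end Plethysm

namespace Plethysm
universe v u

/-! ### The bar construction of T(Sym) in terms of labelled families -/

section SymBar

open MonObj Simplicial Fam

/-- The source map of the terminal operad is the identity, so x · y consists of copies of x placed
at the members of y and then concatenated. -/
theorem sym_diag_labels : Sym.{0, 1}.diag ≫ Sym.{0, 1}.labels Sym.{0, 1}.Q =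
    Sr.const Sym.{0, 1}.Q := by
  have h := Sym.{0, 1}.lift_diag_labels (fst _ _) (snd _ _)
  rw [lift_fst_snd, Category.id_comp] at h
  refine h.trans ?_
  have h₁ : snd Sym.{0, 1}.Q Sym.{0, 1}.Q ≫ Sym.{0, 1}.s = snd _ _ := Category.comp_id _
  rw [h₁]
  exact (congrArg (· ≫ _) lift_fst_snd).trans (Category.id_comp _)

/-- The multiplication of the monoid of operations of `Sym` is the product of labels. -/
theorem sym_mul : (μ[Sym.{0, 1}.toMon.X] : Label × Label ⥤ Label) = mulF := by
  have h : μ[Sym.{0, 1}.toMon.X] = (Sym.{0, 1}.diag ≫ Sym.{0, 1}.labels Sym.{0, 1}.Q) ≫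
    Sr.μ.app (𝟙_ Grpd.{0, 1}) := rfl
  rw [h, sym_diag_labels]
  rfl

/-- The monad of the operad `TSym`, in the form `X ↦ S^r (X × S^r 1)`. -/
noncomputable abbrev labelMonad : Monad Grpd.{0, 1} := writerMonad Sr Sym.toMon

theorem writerAct_eq (X : Grpd.{0, 1}) :
    (writerAct Sr Sym.{0, 1}.toMon X : Writer X × Label ⥤ Writer X) = actF X := by
  have h : (writerAct Sr Sym.{0, 1}.toMon X : Writer X × Label ⥤ Writer X) =
      Sr.rstr (X ⊗ Sym.{0, 1}.toMon.X) Sym.{0, 1}.toMon.X ≫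
        Sr.map ((α_ X Sym.{0, 1}.toMon.X Sym.{0, 1}.toMon.X).hom ≫
          X ◁ (show Sym.{0, 1}.toMon.X ⊗ Sym.{0, 1}.toMon.X ⟶ Sym.{0, 1}.toMon.X from mulF)) :=
    congrArg (fun m => Sr.rstr (X ⊗ Sym.{0, 1}.toMon.X) Sym.{0, 1}.toMon.X ≫
      Sr.map ((α_ X Sym.{0, 1}.toMon.X Sym.{0, 1}.toMon.X).hom ≫ X ◁ m)) sym_mul
  rw [h]
  rfl

theorem labelMonad_μ (X : Grpd.{0, 1}) :
    (labelMonad.μ.app X : Writer (Writer X) ⥤ Writer X) = writerMul X := by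
  have h : (labelMonad.μ.app X : Writer (Writer X) ⥤ Writer X) =
    Fam.map PosLength (writerAct Sr Sym.{0, 1}.toMon X : Writer X × Label ⥤ Writer X) ⋙
      flatten PosLength _ := rfl
  rw [h, writerAct_eq]
  rfl

variable {L : ℕ → Prop} [SeqClosed L] (hL : ∀ n, PosLength n → L n)

noncomputable def symHom : TSym.{0, 1}.monad ⟶ (famMonad.{0, 1} L).toMonad :=
  (show TSym.{0, 1}.monad ⟶ Sr.toMonad from TSym.{0, 1}.toP) ≫ famIncl hL

noncomputable def labelHom : labelMonad ⟶ (famMonad.{0, 1} L).toMonad :=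
  (show labelMonad ⟶ TSym.{0, 1}.monad from writerMonadHom Sr Sym.toMon) ≫ symHom hL

theorem labelHom_app (X : Grpd.{0, 1}) : ((labelHom hL).app X : Writer X ⥤ Fam L X) =
    Fam.map PosLength (CategoryTheory.Prod.fst X Label) ⋙ incl hL X := by
  have h := writerHom_labels Sr Sym.{0, 1}.toMon X
  have h₁ := congrArg (fun f => f ≫ (famIncl.{0, 1} hL).app X) h
  exact h₁

/-- The bar construction of `TSym`, with the monad `labelMonad`. -/
noncomputable abbrev labelBar : SimplicialObject Grpd.{0, 1} := bar (labelHom hL)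

/-- `labelMonad` applied `n` times to the point. -/
noncomputable abbrev Nested (n : ℕ) : Grpd.{0, 1} := iter (E := Grpd.{0, 1}) labelMonad n

/-- The action of the monad on sequences forgets the labels and concatenates. Forgetting may be done
after concatenating, which is the form of `topF`. -/
theorem labelBar_top (n : ℕ) :
    ((labelBar hL).δ (Fin.last (n + 1)) : Fam L (Writer (Nested n)) ⥤ Fam L (Nested n)) =
      topF hL (Nested n) := by
  refine (bar_δ_last (labelHom hL) n).trans ?_
  have h : (top (labelHom hL) n : Fam L (Writer (Nested n)) ⥤ Fam L (Nested n)) =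
      Fam.map L ((labelHom hL).app (Nested n) : Writer (Nested n) ⥤ Fam L (Nested n)) ⋙
        flatten L _ := rfl
  rw [h, labelHom_app]
  rfl

/-- The projection to the point. -/
noncomputable def toPt : Writer (Nested 0) ⥤ Nested 0 := iterC (E := Grpd.{0, 1}) labelMonad

/-- Change the faces of a model to equal ones. -/
def PyrModel.copy {X₀ X₁ X₂ : Type*} [Category* X₀] [Category* X₁] [Category* X₂]
    {d₀ d₁ d₀' d₁' : X₁ ⥤ X₀} {e₀ e₁ e₂ e₀' e₁' e₂' : X₂ ⥤ X₁} (M : PyrModel L d₀ d₁ e₀ e₁ e₂)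
    (h₀ : d₀' = d₀) (h₁ : d₁' = d₁) (h₂ : e₀' = e₀) (h₃ : e₁' = e₁) (h₄ : e₂' = e₂) :
    PyrModel L d₀' d₁' e₀' e₁' e₂' where
  N := M.N
  p := M.p
  par := M.par
  K := M.K
  q := M.q
  mem := M.mem
  p_lt := M.p_lt
  p_id := M.p_id
  p_comp := M.p_comp
  par_lt := by subst h₀ h₁; exact M.par_lt
  par_surj := by subst h₀ h₁; exact M.par_surj
  K_pos := by subst h₁; exact M.K_pos
  q_lt := by subst h₁; exact M.q_lt
  q_id := by subst h₁; exact M.q_id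
  q_comp := by subst h₁; exact M.q_comp
  par_p := by subst h₀ h₁; exact M.par_p
  par_par := by subst h₁ h₂ h₃ h₄; exact M.par_par
  K_mul := by subst h₁ h₂ h₃ h₄; exact M.K_mul
  q_mul := by subst h₁ h₂ h₃ h₄; exact M.q_mul

/-- The numerical data of the simplices of the bar construction. -/
noncomputable def symModel : PyrModel L
    ((labelBar hL).δ 0 : (labelBar hL) _⦋1⦌ ⥤ (labelBar hL) _⦋0⦌)
    ((labelBar hL).δ 1 : (labelBar hL) _⦋1⦌ ⥤ (labelBar hL) _⦋0⦌)
    ((labelBar hL).δ 0 : (labelBar hL) _⦋2⦌ ⥤ (labelBar hL) _⦋1⦌)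
    ((labelBar hL).δ 1 : (labelBar hL) _⦋2⦌ ⥤ (labelBar hL) _⦋1⦌)
    ((labelBar hL).δ 2 : (labelBar hL) _⦋2⦌ ⥤ (labelBar hL) _⦋1⦌) :=
  PyrModel.copy (pyrModel hL (Nested 0) toPt)
    (bar_δ (labelHom hL) 0 0 le_rfl) (labelBar_top hL 0)
    (bar_δ (labelHom hL) 1 0 (Nat.zero_le _))
    ((bar_δ (labelHom hL) 1 1 le_rfl).trans
      (congrArg (fun F => Fam.map L F) (labelMonad_μ (Nested 0))))
    (labelBar_top hL 1)

end SymBar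

end Plethysm

namespace Plethysm
universe v u

/-! ### Codes of the last vertex, the last edge and the top face -/

section Restrictions

open Simplicial Opposite Fam

variable {E : Type u} [Category.{v} E] [CartesianMonoidalCategory E] {M R : Monad E} (χ : M ⟶ R)

/-- Restriction to the last vertex projects `M^n 𝟙` to the point. -/
theorem bar_map_last_vertex (n : ℕ) : ∃ a : iter M n ⟶ iter M 0,
    (bar χ).map (vertexMap (Δ := ⦋n⦌) (Fin.last n)).op = R.map a := by
  refine ⟨_, barMap_of_le χ (le_of_eq ?_)⟩
  refine edge_eq_of _ (Nat.zero_le _) fun i => ?_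
  change n < n ↔ _
  simp

/-- Restriction to the last edge projects `M^n 𝟙` to the point. -/
theorem bar_map_last_edge (n : ℕ) : ∃ a : iter M n ⟶ iter M 0,
    (bar χ).map (edgeMap (Δ := ⦋n + 1⦌) (Pyr.rim (Fin.last n))).op = R.map (iterMap M a) := by
  -- The last edge has the vertices n and n+1: one of them is below n+1 and none is below n. Hence
  -- the outermost copy of `M` is kept and all the inner copies are projected to the point.
  have h₁ : edge (edgeMap (Δ := ⦋n + 1⦌) (Pyr.rim (Fin.last n))).toOrderHom (n + 1) = 1 := by
    refine edge_eq_of _ (by simp) fun i => ?_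
    fin_cases i
    · change n < n + 1 ↔ _
      simp
    · change n + 1 < n + 1 ↔ _
      simp
  have h₂ : edge (edgeMap (Δ := ⦋n + 1⦌) (Pyr.rim (Fin.last n))).toOrderHom n = 0 := by
    refine edge_eq_of _ (by simp) fun i => ?_
    fin_cases i
    · change n < n ↔ _
      simp
    · change n + 1 < n ↔ _
      simp
  refine ⟨act M n 0 (edge (edgeMap (Δ := ⦋n + 1⦌) (Pyr.rim (Fin.last n))).toOrderHom),
    (barMap_of_le χ h₁.le).trans (congrArg (fun f => R.map f) ?_)⟩
  change act M (n + 1) (0 + 1) _ = _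
  rw [act_of_lt M (h₁.symm ▸ Nat.zero_lt_one), act_of_le M h₂.le, iterMap_comp, Category.assoc,
    iterMap_iterη, Category.comp_id]

variable {L : ℕ → Prop} [SeqClosed L] (hL : ∀ n, PosLength n → L n)

/-- The objects of `labelBar` of a given dimension. -/
abbrev Simp (L : ℕ → Prop) (n : ℕ) : Type 1 := Fam L (Nested n)

/-- The code of an iterated sequence. -/
noncomputable def codeOf {n : ℕ} (x : Simp L n) : PyrCode L n :=
  (symModel hL).code (Δ := ⦋n⦌) x

noncomputable def codeMap {n : ℕ} {x y : Simp L n} (f : x ⟶ y) :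
    PyrCode.Hom (codeOf hL x) (codeOf hL y) :=
  (symModel hL).codeHom (Δ := ⦋n⦌) f

variable {n : ℕ}

/-- Restriction to the last vertex applies a functor to every entry, which keeps the length. The
same reason lets the permutation, the parent map and the labels of the outermost level be read off
directly in the lemmas below. -/
theorem codeOf_N_last (x : Simp L n) : (codeOf hL x).N (Fin.last n) = x.n := by
  obtain ⟨a, h⟩ := bar_map_last_vertex (labelHom hL) n
  exact apply_obj_eq h (symModel hL).N x

theorem codeMap_p_last {x y : Simp L n} (f : x ⟶ y) : (codeMap hL f).p (Fin.last n) = pv f := by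
  obtain ⟨a, h⟩ := bar_map_last_vertex (labelHom hL) n
  exact apply_map_eq h (symModel hL).p f

theorem codeOf_anc_rim (x : Fam L (Writer (Nested n))) :
    (codeOf (n := n + 1) hL x).anc (Pyr.rim (Fin.last n)) = par hL x := by
  obtain ⟨a, h⟩ := bar_map_last_edge (labelHom hL) n
  exact apply_obj_eq h (symModel hL).par x

theorem codeOf_K_rim (x : Fam L (Writer (Nested n))) :
    (codeOf (n := n + 1) hL x).K (Pyr.rim (Fin.last n)) =
      label ((flat hL (Nested n × Label)).obj x) := by
  obtain ⟨a, h⟩ := bar_map_last_edge (labelHom hL) n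
  exact apply_obj_eq h (symModel hL).K x

theorem codeMap_q_rim {x y : Fam L (Writer (Nested n))} (f : x ⟶ y) :
    (codeMap (n := n + 1) hL f).q (Pyr.rim (Fin.last n)) =
      lv ((flat hL (Nested n × Label)).map f) := by
  obtain ⟨a, h⟩ := bar_map_last_edge (labelHom hL) n
  exact apply_map_eq h (symModel hL).q f

theorem δ_last_toOrderHom (n : ℕ) :
    (SimplexCategory.δ (Fin.last (n + 1)) : ⦋n⦌ ⟶ ⦋n + 1⦌).toOrderHom = castSuccHom n :=
  OrderHom.ext _ _ (funext fun i => Fin.succAbove_last_apply i)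

/-- This drives the induction on n: omitting the last vertex corresponds to the action of the monad,
so the base of the pyramid of `x` is the pyramid of the forest `topF x` of smaller height. -/
theorem codeOf_top (x : Fam L (Writer (Nested n))) :
    codeOf (n := n) hL ((topF hL (Nested n)).obj x) =
      (codeOf (n := n + 1) hL x).restrict (castSuccHom n) := by
  have h := (symModel hL).code_map (Δ := ⦋n + 1⦌) (SimplexCategory.δ (Fin.last (n + 1))) x
  rw [δ_last_toOrderHom] at h
  exact (apply_obj_eq (labelBar_top hL n) (codeOf hL) x).symm.trans h

theorem δ_last_base (s : Pyr n) : (pyrMap (SimplexCategory.δ (Fin.last (n + 1)) :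
    ⦋n⦌ ⟶ ⦋n + 1⦌).toOrderHom).obj s = Pyr.base s := by
  rw [δ_last_toOrderHom]
  rfl

variable {x y : Fam L (Writer (Nested n))} (f : x ⟶ y)

theorem codeMap_top_p (i : Fin (n + 1)) :
    (codeMap (n := n) hL ((topF hL (Nested n)).map f)).p i =
      (codeMap (n := n + 1) hL f).p i.castSucc := by
  have h := (symModel hL).codeHom_map_p (Δ := ⦋n + 1⦌) (SimplexCategory.δ (Fin.last (n + 1))) f i
  have e : (SimplexCategory.δ (Fin.last (n + 1)) : ⦋n⦌ ⟶ ⦋n + 1⦌).toOrderHom i = i.castSucc :=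
    Fin.succAbove_last_apply i
  rw [e] at h
  exact (apply_map_eq (labelBar_top hL n) (fun g => (codeMap hL g).p i) f).symm.trans h

theorem codeMap_top_q (s : Pyr n) :
    (codeMap (n := n) hL ((topF hL (Nested n)).map f)).q s =
      (codeMap (n := n + 1) hL f).q (Pyr.base s) := by
  have h := (symModel hL).codeHom_map_q (Δ := ⦋n + 1⦌) (SimplexCategory.δ (Fin.last (n + 1))) f s
  rw [δ_last_base] at h
  exact (apply_map_eq (labelBar_top hL n) (fun g => (codeMap hL g).q s) f).symm.trans h

theorem codeMap_top_app (s : Pyr n) (v : ℕ × ℕ) :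
    (codeMap (n := n) hL ((topF hL (Nested n)).map f)).app s v =
      (codeMap (n := n + 1) hL f).app (Pyr.base s) v := by
  rw [PyrCode.Hom.app, PyrCode.Hom.app, codeMap_top_p, codeMap_top_q]
  rfl

end Restrictions

end Plethysm

namespace Plethysm
universe v u

namespace Fam

/-! ### Reconstruction of nested sequences and their morphisms from concatenations -/

section Unflatten

variable {L : ℕ → Prop} [SeqClosed L] {A : Type u} [Groupoid.{v} A]

theorem sigmaPerm_mk {X Y : Fam L (Fam L A)} (φ : X ⟶ Y) {i : Fin X.n} {j : Fin Y.n}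
    (h : Hom.perm φ i = j) (r : Fin (X.el i).n) :
    sigmaPerm φ ⟨i, r⟩ = ⟨j, Hom.perm (Hom.hom φ i j h) r⟩ :=
  (sigmaPerm_eq_iff φ _ _).2 ⟨h, rfl⟩

theorem sigmaPerm_congr {X Y : Fam L (Fam L A)} {φ ψ : X ⟶ Y} (h : flattenMap φ = flattenMap ψ)
    (s : Σ i, Fin (X.el i).n) : sigmaPerm φ s = sigmaPerm ψ s := by
  obtain ⟨k, rfl⟩ := (pos X).surjective s
  rw [← pos_flattenMap, ← pos_flattenMap, h]

theorem sigmaHom_congr {X Y : Fam L (Fam L A)} {φ ψ : X ⟶ Y} (h : flattenMap φ = flattenMap ψ)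
    (s : Σ i, Fin (X.el i).n) (t : Σ j, Fin (Y.el j).n) (h₁ : sigmaPerm φ s = t)
    (h₂ : sigmaPerm ψ s = t) : sigmaHom φ s t h₁ = sigmaHom ψ s t h₂ := by
  obtain ⟨k, rfl⟩ := (pos X).surjective s
  obtain ⟨l, rfl⟩ := (pos Y).surjective t
  refine hom_congr h k l ?_ ?_
  · exact (pos Y).injective ((pos_flattenMap φ k).trans h₁)
  · exact (pos Y).injective ((pos_flattenMap ψ k).trans h₂)

/-- A morphism of sequences of sequences is determined by its outer permutation and by the morphism
of concatenations. -/
theorem flattenMap_injective {X Y : Fam L (Fam L A)} {φ ψ : X ⟶ Y}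
    (hp : ∀ i, Hom.perm φ i = Hom.perm ψ i) (h : flattenMap φ = flattenMap ψ) : φ = ψ :=
  Hom.ext' hp fun i j h₁ h₂ => Hom.ext'
    (fun r => by
      have h₃ := sigmaPerm_congr h ⟨i, r⟩
      rw [sigmaPerm_mk φ h₁, sigmaPerm_mk ψ h₂] at h₃
      exact eq_of_heq (Sigma.mk.inj_iff.1 h₃).2)
    fun r s h₃ h₄ => sigmaHom_congr h ⟨i, r⟩ ⟨j, s⟩ ((sigmaPerm_eq_iff _ _ _).2 ⟨h₁, h₃⟩)
      ((sigmaPerm_eq_iff _ _ _).2 ⟨h₂, h₄⟩)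

/-- Data indexed by positions of a concatenation are re-indexed by pairs (block, place) along `pos`;
the stated equation hides the casts. -/
theorem exists_extend {α β : Sort*} (e : α ≃ β) {P : β → Sort*} (g : ∀ a, P (e a)) :
    ∃ f : ∀ b, P b, ∀ a, f (e a) = g a :=
  ⟨Equiv.piCongrLeft P e g, fun a => Equiv.piCongrLeft_apply_apply P e g a⟩

/-- An equivalence of total spaces over an equivalence of bases restricts to equivalences of
fibres. -/
theorem exists_fibreEquiv {α β : Type*} {P : α → Type*} {Q : β → Type*}
    (Φ : (Σ a, P a) ≃ Σ b, Q b) (π : α ≃ β) (hΦ : ∀ s, (Φ s).1 = π s.1) :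
    ∃ q : ∀ i j, π i = j → (P i ≃ Q j), ∀ i j h r, Φ ⟨i, r⟩ = ⟨j, q i j h r⟩ := by
  have hfib : ∀ i j, π i = j → ∀ r, ∃ s, Φ ⟨i, r⟩ = ⟨j, s⟩ := fun i j hij r => by
    have h₁ := (hΦ ⟨i, r⟩).trans hij
    generalize Φ ⟨i, r⟩ = t at h₁
    obtain ⟨j', s⟩ := t
    dsimp only at h₁
    subst h₁
    exact ⟨s, rfl⟩
  choose fib fib_spec using hfib
  have hbij : ∀ i j hij, Function.Bijective (fib i j hij) := fun i j hij => by
    constructor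
    · intro r r' e
      have h₁ := (fib_spec i j hij r).trans (e ▸ (fib_spec i j hij r').symm)
      exact eq_of_heq (Sigma.mk.inj_iff.1 (Φ.injective h₁)).2
    · intro s
      have h₁ := hΦ (Φ.symm ⟨j, s⟩)
      have h₂ := Φ.apply_symm_apply ⟨j, s⟩
      generalize Φ.symm ⟨j, s⟩ = t at h₁ h₂
      rw [h₂] at h₁
      obtain ⟨i', r⟩ := t
      have h₃ : i' = i := π.injective (h₁.symm.trans hij.symm)
      subst h₃
      refine ⟨r, ?_⟩
      have h₄ := (fib_spec i' j hij r).symm.trans h₂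
      exact eq_of_heq (Sigma.mk.inj_iff.1 h₄).2
  exact ⟨fun i j hij => Equiv.ofBijective _ (hbij i j hij), fib_spec⟩

/-- A morphism of concatenations which is compatible with an outer permutation comes from a
morphism of sequences of sequences. -/
theorem exists_flattenMap {X Y : Fam L (Fam L A)} (φ : flattenObj X ⟶ flattenObj Y)
    (π : Fin X.n ≃ Fin Y.n) (h : ∀ k, (pos Y (Hom.perm φ k)).1 = π (pos X k).1) :
    ∃ f : X ⟶ Y, (∀ i, Hom.perm f i = π i) ∧ flattenMap f = φ := by
  let Φ : (Σ i, Fin (X.el i).n) ≃ Σ j, Fin (Y.el j).n :=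
    (pos X).symm.trans ((Hom.perm φ).trans (pos Y))
  have hpos : ∀ k, Φ (pos X k) = pos Y (Hom.perm φ k) := fun k =>
    congrArg (fun k => pos Y (Hom.perm φ k)) ((pos X).symm_apply_apply k)
  have hΦ : ∀ s, (Φ s).1 = π s.1 := fun s => by
    obtain ⟨k, rfl⟩ := (pos X).surjective s
    rw [hpos, h]
  obtain ⟨fib, fib_spec⟩ := exists_fibreEquiv Φ π hΦ
  -- The components of `φ` are re-indexed by pairs first in the target and then, with `G`, in the
  -- source.
  have hhom : ∀ k, ∃ g : ∀ t : Σ j, Fin (Y.el j).n, Φ (pos X k) = t →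
      ((X.el (pos X k).1).el (pos X k).2 ⟶ (Y.el t.1).el t.2),
      ∀ l h', g (pos Y l) h' = Hom.hom φ k l ((pos Y).injective ((hpos k).symm.trans h')) := by
    intro k
    obtain ⟨g, hg⟩ := exists_extend (pos Y) (P := fun t => Φ (pos X k) = t →
      ((X.el (pos X k).1).el (pos X k).2 ⟶ (Y.el t.1).el t.2))
      fun l h' => Hom.hom φ k l ((pos Y).injective ((hpos k).symm.trans h'))
    exact ⟨g, fun l h' => congrFun (hg l) h'⟩
  choose g hg using hhom
  obtain ⟨G, hG⟩ := exists_extend (pos X) (P := fun s => ∀ t : Σ j, Fin (Y.el j).n, Φ s = t →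
      ((X.el s.1).el s.2 ⟶ (Y.el t.1).el t.2)) g
  let f : X ⟶ Y := ⟨π, fun i j hij => ⟨fib i j hij, fun r s hrs =>
    G ⟨i, r⟩ ⟨j, s⟩ ((fib_spec i j hij r).trans (congrArg (Sigma.mk j) hrs))⟩⟩
  have hf : ∀ s, sigmaPerm f s = Φ s := fun s => (fib_spec s.1 _ rfl s.2).symm
  refine ⟨f, fun i => rfl, Hom.ext' (fun k => (pos Y).injective ?_) fun k l h₁ h₂ => ?_⟩
  · exact (pos_flattenMap f k).trans ((hf _).trans (hpos k))
  · have h₃ : Φ (pos X k) = pos Y l := (hpos k).trans (congrArg _ h₂)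
    refine Eq.trans (b := G (pos X k) (pos Y l) h₃) rfl ?_
    rw [hG, hg]

variable (hL : ∀ n, PosLength n → L n)

theorem flat_map_injective {x y : Fam L (Fam PosLength A)} {f g : x ⟶ y}
    (hp : ∀ i, Hom.perm f i = Hom.perm g i) (h : (flat hL A).map f = (flat hL A).map g) :
    f = g := by
  have h₁ : (inclMap hL A).map f = (inclMap hL A).map g :=
    flattenMap_injective (φ := (inclMap hL A).map f) (ψ := (inclMap hL A).map g) hp h
  refine Hom.ext' hp fun i j hi hj => ?_
  have h₂ := hom_congr h₁ i j hi hj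
  exact Hom.ext' (fun r => congrArg (fun φ : ((inclMap hL A).obj x).el i ⟶
    ((inclMap hL A).obj y).el j => Hom.perm φ r) h₂)
    fun r s hr hs => hom_congr h₂ r s hr hs

/-- Regarding the inner sequences as `L`-sequences changes only the proof about their lengths, so
the morphism found there has the same data. -/
theorem exists_flat_map {x y : Fam L (Fam PosLength A)}
    (φ : (flat hL A).obj x ⟶ (flat hL A).obj y) (π : Fin x.n ≃ Fin y.n)
    (h : ∀ k, (fpos hL y (Hom.perm φ k)).1 = π (fpos hL x k).1) :
    ∃ f : x ⟶ y, (∀ i, Hom.perm f i = π i) ∧ (flat hL A).map f = φ := by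
  obtain ⟨f, h₁, h₂⟩ := exists_flattenMap (X := (inclMap hL A).obj x) (Y := (inclMap hL A).obj y)
    φ π h
  exact ⟨⟨f.perm, fun i j h => ⟨(f.hom i j h).perm, (f.hom i j h).hom⟩⟩, h₁, h₂⟩

end Unflatten

section Labelled

variable {L : ℕ → Prop} [SeqClosed L] {Z : Type 1} [Groupoid.{0} Z] {u w : Fam L (Z × Label)}

/-- The point has a single morphism, so a morphism of labels is a bare permutation, and `lv` records
all its values. -/
theorem labelled_hom_ext {φ ψ : u ⟶ w}
    (h : (map L (CategoryTheory.Prod.fst Z Label)).map φ =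
      (map L (CategoryTheory.Prod.fst Z Label)).map ψ)
    (h' : ∀ a < u.n, ∀ e < label u a, lv φ a e = lv ψ a e) : φ = ψ := by
  have hp : ∀ i, Hom.perm φ i = Hom.perm ψ i := fun i =>
    congrArg (fun f : (map L (CategoryTheory.Prod.fst Z Label)).obj u ⟶
      (map L (CategoryTheory.Prod.fst Z Label)).obj w => Hom.perm f i) h
  refine Hom.ext' hp fun i j hi hj => Prod.ext (hom_congr h i j hi hj) ?_
  refine Hom.ext' (fun r => Fin.ext ?_) fun _ _ _ _ => rfl
  have h₁ := h' i i.2 r (r.2.trans_eq (label_val u i).symm)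
  rw [lv_val φ i j hi, lv_val ψ i j hj] at h₁
  exact (pv_val _ r).symm.trans (h₁.trans (pv_val _ r))

theorem exists_labelled_hom
    (g : (map L (CategoryTheory.Prod.fst Z Label)).obj u ⟶
      (map L (CategoryTheory.Prod.fst Z Label)).obj w)
    (q : ∀ (i : Fin u.n) (j : Fin w.n), Hom.perm g i = j → Fin (u.el i).2.n ≃ Fin (w.el j).2.n) :
    ∃ φ : u ⟶ w, (map L (CategoryTheory.Prod.fst Z Label)).map φ = g ∧
      ∀ i j h r, lv φ (i : Fin u.n) (r : Fin (u.el i).2.n) = (q i j h r : ℕ) := by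
  let φ : u ⟶ w := ⟨g.perm, fun i j h => (g.hom i j h, ⟨q i j h, fun _ _ _ => PUnit.unit⟩)⟩
  refine ⟨φ, rfl, fun i j h r => ?_⟩
  rw [lv_val φ i j h]
  exact pv_val _ r

variable (hL : ∀ n, PosLength n → L n)

/-- A morphism of sequences of families is determined by its outer permutation, its underlying
morphism without labels, and its effect on labels. -/
theorem families_hom_ext {x y : Fam L (Writer Z)} {f g : x ⟶ y}
    (h₁ : (topF hL Z).map f = (topF hL Z).map g) (h₂ : ∀ a < x.n, pv f a = pv g a)
    (h₃ : ∀ a < ((flat hL (Z × Label)).obj x).n, ∀ e < label ((flat hL (Z × Label)).obj x) a,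
      lv ((flat hL (Z × Label)).map f) a e = lv ((flat hL (Z × Label)).map g) a e) : f = g := by
  refine flat_map_injective hL (fun i => Fin.ext ?_) (labelled_hom_ext h₁ h₃)
  rw [← pv_val, ← pv_val, h₂ i i.2]

/-- Sequences of families with prescribed concatenation, outer structure and labels. -/
theorem exists_families (x₁ : Fam L Z) {m : ℕ} (hm : L m) (u : Fin x₁.n → Fin m)
    (hu : Function.Surjective u) (l : Fin x₁.n → ℕ) (hl : ∀ k, 0 < l k) :
    ∃ (x : Fam L (Writer Z)) (g : (topF hL Z).obj x ⟶ x₁), x.n = m ∧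
      ∀ a : Fin ((flat hL (Z × Label)).obj x).n, par hL x a = u (Hom.perm g a) ∧
        (((flat hL (Z × Label)).obj x).el a).2.n = l (Hom.perm g a) := by
  -- The `b`-th family consists of the entries over `b`, listed in an arbitrary order; it is
  -- nonempty since `u` is surjective.
  let ε : ∀ b, Fin (Fintype.card {k // u k = b}) ≃ {k // u k = b} :=
    fun b => (Fintype.equivFin _).symm
  let x : Fam L (Writer Z) := ⟨m, hm, fun b => ⟨Fintype.card {k // u k = b},
    Fintype.card_pos_iff.2 ((hu b).elim fun k hk => ⟨⟨k, hk⟩⟩),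
    fun c => (x₁.el (ε b c).1, ⟨l (ε b c).1, hl _, fun _ => ⟨⟩⟩)⟩⟩
  -- Concatenating the fibres lists the entries of `x₁` in another order; `τ` is the resulting
  -- permutation and underlies `g`.
  let τ : Fin ((topF hL Z).obj x).n ≃ Fin x₁.n :=
    (fpos hL x).trans ((Equiv.sigmaCongrRight ε).trans (Equiv.sigmaFiberEquiv u))
  have hel : ∀ a, ((topF hL Z).obj x).el a = x₁.el (τ a) := fun _ => rfl
  refine ⟨x, ⟨τ, fun a k h => eqToHom ((hel a).trans (congrArg x₁.el h))⟩, rfl, fun a => ⟨?_, rfl⟩⟩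
  rw [par_val]
  exact congrArg Fin.val (ε (fpos hL x a).1 (fpos hL x a).2).2.symm

end Labelled

end Fam

end Plethysm

namespace Plethysm
universe v u

/-! ### Faithfulness in every degree -/

section Faithful

open Simplicial Opposite Fam

theorem PyrCode.mem_diag {L : ℕ → Prop} {n : ℕ} (c : PyrCode L n) (i : Fin (n + 1)) (v : ℕ × ℕ) :
    v ∈ c.carrier ⟨i, i, le_rfl⟩ ↔ v.1 < c.N i ∧ v.2 = 0 := by
  refine and_congr_right fun h => ?_
  rw [c.K_self i h, Nat.lt_one_iff]

variable {L : ℕ → Prop} [SeqClosed L] (hL : ∀ n, PosLength n → L n) {C : Type → Prop}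
  (hC : ∀ T, C T ↔ Finite T ∧ L (Nat.card T)) {n : ℕ}

/-- The pyramid of an iterated sequence. -/
noncomputable def pyrOf (n : ℕ) : Simp L n ⥤ Pyramid C n :=
  (symModel hL).pyramidFunctor hL hC ⦋n⦌

theorem pyrOf_map_val {x y : Simp L n} (f : x ⟶ y) (s : Pyr n)
    (v : (codeOf hL x).diagram.obj s) :
    (((pyrOf hL hC n).map f).hom.app s v).1 = (codeMap hL f).app s v.1 := rfl

theorem pyrOf_map_eq {x y : Simp L n} {f g : x ⟶ y}
    (h : (pyrOf hL hC n).map f = (pyrOf hL hC n).map g) (s : Pyr n) {v : ℕ × ℕ}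
    (hv : v ∈ (codeOf hL x).carrier s) : (codeMap hL f).app s v = (codeMap hL g).app s v :=
  congrArg Subtype.val (congrArg (fun φ => φ.hom.app s ⟨v, hv⟩) h)

theorem codeOf_N_rim (x : Fam L (Writer (Nested n))) :
    (codeOf (n := n + 1) hL x).N (Fin.last n).castSucc =
      ((flat hL (Nested n × Label)).obj x).n :=
  (congrArg (fun c => c.N (Fin.last n)) (codeOf_top hL x)).symm.trans
    (codeOf_N_last hL ((topF hL (Nested n)).obj x))

theorem mem_rim (x : Fam L (Writer (Nested n))) (v : ℕ × ℕ) :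
    v ∈ (codeOf (n := n + 1) hL x).carrier (Pyr.rim (Fin.last n)) ↔
      v.1 < ((flat hL (Nested n × Label)).obj x).n ∧
        v.2 < label ((flat hL (Nested n × Label)).obj x) v.1 := by
  rw [← codeOf_N_rim, ← codeOf_K_rim]
  rfl

/-- The elements of the last set of the diagonal. -/
noncomputable def diagEquiv (x : Simp L n) :
    (codeOf hL x).diagram.obj ⟨Fin.last n, Fin.last n, le_rfl⟩ ≃ Fin x.n where
  toFun v := ⟨v.1.1, v.2.1.trans_eq (codeOf_N_last hL x)⟩
  invFun k := ⟨(k, 0), (PyrCode.mem_diag _ _ _).2 ⟨k.2.trans_eq (codeOf_N_last hL x).symm, rfl⟩⟩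
  left_inv v := Subtype.ext (Prod.ext rfl ((PyrCode.mem_diag _ _ _).1 v.2).2.symm)
  right_inv _ := rfl

/-- The elements of the last set of the rim. -/
noncomputable def rimEquiv (x : Fam L (Writer (Nested n))) :
    (codeOf (n := n + 1) hL x).diagram.obj (Pyr.rim (Fin.last n)) ≃
      Σ k : Fin ((flat hL (Nested n × Label)).obj x).n,
        Fin (((flat hL (Nested n × Label)).obj x).el k).2.n where
  toFun v := ⟨⟨v.1.1, ((mem_rim hL x v.1).1 v.2).1⟩, ⟨v.1.2,
    ((mem_rim hL x v.1).1 v.2).2.trans_eq (label_of_lt _ _)⟩⟩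
  invFun s := ⟨(s.1, s.2), (mem_rim hL x _).2 ⟨s.1.2, s.2.2.trans_eq (label_val _ s.1).symm⟩⟩
  left_inv _ := rfl
  right_inv _ := rfl

theorem codeMap_app_rim {x y : Fam L (Writer (Nested n))} (f : x ⟶ y) (v : ℕ × ℕ) :
    (codeMap (n := n + 1) hL f).app (Pyr.rim (Fin.last n)) v =
      (pv ((topF hL (Nested n)).map f) v.1, lv ((flat hL (Nested n × Label)).map f) v.1 v.2) := by
  refine Prod.ext ?_ ?_
  · exact (congrFun (codeMap_top_p hL f (Fin.last n)) v.1).symm.trans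
      (congrFun (codeMap_p_last hL ((topF hL (Nested n)).map f)) v.1)
  · exact congrFun (congrFun (codeMap_q_rim hL f) v.1) v.2

theorem codeMap_app_diag {x y : Simp L n} (f : x ⟶ y) (v : ℕ × ℕ) :
    ((codeMap hL f).app ⟨Fin.last n, Fin.last n, le_rfl⟩ v).1 = pv f v.1 :=
  congrFun (codeMap_p_last hL f) v.1

/-- A 0-simplex is a sequence of points, whose morphisms are bare permutations, visible on the
single set of the pyramid. -/
theorem pyrOf_faithful_zero : (pyrOf hL hC 0).Faithful where
  map_injective {x y f g} h := Hom.ext' (fun i => Fin.ext (by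
    have h₁ := congrArg Prod.fst (pyrOf_map_eq hL hC h _ ((diagEquiv hL x).symm i).2)
    rw [codeMap_app_diag, codeMap_app_diag] at h₁
    rw [← pv_val, ← pv_val]
    exact h₁)) fun i j h h' => rfl

theorem mem_base (x : Fam L (Writer (Nested n))) (s : Pyr n) (v : ℕ × ℕ) :
    v ∈ (codeOf (n := n) hL ((topF hL (Nested n)).obj x)).carrier s ↔
      v ∈ (codeOf (n := n + 1) hL x).carrier (Pyr.base s) := by
  rw [codeOf_top]
  rfl

/-- The base, the tip and the rim of the pyramid show, in this order, the morphism of top faces (by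
induction), the outer permutation and the permutations of labels. -/
theorem hom_eq_of_codeMap (ih : (pyrOf hL hC n).Faithful) {x y : Fam L (Writer (Nested n))}
    (f g : x ⟶ y) (h : ∀ s, ∀ v ∈ (codeOf (n := n + 1) hL x).carrier s,
      (codeMap (n := n + 1) hL f).app s v = (codeMap (n := n + 1) hL g).app s v) : f = g := by
  refine families_hom_ext hL ?_ ?_ ?_
  · refine ih.map_injective (Iso.ext (NatTrans.ext (funext fun s =>
      ConcreteCategory.hom_ext _ _ fun v => Subtype.ext ?_)))
    refine (pyrOf_map_val hL hC _ s v).trans (Eq.trans ?_ (pyrOf_map_val hL hC _ s v).symm)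
    rw [codeMap_top_app, codeMap_top_app]
    exact h _ _ ((mem_base hL x s v.1).1 v.2)
  · intro a ha
    have h₂ := congrArg Prod.fst (h _ _ ((diagEquiv (n := n + 1) hL x).symm ⟨a, ha⟩).2)
    exact (codeMap_app_diag (n := n + 1) hL f _).symm.trans
      (h₂.trans (codeMap_app_diag (n := n + 1) hL g _))
  · intro a ha e he
    have h₂ := congrArg Prod.snd (h _ (a, e) ((mem_rim hL x _).2 ⟨ha, he⟩))
    rw [codeMap_app_rim, codeMap_app_rim] at h₂
    exact h₂

theorem pyrOf_faithful_succ (ih : (pyrOf hL hC n).Faithful) : (pyrOf hL hC (n + 1)).Faithful where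
  map_injective h := hom_eq_of_codeMap hL hC ih _ _ fun s _ hv => pyrOf_map_eq hL hC h s hv

end Faithful

/-! ### Fullness in every degree -/

section Full

open Simplicial Opposite Fam

variable {L : ℕ → Prop} [SeqClosed L] (hL : ∀ n, PosLength n → L n) {C : Type → Prop}
  (hC : ∀ T, C T ↔ Finite T ∧ L (Nat.card T)) {n : ℕ}

/-- The equivalence of sets underlying an isomorphism of diagrams. -/
def appEquiv {J : Type} [Category J] {S T : J ⥤ Type} (h : S ≅ T) (s : J) : S.obj s ≃ T.obj s :=
  (h.app s).toEquiv

theorem pyrOf_full_zero : (pyrOf hL hC 0).Full where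
  map_surjective {x y} h := by
    let π : Fin x.n ≃ Fin y.n := (diagEquiv hL x).symm.trans
      ((appEquiv h ⟨Fin.last 0, Fin.last 0, le_rfl⟩).trans (diagEquiv hL y))
    let f : x ⟶ y := ⟨π, fun _ _ _ => PUnit.unit⟩
    refine ⟨f, Iso.ext (NatTrans.ext (funext fun s => ConcreteCategory.hom_ext _ _ ?_))⟩
    obtain rfl : s = ⟨Fin.last 0, Fin.last 0, le_rfl⟩ :=
      Pyr.ext (Subsingleton.elim (α := Fin 1) _ _) (Subsingleton.elim (α := Fin 1) _ _)
    intro v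
    refine (diagEquiv hL y).injective (Fin.ext ?_)
    refine (codeMap_app_diag hL f v.1).trans ?_
    refine (pv_val f (diagEquiv hL x v)).trans ?_
    have h₁ : π (diagEquiv hL x v) = diagEquiv hL y (h.hom.app _ v) := by
      exact congrArg (fun w => diagEquiv hL y (h.hom.app _ w))
        ((diagEquiv hL x).symm_apply_apply v)
    exact congrArg Fin.val h₁

/-- The base of the pyramid of `x` has a code that is only provably equal to the code of the top
face. Allowing arbitrary equal codes makes fullness applicable to it. -/
theorem exists_hom_of_code (ih : (pyrOf hL hC n).Full) {x y : Simp L n} {c d : PyrCode L n}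
    (hc : codeOf hL x = c) (hd : codeOf hL y = d)
    (h : c.pyramid hL hC ⟶ d.pyramid hL hC) :
    ∃ g : x ⟶ y, ∀ s v hv, (codeMap hL g).app s v = (h.hom.app s ⟨v, hv⟩).1 := by
  subst hc hd
  obtain ⟨g, rfl⟩ := ih.map_surjective h
  exact ⟨g, fun s v hv => rfl⟩

/-- The map of a pyramid from the last rim to the last diagonal position of the base. -/
theorem res_rim (x : Fam L (Writer (Nested n)))
    (v : (codeOf (n := n + 1) hL x).diagram.obj (Pyr.rim (Fin.last n))) :
    (((pyrOf hL hC (n + 1)).obj x).res (Pyr.rim_le_base (Fin.last n)) v).1 = (v.1.1, 0) := by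
  have h := ((codeOf (n := n + 1) hL x).mem_diag _ _).1
    (((pyrOf hL hC (n + 1)).obj x).res (Pyr.rim_le_base (Fin.last n)) v).2
  exact Prod.ext ((codeOf (n := n + 1) hL x).anc_self _ v.2.1) h.2

theorem res_diag (x : Fam L (Writer (Nested n)))
    (v : (codeOf (n := n + 1) hL x).diagram.obj
      (Pyr.base (⟨Fin.last n, Fin.last n, le_rfl⟩ : Pyr n))) :
    (((pyrOf hL hC (n + 1)).obj x).res Pyr.diag_le_tip v).1.1 = par hL x v.1.1 :=
  congrFun (codeOf_anc_rim hL x) v.1.1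

/-- An element of the last diagonal position of the base. -/
noncomputable def diagElem (x : Fam L (Writer (Nested n)))
    (k : Fin ((flat hL (Nested n × Label)).obj x).n) :
    (codeOf (n := n + 1) hL x).diagram.obj (Pyr.base (⟨Fin.last n, Fin.last n, le_rfl⟩ : Pyr n)) :=
  ⟨(k, 0), (PyrCode.mem_diag _ _ _).2 ⟨k.2.trans_eq (codeOf_N_rim hL x).symm, rfl⟩⟩

/-- An isomorphism of pyramids yields `g` on top faces (by induction), an outer permutation `π` from
the tip, and label permutations from the rim. They assemble to a morphism of families because they
are compatible over the position (n, n). -/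
theorem exists_hom_succ (ih : (pyrOf hL hC n).Full) {x y : Fam L (Writer (Nested n))}
    (h : (pyrOf hL hC (n + 1)).obj x ⟶ (pyrOf hL hC (n + 1)).obj y) :
    ∃ f : x ⟶ y, (pyrOf hL hC (n + 1)).map f = h := by
  obtain ⟨g, hg⟩ := exists_hom_of_code hL hC ih (codeOf_top hL x) (codeOf_top hL y)
    ((Pyramid.restrict (castSuccHom n)).map h)
  let π : Fin x.n ≃ Fin y.n := (diagEquiv (n := n + 1) hL x).symm.trans
    ((appEquiv h (Pyr.tip n)).trans (diagEquiv (n := n + 1) hL y))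
  have hπ : ∀ w, diagEquiv (n := n + 1) hL y (h.hom.app (Pyr.tip n) w) =
      π (diagEquiv (n := n + 1) hL x w) := fun w =>
    (congrArg (fun w => diagEquiv (n := n + 1) hL y (h.hom.app (Pyr.tip n) w))
      ((diagEquiv (n := n + 1) hL x).symm_apply_apply w)).symm
  -- On the rim `h` covers the permutation of `g`, by naturality along the map from (n, n+1) to (n,
  -- n).
  have hrim : ∀ v, (h.hom.app (Pyr.rim (Fin.last n)) v).1.1 = pv g v.1.1 := fun v => by
    have h₁ := congrArg Subtype.val (Pyramid.app_res h.hom (Pyr.rim_le_base (Fin.last n)) v)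
    have h₂ := hg ⟨Fin.last n, Fin.last n, le_rfl⟩ _
      (((pyrOf hL hC (n + 1)).obj x).res (Pyr.rim_le_base (Fin.last n)) v).2
    have h₃ := (congrArg ((codeMap hL g).app _) (res_rim hL hC x v)).symm.trans
      (h₂.trans (h₁.trans (res_rim hL hC y _)))
    exact (congrArg Prod.fst h₃).symm.trans (codeMap_app_diag hL g _)
  -- The map from (n, n) to the tip is the parent map, so naturality of `h` says that `g` respects
  -- the blocks and permutes them by `π`.
  have hpar : ∀ k, (fpos hL y (Hom.perm g k)).1 = π (fpos hL x k).1 := fun k => by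
    have h₁ := congrArg (diagEquiv (n := n + 1) hL y)
      (Pyramid.app_res h.hom Pyr.diag_le_tip (diagElem hL x k))
    have h₂ := hg ⟨Fin.last n, Fin.last n, le_rfl⟩ _ (diagElem hL x k).2
    have h₃ : (h.hom.app _ (diagElem hL x k)).1.1 = Hom.perm g k :=
      (congrArg Prod.fst h₂).symm.trans ((codeMap_app_diag hL g _).trans (pv_val g k))
    have h₄ : diagEquiv (n := n + 1) hL x (((pyrOf hL hC (n + 1)).obj x).res Pyr.diag_le_tip
        (diagElem hL x k)) = (fpos hL x k).1 :=
      Fin.ext ((res_diag hL hC x (diagElem hL x k)).trans (par_val hL x k))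
    have h₅ := (congrArg Fin.val h₁).trans (res_diag hL hC y (h.hom.app _ (diagElem hL x k)))
    rw [h₃] at h₅
    refine Eq.trans ?_ ((hπ _).trans (congrArg π h₄))
    exact Fin.ext ((par_val hL y (Hom.perm g k)).symm.trans h₅.symm)
  let Φ := (rimEquiv hL x).symm.trans
    ((appEquiv h (Pyr.rim (Fin.last n))).trans (rimEquiv hL y))
  have hΦ : ∀ v, Φ (rimEquiv hL x v) = rimEquiv hL y (h.hom.app (Pyr.rim (Fin.last n)) v) :=
    fun v => rfl
  let σ := Hom.perm g
  -- The rim fibres over the nodes with the labels as fibres. As `h` covers `σ`, it restricts to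
  -- bijections of fibres, which serve as the morphisms of labels.
  obtain ⟨q, hq⟩ := exists_fibreEquiv Φ σ fun s => Fin.ext
    ((hrim ((rimEquiv hL x).symm s)).trans (pv_val g s.1))
  obtain ⟨φ, hφ, hφ'⟩ := exists_labelled_hom g q
  obtain ⟨f, hf, rfl⟩ := exists_flat_map hL φ π fun k => by
    refine Eq.trans ?_ (hpar k)
    rw [← hφ]
    rfl
  refine ⟨f, Iso.ext (Pyramid.hom_ext (S := (pyrOf hL hC (n + 1)).obj x)
    (T := (pyrOf hL hC (n + 1)).obj y) (fun s v => ?_) (fun v => ?_) fun v => ?_)⟩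
  · refine Subtype.ext ((codeMap_top_app hL f s v.1).symm.trans (Eq.trans ?_
      (hg s v.1 v.2)))
    exact congrArg (fun g => (codeMap hL g).app s v.1) hφ
  · refine Subtype.ext ((codeMap_app_rim hL f v.1).trans (Prod.ext ?_ ?_))
    · exact (congrArg (fun g => pv g v.1.1) hφ).trans (hrim v).symm
    · have h₁ := hφ' (rimEquiv hL x v).1 _ rfl (rimEquiv hL x v).2
      have h₂ := (hq _ _ rfl (rimEquiv hL x v).2).symm.trans (hΦ v)
      exact h₁.trans (congrArg (fun t => (t.2 : ℕ)) h₂)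
  · refine (diagEquiv (n := n + 1) hL y).injective (Fin.ext ?_)
    refine (codeMap_app_diag (n := n + 1) hL f v.1).trans ?_
    refine (pv_val f (diagEquiv (n := n + 1) hL x v)).trans ?_
    exact congrArg Fin.val ((hf _).trans (hπ v).symm)

theorem pyrOf_full_succ (ih : (pyrOf hL hC n).Full) : (pyrOf hL hC (n + 1)).Full where
  map_surjective h := exists_hom_succ hL hC ih h

end Full

end Plethysm

namespace Plethysm
universe v u

/-! ### Essential surjectivity in every degree -/

section EssSurj

open Simplicial Opposite Fam

variable {L : ℕ → Prop} [SeqClosed L] (hL : ∀ n, PosLength n → L n) {C : Type → Prop}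
  (hC : ∀ T, C T ↔ Finite T ∧ L (Nat.card T)) {n : ℕ}

theorem pyr_zero_eq (s : Pyr 0) : s = ⟨Fin.last 0, Fin.last 0, le_rfl⟩ :=
  Pyr.ext (Subsingleton.elim (α := Fin 1) _ _) (Subsingleton.elim (α := Fin 1) _ _)

theorem nonempty_iso_zero {S T : Pyr 0 ⥤ Type}
    (e : S.obj ⟨Fin.last 0, Fin.last 0, le_rfl⟩ ≃ T.obj ⟨Fin.last 0, Fin.last 0, le_rfl⟩) :
    Nonempty (S ≅ T) :=
  ⟨NatIso.ofComponents (fun s => S.mapIso (eqToIso (pyr_zero_eq s)) ≪≫ e.toIso ≪≫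
    T.mapIso (eqToIso (pyr_zero_eq s).symm)) fun {s t} f => by
      obtain rfl := pyr_zero_eq s
      obtain rfl := pyr_zero_eq t
      obtain rfl : f = 𝟙 _ := Subsingleton.elim _ _
      simp⟩

theorem pyrOf_essSurj_zero : (pyrOf hL hC 0).EssSurj where
  mem_essImage T := by
    have h := (hC _).1 (T.mem ⟨Fin.last 0, Fin.last 0, le_rfl⟩)
    have := h.1
    let e := Finite.equivFin (T.diagram.obj ⟨Fin.last 0, Fin.last 0, le_rfl⟩)
    let x : Simp L 0 := ⟨_, h.2, fun _ => (⟨⟩ : Pt)⟩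
    obtain ⟨i⟩ := nonempty_iso_zero (S := ((pyrOf hL hC 0).obj x).diagram) (T := T.diagram)
      ((diagEquiv hL x).trans e.symm)
    let j : (pyrOf hL hC 0).obj x ⟶ T := i
    exact ⟨x, ⟨asIso j⟩⟩

theorem exists_iso_of_code {c d : PyrCode L n} (h : c = d) {T : Pyramid C n}
    (i : c.pyramid hL hC ⟶ T) :
    ∃ j : d.pyramid hL hC ⟶ T, ∀ s v hv hv', j.hom.app s ⟨v, hv⟩ = i.hom.app s ⟨v, hv'⟩ := by
  subst h
  exact ⟨i, fun _ _ _ _ => rfl⟩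

/-- By induction the base of `T` comes from a forest `x₁`. Its roots are grouped by their images at
the tip and labelled by the sizes of the rim fibres; the resulting forest has a pyramid isomorphic
to `T`. -/
theorem exists_iso_succ (ih : (pyrOf hL hC n).EssSurj) (T : Pyramid C (n + 1)) :
    ∃ x : Fam L (Writer (Nested n)), Nonempty (((pyrOf hL hC (n + 1)).obj x).diagram ≅ T.diagram) := by
  obtain ⟨x₁, ⟨i⟩⟩ := ih.mem_essImage ((Pyramid.restrict (castSuccHom n)).obj T)
  have hfin : ∀ s, Finite (T.diagram.obj s) := fun s => ((hC _).1 (T.mem s)).1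
  have htip := hfin (Pyr.tip n)
  let e := Finite.equivFin (T.diagram.obj (Pyr.tip n))
  let ρ : Fin x₁.n ≃ T.diagram.obj (Pyr.base (⟨Fin.last n, Fin.last n, le_rfl⟩ : Pyr n)) :=
    (diagEquiv hL x₁).symm.trans (appEquiv i.hom ⟨Fin.last n, Fin.last n, le_rfl⟩)
  -- The fibre of the rim over the `k`-th root; it is finite and nonempty, so its cardinality is a
  -- legitimate label.
  let R : Fin x₁.n → Type := fun k =>
    {v : T.diagram.obj (Pyr.rim (Fin.last n)) // T.res (Pyr.rim_le_base _) v = ρ k}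
  have hR : ∀ k, Finite (R k) := fun k => by
    have := hfin (Pyr.rim (Fin.last n))
    exact Subtype.finite
  obtain ⟨x, g, hx, hg⟩ := exists_families hL x₁ ((hC _).1 (T.mem (Pyr.tip n))).2
    (fun k => e (T.res Pyr.diag_le_tip (ρ k)))
    (e.surjective.comp ((T.surjective (homOfLE Pyr.diag_le_tip)).comp ρ.surjective))
    (fun k => Nat.card (R k)) (fun k => by
      obtain ⟨v, hv⟩ := T.surjective (homOfLE (Pyr.rim_le_base (Fin.last n))) (ρ k)
      have : Nonempty (R k) := ⟨⟨v, hv⟩⟩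
      exact Nat.card_pos)
  obtain ⟨j, hj⟩ := exists_iso_of_code hL hC (codeOf_top hL x)
    ((pyrOf hL hC n).map g ≫ i.hom : (codeOf hL ((topF hL (Nested n)).obj x)).pyramid hL hC ⟶
      (Pyramid.restrict (castSuccHom n)).obj T)
  -- The isomorphism `j` of bases includes the reordering `g`. At (n, n) it is thus `ρ` after the
  -- permutation of `g`, and the rim and tip are matched through the same permutation.
  have hj' : ∀ v : ((pyrOf hL hC (n + 1)).obj x).diagram.obj
      (Pyr.base (⟨Fin.last n, Fin.last n, le_rfl⟩ : Pyr n)),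
      ∀ k : Fin x₁.n, pv g v.1.1 = k →
      j.hom.app ⟨Fin.last n, Fin.last n, le_rfl⟩ v = ρ k := fun v k hk => by
    have hv := (mem_base hL x ⟨Fin.last n, Fin.last n, le_rfl⟩ v.1).2 v.2
    refine (hj _ v.1 v.2 hv).trans (congrArg (i.hom.hom.app ⟨Fin.last n, Fin.last n, le_rfl⟩) ?_)
    exact ((diagEquiv hL x₁).eq_symm_apply).2
      (Fin.ext ((codeMap_app_diag hL g v.1).trans hk))
  let F : ∀ a : Fin ((topF hL (Nested n)).obj x).n,
      Fin (((flat hL (Nested n × Label)).obj x).el a).2.n ≃ R (Hom.perm g a) :=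
    fun a => (finCongr (hg a).2).trans (Finite.equivFin (R (Hom.perm g a))).symm
  -- The rim of the forest is the union of its labels, and the rim of `T` is the union of its
  -- fibres. Any bijections of the fibres over `ρ` will do, since only compatibility with the map to
  -- (n, n) is required.
  let β := (rimEquiv hL x).trans ((Equiv.sigmaCongr
    (β₂ := fun y => {v // T.res (Pyr.rim_le_base (Fin.last n)) v = y})
    ((Hom.perm g).trans ρ) F).trans (Equiv.sigmaFiberEquiv (T.res (Pyr.rim_le_base (Fin.last n)))))
  have hβ : ∀ v, T.res (Pyr.rim_le_base (Fin.last n)) (β v) = ρ (Hom.perm g (rimEquiv hL x v).1) :=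
    fun v => (F (rimEquiv hL x v).1 (rimEquiv hL x v).2).2
  let γ := (diagEquiv (n := n + 1) hL x).trans ((finCongr hx).trans e.symm)
  -- The remaining conditions are compatibility of the rim with (n, n), which is `hβ`, and of (n, n)
  -- with the tip, which holds because parents in `x` were defined by the map to the tip.
  have H := Pyramid.exists_iso (S := (pyrOf hL hC (n + 1)).obj x) (T := T)
    (fun s => appEquiv j s) β γ (fun {s t} h v => Pyramid.app_res j.hom h v) (fun v => by
      refine (hβ v).trans (hj' _ _ ?_).symm
      refine (congrArg (fun u => pv g (Prod.fst u)) (res_rim hL hC x v)).trans ?_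
      exact pv_val g (rimEquiv hL x v).1) (fun v => by
      let a : Fin ((topF hL (Nested n)).obj x).n := ⟨v.1.1, v.2.1.trans_eq (codeOf_N_rim hL x)⟩
      refine Eq.trans ?_
        (congrArg (T.res Pyr.diag_le_tip) (hj' v (Hom.perm g a) (pv_val g a))).symm
      refine (Equiv.symm_apply_eq e).2 (Fin.ext ?_)
      exact (res_diag hL hC x v).trans (hg a).1)
  exact ⟨x, H.elim fun h _ => ⟨h⟩⟩

theorem pyrOf_essSurj_succ (ih : (pyrOf hL hC n).EssSurj) : (pyrOf hL hC (n + 1)).EssSurj where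
  mem_essImage T := by
    obtain ⟨x, ⟨i⟩⟩ := exists_iso_succ hL hC ih T
    let j : (pyrOf hL hC (n + 1)).obj x ⟶ T := i
    exact ⟨x, ⟨asIso j⟩⟩

theorem pyrOf_isEquivalence : ∀ n, (pyrOf hL hC n).IsEquivalence := fun n =>
  { faithful := by
      induction n with
      | zero => exact pyrOf_faithful_zero hL hC
      | succ n ih => exact pyrOf_faithful_succ hL hC ih
    full := by
      induction n with
      | zero => exact pyrOf_full_zero hL hC
      | succ n ih => exact pyrOf_full_succ hL hC ih
    essSurj := by
      induction n with
      | zero => exact pyrOf_essSurj_zero hL hC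
      | succ n ih => exact pyrOf_essSurj_succ hL hC ih }

end EssSurj

/-! ### The equivalence of simplicial groupoids -/

section Equivalence

open Fam

theorem isEquivalence_of_isIso {A B : Grpd.{v, u}} (F : A ⟶ B) [IsIso F] :
    Functor.IsEquivalence (C := A) (D := B) F :=
  (CategoryTheory.Equivalence.mk (C := A) (D := B) F (inv F) (eqToIso (IsIso.hom_inv_id F).symm)
    (eqToIso (IsIso.inv_hom_id F))).isEquivalence_functor

/-- The bar construction of `TSym` relative to sequences with length in `L` is equivalent to the
pyramids of finite sets with cardinality in `L`. -/
theorem bar_symHom_equivalence {L : ℕ → Prop} [SeqClosed L] (hL : ∀ n, PosLength n → L n)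
    {C : Type → Prop} (hC : ∀ T, C T ↔ Finite T ∧ L (Nat.card T)) :
    SimplicialEquivalence (bar (symHom hL)) (pyramids C) := by
  -- The map `b` goes from the labelled model to the bar construction of `TSym` and is invertible.
  -- Its inverse followed by `toPyramids` has the required direction.
  let b := barHom (show labelMonad ⟶ TSym.{0, 1}.monad from writerMonadHom Sr Sym.toMon)
    (symHom hL)
  have h : IsIso b := barHom_isIso _ (fun X => writerMonadHom_isIso Sr Sym.toMon X) _
  refine ⟨inv b ≫ (symModel hL).toPyramids hL hC, fun n => ?_⟩
  have h₂ := isEquivalence_of_isIso ((inv b).app n)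
  have h₃ : Functor.IsEquivalence (C := (labelBar hL).obj n) (D := (pyramids C).obj n)
      (((symModel hL).toPyramids hL hC).app n) := pyrOf_isEquivalence hL hC n.unop.len
  exact @Functor.isEquivalence_trans _ _ _ _ _ _ _ _ h₂ h₃

end Equivalence

end Plethysm

theorem mainTheorem3 :
    Plethysm.SimplicialEquivalence (Plethysm.TSym.barRel Plethysm.SrToS) Plethysm.TS ∧
    Plethysm.SimplicialEquivalence Plethysm.TSym.bar Plethysm.TSpos := by
  constructor
  · exact Plethysm.bar_symHom_equivalence (L := Plethysm.AnyLength) (fun _ _ => trivial)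
      (fun _ => ⟨fun h => ⟨h, trivial⟩, fun h => h.1⟩)
  -- Here the inclusion of `PosLength` sequences into themselves is the identity, so `symHom` is the
  -- projection of `TSym` to S^r. A finite set has positive cardinality exactly if it is nonempty.
  · exact Plethysm.bar_symHom_equivalence (L := Plethysm.PosLength) (fun _ h => h)
      (fun _ => ⟨fun h => ⟨h.1, Nat.card_pos_iff.2 ⟨h.2, h.1⟩⟩,
        fun h => ⟨h.1, (Nat.card_pos_iff.1 h.2).1⟩⟩)
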